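/- Practical regular expressions (PRE) over an alphabet $\Sigma$ are built from the symbols of $\Sigma$ and back references $\backslash k$ ($k \ge 1$) by concatenation, union ($\mid$), the closure operator (star), and parentheses $(\ldots)$. The $k$-th pair of parentheses, counted by opening parentheses from left to right, defines variable $k$: when the subexpression inside it is matched to a string, this string becomes the value of variable $k$, and $\backslash k$ matches exactly the current value of variable $k$. Initially all variables are uninstantiated, and a reference to an uninstantiated variable matches nothing. An expression is valid only if at least $k$ opening parentheses stand to the left of every $\backslash k$ in it. The language $L(\alpha)$ is the set of strings matched by $\alpha$. Theorem. Consider valid PRE without closure operators over a single-letter alphabet $\{0\}$, written as strings over a finite set of tokens, with the numbers of back references in binary. Both of the following problems are complete for NP under logarithmic-space many-one reductions, i.e. each of them is in NP and every language in NP over a finite alphabet is reducible to it by a function computable in logarithmic space: (1) (Matching) given such an expression $\alpha$ and a string $s \in \{0\}^*$ (written out symbol by symbol), does some string in $L(\alpha)$ occur as a substring of $s$? (2) (Membership) given such an expression $\alpha$ and a string $s \in \{0\}^*$ (written out symbol by symbol), is $s \in L(\alpha)$? -/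

import Mathlib

/-! ## Turing machines, NP, and logarithmic-space reductions -/

namespace Complexity

/-- Directions of a head movement. -/
inductive Dir where
  | left
  | stay
  | right

/-- The displacement of a head on a two-way infinite tape. -/
def Dir.offset : Dir → ℤ
  | .left => -1
  | .stay => 0
  | .right => 1

/-- What a machine does in one step: the next state, the movement of the input head, the symbols
written on the work tapes, the movements of the work heads, and the symbol (if any) appended to the
write-only output tape. -/
structure Action (Q ι A Δ : Type) where
  next : Q
  inMove : Dir
  write : ι → A
  move : ι → Dir
  emit : Option Δ

/-- A nondeterministic multi-tape Turing machine with a two-way read-only input tape carrying a word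
over `Γ`, finitely many (indexed by `ι`) two-way infinite work tapes, and a one-way write-only output
tape over `Δ`. States, tapes and work symbols are finite in number. The transition relation `δ`
depends on the current state, the scanned input symbol (`none` for either endmarker), and the scanned
work symbols. -/
structure Machine (Γ Δ : Type) where
  Q : Type
  ι : Type
  A : Type
  finite_Q : Finite Q
  finite_ι : Finite ι
  finite_A : Finite A
  start : Q
  blank : A
  accept : Set Q
  δ : Q → Option Γ → (ι → A) → Action Q ι A Δ → Prop

namespace Machine

variable {Γ Δ : Type} (M : Machine Γ Δ)

/-- A configuration. The input head is at a position `0 ≤ inPos ≤ |w| + 1`, where the positions `0`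
and `|w| + 1` carry the endmarkers. -/
@[ext]
structure Cfg where
  state : M.Q
  inPos : ℕ
  tape : M.ι → ℤ → M.A
  head : M.ι → ℤ
  out : List Δ

/-- The initial configuration: everything blank, all work heads at `0`, the input head on the left
endmarker. -/
def initial : M.Cfg where
  state := M.start
  inPos := 0
  tape := fun _ _ => M.blank
  head := fun _ => 0
  out := []

/-- The symbol at a position of the input tape; `none` stands for an endmarker. -/
def readInput (w : List Γ) (p : ℕ) : Option Γ :=
  if p = 0 then none else w[p - 1]?

/-- Movement of the input head, which cannot leave the part between the endmarkers. -/
def moveInput (w : List Γ) (p : ℕ) : Dir → ℕ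
  | .left => p - 1
  | .stay => p
  | .right => min (p + 1) (w.length + 1)

/-- The effect of an action on a configuration. -/
def apply (w : List Γ) (c : M.Cfg) (a : Action M.Q M.ι M.A Δ) : M.Cfg where
  state := a.next
  inPos := moveInput w c.inPos a.inMove
  tape := fun i => Function.update (c.tape i) (c.head i) (a.write i)
  head := fun i => c.head i + (a.move i).offset
  out := c.out ++ a.emit.toList

/-- The one-step relation on input `w`. -/
def Step (w : List Γ) (c c' : M.Cfg) : Prop :=
  ∃ a, M.δ c.state (readInput w c.inPos) (fun i => c.tape i (c.head i)) a ∧ c' = M.apply w c a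

/-- `M.ReachesIn w t c`: some computation of `M` on `w` is in configuration `c` after exactly
`t` steps. -/
def ReachesIn (w : List Γ) : ℕ → M.Cfg → Prop
  | 0, c => c = M.initial
  | t + 1, c => ∃ b, ReachesIn w t b ∧ M.Step w b c

/-- Some computation of `M` on `w` is in an accepting state after exactly `t` steps. -/
def AcceptsIn (w : List Γ) (t : ℕ) : Prop :=
  ∃ c, M.ReachesIn w t c ∧ c.state ∈ M.accept

/-- A configuration without successor. -/
def Halted (w : List Γ) (c : M.Cfg) : Prop :=
  ∀ c', ¬ M.Step w c c'

/-- In every situation at most one action is possible. -/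
def Deterministic : Prop :=
  ∀ q x s a b, M.δ q x s a → M.δ q x s b → a = b

end Machine

/-- The class NP: some nondeterministic machine accepts exactly the words of `L`, and it accepts each
of them by a computation of polynomially bounded length. -/
def InNP {Γ : Type} (L : Language Γ) : Prop :=
  ∃ (M : Machine Γ Empty) (p : Polynomial ℕ), ∀ w : List Γ,
    (w ∈ L → ∃ t ≤ p.eval w.length, M.AcceptsIn w t) ∧
    ((∃ t, M.AcceptsIn w t) → w ∈ L)

/-- `f` is computed by a deterministic machine that halts on every input `w` and whose work heads
stay within distance `O(log |w|)` of their initial positions. -/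
def LogSpaceComputable {Γ Δ : Type} (f : List Γ → List Δ) : Prop :=
  ∃ (M : Machine Γ Δ) (c : ℕ), M.Deterministic ∧ ∀ w : List Γ,
    (∃ t b, M.ReachesIn w t b ∧ M.Halted w b ∧ b.out = f w) ∧
    (∀ t b, M.ReachesIn w t b → ∀ i, (b.head i).natAbs ≤ c * (Nat.log 2 w.length + 1))

/-- Logarithmic-space many-one reducibility. -/
def LogSpaceReducible {Γ Δ : Type} (L : Language Γ) (K : Language Δ) : Prop :=
  ∃ f : List Γ → List Δ, LogSpaceComputable f ∧ ∀ w, w ∈ L ↔ f w ∈ K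

/-- `K`, a language over a finite alphabet, is in NP, and every language in NP over any finite
alphabet is reducible to `K` in logarithmic space. -/
def NPCompleteLogSpace {Δ : Type} [Finite Δ] (K : Language Δ) : Prop :=
  InNP K ∧ ∀ (Γ : Type) [Finite Γ] (L : Language Γ), InNP L → LogSpaceReducible L K

end Complexity

/-! ## Practical regular expressions -/

/-- Parse trees of practical regular expressions over the alphabet `σ`. -/
inductive PRE (σ : Type) where
  /-- a single symbol -/
  | sym (a : σ)
  /-- the back reference to the `k`-th parenthesized subexpression -/
  | ref (k : ℕ)
  /-- alternation -/
  | alt (r s : PRE σ)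
  /-- concatenation -/
  | cat (r s : PRE σ)
  /-- Kleene closure -/
  | star (r : PRE σ)
  /-- a pair of parentheses, which defines the variable numbered by its opening parenthesis -/
  | group (r : PRE σ)

/-- The symbols used to write down expressions, and a separator. -/
inductive PREToken (σ : Type) where
  | letter (a : σ)
  | backslash
  | digit (b : Bool)
  | bar
  | asterisk
  | lparen
  | rparen
  | sep

/-- There are finitely many tokens over a finite alphabet. -/
instance {σ : Type} [Finite σ] : Finite (PREToken σ) := by
  refine Finite.of_injective (β := σ ⊕ Bool ⊕ Fin 6)
    (fun t => match t with
      | .letter a => Sum.inl a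
      | .digit b => Sum.inr (Sum.inl b)
      | .backslash => Sum.inr (Sum.inr 0)
      | .bar => Sum.inr (Sum.inr 1)
      | .asterisk => Sum.inr (Sum.inr 2)
      | .lparen => Sum.inr (Sum.inr 3)
      | .rparen => Sum.inr (Sum.inr 4)
      | .sep => Sum.inr (Sum.inr 5)) ?_
  intro x y h
  cases x <;> cases y <;> simp_all

namespace PRE

variable {σ : Type}

/-- The written form of an expression. All parentheses are those of `group`; numbers of back
references are written in binary, most significant digit first. -/
def toTokens : PRE σ → List (PREToken σ)
  | sym a => [.letter a]
  | ref k => .backslash :: (Nat.bits k).reverse.map .digit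
  | alt r s => r.toTokens ++ .bar :: s.toTokens
  | cat r s => r.toTokens ++ s.toTokens
  | star r => r.toTokens ++ [.asterisk]
  | group r => .lparen :: (r.toTokens ++ [.rparen])

/-- The top-level operation is alternation. -/
def IsAlt : PRE σ → Prop
  | alt _ _ => True
  | _ => False

/-- The top-level operation is concatenation. -/
def IsCat : PRE σ → Prop
  | cat _ _ => True
  | _ => False

/-- The tree is the parse tree of its written form, where closure binds more tightly than
concatenation, concatenation more tightly than alternation, and both binary operations associate to
the left. -/
def IsParseTree : PRE σ → Prop
  | sym _ => True
  | ref _ => True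
  | alt r s => r.IsParseTree ∧ s.IsParseTree ∧ ¬ s.IsAlt
  | cat r s => r.IsParseTree ∧ s.IsParseTree ∧ ¬ r.IsAlt ∧ ¬ s.IsAlt ∧ ¬ s.IsCat
  | star r => r.IsParseTree ∧ ¬ r.IsAlt ∧ ¬ r.IsCat
  | group r => r.IsParseTree

/-- The number of pairs of parentheses. -/
def groups : PRE σ → ℕ
  | sym _ => 0
  | ref _ => 0
  | alt r s => r.groups + s.groups
  | cat r s => r.groups + s.groups
  | star r => r.groups
  | group r => r.groups + 1

/-- If `n` opening parentheses stand to the left of the expression, then every back reference `k` in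
it has `k ≥ 1` and at least `k` opening parentheses to its left. -/
def RefsValid : ℕ → PRE σ → Prop
  | _, sym _ => True
  | n, ref k => 1 ≤ k ∧ k ≤ n
  | n, alt r s => r.RefsValid n ∧ s.RefsValid (n + r.groups)
  | n, cat r s => r.RefsValid n ∧ s.RefsValid (n + r.groups)
  | n, star r => r.RefsValid n
  | n, group r => r.RefsValid (n + 1)

/-- A valid expression. -/
def Valid (r : PRE σ) : Prop :=
  r.IsParseTree ∧ r.RefsValid 0

/-- No closure operator occurs. -/
def StarFree : PRE σ → Prop
  | sym _ => True
  | ref _ => True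
  | alt r s => r.StarFree ∧ s.StarFree
  | cat r s => r.StarFree ∧ s.StarFree
  | star _ => False
  | group r => r.StarFree

/-- `Matches n r e w e'`: the occurrence of `r` with `n` opening parentheses to its left matches the
word `w` when the values of the variables are `e` before and `e'` after the match. A variable with
value `none` is uninstantiated, and a reference to it matches nothing. -/
inductive Matches : ℕ → PRE σ → (ℕ → Option (List σ)) → List σ → (ℕ → Option (List σ)) → Prop
  | sym (n : ℕ) (a : σ) (e) : Matches n (sym a) e [a] e
  | ref (n k : ℕ) (e) (w : List σ) (h : e k = some w) : Matches n (ref k) e w e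
  | alt_left (n : ℕ) (r s : PRE σ) (e e') (w : List σ) (h : Matches n r e w e') :
      Matches n (alt r s) e w e'
  | alt_right (n : ℕ) (r s : PRE σ) (e e') (w : List σ) (h : Matches (n + r.groups) s e w e') :
      Matches n (alt r s) e w e'
  | cat (n : ℕ) (r s : PRE σ) (e e' e'') (u v : List σ) (hr : Matches n r e u e')
      (hs : Matches (n + r.groups) s e' v e'') : Matches n (cat r s) e (u ++ v) e''
  | star_nil (n : ℕ) (r : PRE σ) (e) : Matches n (star r) e [] e
  | star_cons (n : ℕ) (r : PRE σ) (e e' e'') (u v : List σ) (hr : Matches n r e u e')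
      (hs : Matches n (star r) e' v e'') : Matches n (star r) e (u ++ v) e''
  | group (n : ℕ) (r : PRE σ) (e e') (w : List σ) (h : Matches (n + 1) r e w e') :
      Matches n (group r) e w (Function.update e' (n + 1) (some w))

/-- The language described by an expression: initially all variables are uninstantiated. -/
def language (r : PRE σ) : Language σ :=
  {w | ∃ e', Matches 0 r (fun _ => none) w e'}

/-- The written form of an expression together with a string. -/
def encodeInstance (r : PRE σ) (s : List σ) : List (PREToken σ) :=
  r.toTokens ++ .sep :: s.map .letter

/-- The matching problem for expressions without closure operators: given an expression and a string
`s`, does some word of the language of the expression occur as a substring of `s`? -/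
def starFreeMatching (σ : Type) : Language (PREToken σ) :=
  {x | ∃ (r : PRE σ) (s : List σ), r.Valid ∧ r.StarFree ∧ x = encodeInstance r s ∧
    ∃ u ∈ r.language, u <:+: s}

/-- The membership problem for expressions without closure operators: given an expression and a
string `s`, does `s` belong to the language of the expression? -/
def starFreeMembership (σ : Type) : Language (PREToken σ) :=
  {x | ∃ (r : PRE σ) (s : List σ), r.Valid ∧ r.StarFree ∧ x = encodeInstance r s ∧ s ∈ r.language}

end PRE

/-! ## Multi-stack programs -/

namespace Complexity

/-! Membership in NP. Without closure operators every pair of parentheses is entered at most once,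
so a match is described by a trace: the sequence of matched letters and of parentheses opened,
skipped or closed. Nested groups share their letters, hence the trace of a match of `w` is no longer
than the written expression plus `w`. The value of a variable `k` can be read off from the trace: it
is the number of letters between the `k`-th opening parenthesis and its partner. A machine can
therefore guess parse and match together in one pass over the tokens (`Parse`, `Parse.sound`,
`Matches.parse`) and finally compare the number of letters with the length of `s`. Over one letter a
word occurs in `s` exactly when it is not longer than `s`, so matching and membership differ only in
this last comparison.

Hardness. A computation is laid out as a tableau on a torus with `2 ^ K` rows and `2 ^ (K + 1)`
columns, whose correctness is a condition on windows of two by two cells. In the direction of time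
the torus closes up through rows that show nothing and a row that shows the input; from a
configuration these rows can be reached only through an accepting state. So tableaux exist exactly
for accepted words (`IsTableau.accepts`, `AcceptsIn.exists_isTableau`). For every cell of the torus
the expression contains a chooser `((0)|(0)|...|(0))`, which instantiates exactly one of its inner
variables; the position of that variable is the code of the chosen tile. A reference to an
uninstantiated variable fails, so four references in a row test that a window carries four given
codes, an alternation of such tests checks that the window is allowed, and single references fix the
input row. Hence the language of the expression is empty if there is no tiling
(`isTiling_of_matches`), and otherwise it contains a unary word whose length depends on `K` alone
(`replicate_mem_language`). This settles both problems at once. As the problems speak about written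
expressions, the reduction also needs unique readability (`encodeInstance_inj`).

Logarithmic space. The choosers come in blocks of `2 ^ D` variables, so the number of a variable is
a leading one followed by the binary digits of row, column and code (`toTokens_ref_tileVar`). A few
binary counters of logarithmic width are enough to print everything.

Machines are not written down directly: structured programs on stacks are compiled to them step by
step. For space, no action of the deterministic program decreases the total height of the stacks, so
that only the height at the end has to be estimated. -/

/-- An operation on a stack. -/
inductive StackOp (A : Type) where
  | keep
  | pop
  | push (a : A)
  | set (a : A)

namespace StackOp

variable {A : Type}

/-- The effect of an operation on the contents of a stack, top first. -/
def run : StackOp A → List A → List A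
  | keep, l => l
  | pop, l => l.tail
  | push a, l => a :: l
  | set _, [] => []
  | set a, _ :: l => a :: l

/-- The cached top after an operation. -/
def cacheAfter : StackOp A → Option A → Option A
  | keep, c => c
  | pop, _ => none
  | push a, _ => some a
  | set a, some _ => some a
  | set _, none => none

/-- The symbol written by the machine that carries out an operation. -/
def writeAfter : StackOp A → Option A → Option A → Option A
  | keep, _, x => x
  | pop, _, x => x
  | push _, some b, _ => some b
  | push _, none, x => x
  | set _, some _, x => x
  | set _, none, none => none
  | set a, none, some _ => some a

/-- The head movement of the machine that carries out an operation. -/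
def moveAfter : StackOp A → Option A → Option A → Dir
  | keep, _, _ => .stay
  | pop, some _, _ => .left
  | pop, none, none => .stay
  | pop, none, some _ => .left
  | push _, _, _ => .right
  | set _, _, _ => .stay

end StackOp

/-- The cells `1, …, h` of a tape contain a stack, top first, and cell `0` is blank. -/
def StackBelow {A : Type} (tp : ℤ → Option A) : ℤ → List A → Prop
  | h, [] => h = 0 ∧ tp 0 = none
  | h, a :: l => tp h = some a ∧ StackBelow tp (h - 1) l

theorem StackBelow.height {A : Type} {tp : ℤ → Option A} :
    ∀ {l : List A} {h : ℤ}, StackBelow tp h l → h = l.length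
  | [], _, hb => hb.1
  | a :: l, h, hb => by
    have := StackBelow.height hb.2
    simp only [List.length_cons, Nat.cast_add, Nat.cast_one]
    linarith

theorem StackBelow.congr {A : Type} {tp tp' : ℤ → Option A} :
    ∀ {l : List A} {h : ℤ}, StackBelow tp h l → (∀ z ≤ h, tp z = tp' z) → StackBelow tp' h l
  | [], _, hb, hc => ⟨hb.1, by rw [← hc 0 (by rw [hb.1]), hb.2]⟩
  | a :: l, h, hb, hc =>
    ⟨by rw [← hc h le_rfl, hb.1], StackBelow.congr hb.2 fun z hz => hc z (by omega)⟩

/-- A tape with its head position and a cached top represents a stack. -/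
def StackRep {A : Type} (tp : ℤ → Option A) (h : ℤ) : Option A → List A → Prop
  | none, l => StackBelow tp h l
  | some a, l => ∃ l', l = a :: l' ∧ StackBelow tp (h - 1) l'

/-- The top is either in the cache or under the head; the blank cell `0` signals the empty stack. So
the machine sees the top without moving. -/
theorem StackRep.top {A : Type} {tp : ℤ → Option A} {h : ℤ} {c : Option A} {l : List A}
    (hr : StackRep tp h c l) : (c <|> tp h) = l.head? := by
  cases c with
  | some a => obtain ⟨l', rfl, -⟩ := hr; rfl
  | none =>
    cases l with
    | nil => obtain ⟨rfl, h0⟩ := hr; simpa using h0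
    | cons a l => simpa using hr.1

theorem StackRep.natAbs_le {A : Type} {tp : ℤ → Option A} {h : ℤ} {c : Option A} {l : List A}
    (hr : StackRep tp h c l) : h.natAbs ≤ l.length := by
  cases c with
  | some a =>
    obtain ⟨l', rfl, hb⟩ := hr
    have := hb.height
    simp only [List.length_cons]; omega
  | none => have := StackBelow.height hr; omega

/-- A machine writes before it moves, so a pushed symbol cannot reach the cell above the head in the
same step. It waits in the cache and is written down by the next push. Popped symbols stay on the
tape above the head, where `StackBelow` does not look. Thus every operation costs exactly one step.
-/
theorem StackRep.step {A : Type} {tp : ℤ → Option A} {h : ℤ} {c : Option A} {l : List A}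
    (hr : StackRep tp h c l) (op : StackOp A) :
    StackRep (Function.update tp h (op.writeAfter c (tp h))) (h + (op.moveAfter c (tp h)).offset)
      (op.cacheAfter c) (op.run l) := by
  cases op with
  | keep =>
    simpa [StackOp.writeAfter, StackOp.moveAfter, StackOp.cacheAfter, StackOp.run, Dir.offset]
      using hr
  | pop =>
    cases c with
    | some a =>
      obtain ⟨l', rfl, hb⟩ := hr
      simpa [StackOp.writeAfter, StackOp.moveAfter, StackOp.cacheAfter, StackOp.run, Dir.offset,
        StackRep, ← sub_eq_add_neg] using hb
    | none =>
      cases l with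
      | nil =>
        obtain ⟨rfl, h0⟩ := hr
        simp [StackOp.writeAfter, StackOp.moveAfter, StackOp.cacheAfter, StackOp.run, Dir.offset,
          StackRep, h0, StackBelow]
      | cons a l =>
        obtain ⟨ht, hb⟩ := hr
        simp only [StackOp.writeAfter, StackOp.moveAfter, ht, StackOp.cacheAfter, StackOp.run,
          Dir.offset, StackRep, ← sub_eq_add_neg, List.tail_cons]
        rwa [← ht, Function.update_eq_self]
  | push a =>
    cases c with
    | some b =>
      obtain ⟨l', rfl, hb⟩ := hr
      refine ⟨b :: l', rfl, ?_, ?_⟩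
      · simp [StackOp.writeAfter, StackOp.moveAfter, Dir.offset]
      · simp only [StackOp.writeAfter, StackOp.moveAfter, Dir.offset, add_sub_cancel_right]
        exact hb.congr fun z hz => by rw [Function.update_of_ne (by omega)]
    | none =>
      refine ⟨l, rfl, ?_⟩
      simpa [StackOp.writeAfter, StackOp.moveAfter, Dir.offset, StackRep] using hr
  | set a =>
    cases c with
    | some b =>
      obtain ⟨l', rfl, hb⟩ := hr
      refine ⟨l', rfl, ?_⟩
      simpa [StackOp.writeAfter, StackOp.moveAfter, Dir.offset] using hb
    | none =>
      cases l with
      | nil =>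
        obtain ⟨rfl, h0⟩ := hr
        simp [StackOp.writeAfter, StackOp.moveAfter, StackOp.cacheAfter, StackOp.run, Dir.offset,
          StackRep, h0, StackBelow]
      | cons b l =>
        obtain ⟨ht, hb⟩ := hr
        simp only [StackOp.writeAfter, StackOp.moveAfter, StackOp.cacheAfter, StackOp.run,
          Dir.offset, StackRep, ht, add_zero]
        exact ⟨by simp, hb.congr fun z hz => by rw [Function.update_of_ne (by omega)]⟩

/-- The effect of one step of a program. -/
structure Effect (Δ ι A : Type) where
  inMove : Dir
  ops : ι → StackOp A
  emit : Option Δ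

/-- The effect that changes nothing. -/
def Effect.idle {Δ ι A : Type} : Effect Δ ι A := ⟨.stay, fun _ => .keep, none⟩

/-- The memory of a program: the position of the input head, the stacks (top first), the output. -/
@[ext]
structure Mem (Δ ι A : Type) where
  pos : ℕ
  stk : ι → List A
  out : List Δ

/-- The tops of the stacks. -/
def Mem.tops {Δ ι A : Type} (m : Mem Δ ι A) : ι → Option A := fun i => (m.stk i).head?

/-- Carrying out an effect. -/
def Mem.apply {Γ Δ ι A : Type} (w : List Γ) (m : Mem Δ ι A) (e : Effect Δ ι A) : Mem Δ ι A :=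
  ⟨Machine.moveInput w m.pos e.inMove, fun i => (e.ops i).run (m.stk i), m.out ++ e.emit.toList⟩

@[simp]
theorem Mem.apply_idle {Γ Δ ι A : Type} (w : List Γ) (m : Mem Δ ι A) :
    m.apply w Effect.idle = m := by
  simp [Mem.apply, Effect.idle, Machine.moveInput, StackOp.run]

/-- Structured nondeterministic programs that work on stacks, read the input and produce output. -/
inductive Prog (Γ Δ ι A : Type) where
  | act (f : Option Γ → (ι → Option A) → Option (Effect Δ ι A))
  | seq (p q : Prog Γ Δ ι A)
  | ite (c : Option Γ → (ι → Option A) → Bool) (p q : Prog Γ Δ ι A)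
  | loop (c : Option Γ → (ι → Option A) → Bool) (p : Prog Γ Δ ι A)
  | choice (p q : Prog Γ Δ ι A)
  | star (p : Prog Γ Δ ι A)

/-! ### Small-step semantics of programs and their compilation to machines. -/

namespace Prog

variable {Γ Δ ι A : Type}

/-- One step of a list of programs to be run one after the other. -/
inductive PStep (x : Option Γ) (s : ι → Option A) :
    List (Prog Γ Δ ι A) → List (Prog Γ Δ ι A) → Effect Δ ι A → Prop
  | act (f k e) (h : f x s = some e) : PStep x s (act f :: k) k e
  | seq (p q k) : PStep x s (seq p q :: k) (p :: q :: k) .idle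
  | ite (c p q k) : PStep x s (ite c p q :: k) (bif c x s then p :: k else q :: k) .idle
  | loop (c p k) : PStep x s (loop c p :: k) (bif c x s then p :: loop c p :: k else k) .idle
  | choice_left (p q k) : PStep x s (choice p q :: k) (p :: k) .idle
  | choice_right (p q k) : PStep x s (choice p q :: k) (q :: k) .idle
  | star_nil (p k) : PStep x s (star p :: k) k .idle
  | star_cons (p k) : PStep x s (star p :: k) (p :: star p :: k) .idle

/-- The continuations that can occur before `k` while `p :: k` is run. -/
def conts : Prog Γ Δ ι A → List (Prog Γ Δ ι A) → Set (List (Prog Γ Δ ι A))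
  | act f, k => {act f :: k}
  | seq p q, k => {seq p q :: k} ∪ (conts p (q :: k) ∪ conts q k)
  | ite c p q, k => {ite c p q :: k} ∪ (conts p k ∪ conts q k)
  | loop c p, k => {loop c p :: k} ∪ conts p (loop c p :: k)
  | choice p q, k => {choice p q :: k} ∪ (conts p k ∪ conts q k)
  | star p, k => {star p :: k} ∪ conts p (star p :: k)

/-- This makes the state set of the compiled machine finite: the body of a loop is run in front of
the loop itself, so unfolding a loop creates no new programs. -/
theorem finite_conts (p : Prog Γ Δ ι A) : ∀ k, (conts p k).Finite := by
  induction p with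
  | act f => intro k; exact Set.finite_singleton _
  | seq p q hp hq => intro k; exact (Set.finite_singleton _).union ((hp _).union (hq _))
  | ite c p q hp hq => intro k; exact (Set.finite_singleton _).union ((hp _).union (hq _))
  | loop c p hp => intro k; exact (Set.finite_singleton _).union (hp _)
  | choice p q hp hq => intro k; exact (Set.finite_singleton _).union ((hp _).union (hq _))
  | star p hp => intro k; exact (Set.finite_singleton _).union (hp _)

theorem self_mem_conts (p : Prog Γ Δ ι A) (k) : p :: k ∈ conts p k := by
  cases p <;> simp [conts]

/-- The exit `k` does not belong to the set in general; allowing it as a second outcome lets the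
induction pass from the parts of a program to the whole. -/
theorem conts_closed (p : Prog Γ Δ ι A) : ∀ k l l' x s e, l ∈ conts p k → PStep x s l l' e →
    l' ∈ conts p k ∨ l' = k := by
  induction p with
  | act f =>
    rintro k l l' x s e rfl h
    cases h; exact .inr rfl
  | seq p q hp hq =>
    rintro k l l' x s e (rfl | hl | hl) h
    · cases h; exact .inl (.inr (.inl (self_mem_conts _ _)))
    · rcases hp _ _ _ _ _ _ hl h with h | rfl
      · exact .inl (.inr (.inl h))
      · exact .inl (.inr (.inr (self_mem_conts _ _)))
    · rcases hq _ _ _ _ _ _ hl h with h | rfl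
      · exact .inl (.inr (.inr h))
      · exact .inr rfl
  | ite c p q hp hq =>
    rintro k l l' x s e (rfl | hl | hl) h
    · cases h
      cases c x s
      · exact .inl (.inr (.inr (self_mem_conts _ _)))
      · exact .inl (.inr (.inl (self_mem_conts _ _)))
    · rcases hp _ _ _ _ _ _ hl h with h | rfl
      · exact .inl (.inr (.inl h))
      · exact .inr rfl
    · rcases hq _ _ _ _ _ _ hl h with h | rfl
      · exact .inl (.inr (.inr h))
      · exact .inr rfl
  | loop c p hp =>
    rintro k l l' x s e (rfl | hl) h
    · cases h
      cases c x s
      · exact .inr rfl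
      · exact .inl (.inr (self_mem_conts _ _))
    · rcases hp _ _ _ _ _ _ hl h with h | rfl
      · exact .inl (.inr h)
      · exact .inl (.inl rfl)
  | choice p q hp hq =>
    rintro k l l' x s e (rfl | hl | hl) h
    · cases h
      · exact .inl (.inr (.inl (self_mem_conts _ _)))
      · exact .inl (.inr (.inr (self_mem_conts _ _)))
    · rcases hp _ _ _ _ _ _ hl h with h | rfl
      · exact .inl (.inr (.inl h))
      · exact .inr rfl
    · rcases hq _ _ _ _ _ _ hl h with h | rfl
      · exact .inl (.inr (.inr h))
      · exact .inr rfl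
  | star p hp =>
    rintro k l l' x s e (rfl | hl) h
    · cases h
      · exact .inr rfl
      · exact .inl (.inr (self_mem_conts _ _))
    · rcases hp _ _ _ _ _ _ hl h with h | rfl
      · exact .inl (.inr h)
      · exact .inl (.inl rfl)

/-- The continuations that occur while `p` is run. -/
def reach (p : Prog Γ Δ ι A) : Set (List (Prog Γ Δ ι A)) := insert [] (conts p [])

theorem finite_reach (p : Prog Γ Δ ι A) : (reach p).Finite := (finite_conts p []).insert _

theorem reach_closed {p : Prog Γ Δ ι A} {l l' x s e} (hl : l ∈ reach p) (h : PStep x s l l' e) :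
    l' ∈ reach p := by
  rcases hl with rfl | hl
  · cases h
  · rcases conts_closed p _ _ _ _ _ _ hl h with h | rfl
    · exact .inr h
    · exact .inl rfl

/-- The machine that runs a program. -/
def machine (p : Prog Γ Δ ι A) (hι : Finite ι) (hA : Finite A) : Machine Γ Δ where
  Q := reach p × (ι → Option A)
  ι := ι
  A := Option A
  finite_Q := by
    have := (finite_reach p).to_subtype
    infer_instance
  finite_ι := hι
  finite_A := inferInstance
  start := (⟨[p], .inr (self_mem_conts p [])⟩, fun _ => none)
  blank := none
  accept := {q | q.1.1 = []}
  δ q x s a := ∃ (k : reach p) (e : Effect Δ ι A),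
    PStep x (fun i => q.2 i <|> s i) q.1.1 k.1 e ∧
    a = ⟨(k, fun i => (e.ops i).cacheAfter (q.2 i)), e.inMove,
      fun i => (e.ops i).writeAfter (q.2 i) (s i), fun i => (e.ops i).moveAfter (q.2 i) (s i),
      e.emit⟩

/-- Runs of exactly `t` steps. -/
inductive Run (w : List Γ) : ℕ → List (Prog Γ Δ ι A) → Mem Δ ι A →
    List (Prog Γ Δ ι A) → Mem Δ ι A → Prop
  | zero (k m) : Run w 0 k m k m
  | succ {t k m k' e k'' m''} (h : PStep (Machine.readInput w m.pos) m.tops k k' e)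
      (hr : Run w t k' (m.apply w e) k'' m'') : Run w (t + 1) k m k'' m''

theorem Run.trans {w : List Γ} {t t' : ℕ} {k k' k'' : List (Prog Γ Δ ι A)} {m m' m'' : Mem Δ ι A}
    (h : Run w t k m k' m') (h' : Run w t' k' m' k'' m'') : Run w (t + t') k m k'' m'' := by
  induction h with
  | zero => simpa using h'
  | succ hs _ ih =>
    rw [Nat.add_right_comm]
    exact .succ hs (ih h')

theorem Run.one {w : List Γ} {k k' : List (Prog Γ Δ ι A)} {m : Mem Δ ι A} {e}
    (h : PStep (Machine.readInput w m.pos) m.tops k k' e) : Run w 1 k m k' (m.apply w e) :=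
  .succ h (.zero _ _)

theorem Run.split {w : List Γ} : ∀ {t t' : ℕ} {k k'' : List (Prog Γ Δ ι A)} {m m'' : Mem Δ ι A},
    Run w (t + t') k m k'' m'' → ∃ k' m', Run w t k m k' m' ∧ Run w t' k' m' k'' m''
  | 0, t', k, k'', m, m'', h => ⟨k, m, .zero _ _, by simpa using h⟩
  | t + 1, t', k, k'', m, m'', h => by
    rw [Nat.add_right_comm] at h
    cases h with
    | succ hs hr =>
      obtain ⟨k', m', h1, h2⟩ := Run.split hr
      exact ⟨k', m', .succ hs h1, h2⟩

/-- The initial memory. -/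
def _root_.Complexity.Mem.init : Mem Δ ι A := ⟨0, fun _ => [], []⟩

/-- A configuration of the machine represents a continuation and a memory. -/
structure Represents {p : Prog Γ Δ ι A} {hι : Finite ι} {hA : Finite A}
    (c : (machine p hι hA).Cfg) (k : List (Prog Γ Δ ι A)) (m : Mem Δ ι A) : Prop where
  cont : c.state.1.1 = k
  pos : c.inPos = m.pos
  out : c.out = m.out
  stk : ∀ i, StackRep (c.tape i) (c.head i) (c.state.2 i) (m.stk i)

/-! ### Step-by-step correspondence of machine and program. -/

section Simulation

variable {p : Prog Γ Δ ι A} {hι : Finite ι} {hA : Finite A}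

theorem represents_initial :
    Represents (machine p hι hA).initial [p] (Mem.init : Mem Δ ι A) :=
  ⟨rfl, rfl, rfl, fun _ => ⟨rfl, rfl⟩⟩

theorem Represents.apply {c : (machine p hι hA).Cfg} {k m} (hc : Represents c k m) (w : List Γ)
    (e : Effect Δ ι A) (k' : reach p) :
    Represents ((machine p hι hA).apply w c ⟨(k', fun i => (e.ops i).cacheAfter (c.state.2 i)),
      e.inMove, fun i => (e.ops i).writeAfter (c.state.2 i) (c.tape i (c.head i)),
      fun i => (e.ops i).moveAfter (c.state.2 i) (c.tape i (c.head i)), e.emit⟩) k'.1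
      (m.apply w e) := by
  refine ⟨rfl, ?_, ?_, fun i => (hc.stk i).step (e.ops i)⟩
  · simp [Machine.apply, Mem.apply, hc.pos]
  · simp [Machine.apply, Mem.apply, hc.out]

theorem Represents.tops {c : (machine p hι hA).Cfg} {k m} (hc : Represents c k m) :
    (fun i => Option.orElse (c.state.2 i) fun _ => (c.tape i (c.head i) : Option A)) = m.tops :=
  funext fun i => (hc.stk i).top

theorem Represents.step {c : (machine p hι hA).Cfg} {k m} (hc : Represents c k m) {w : List Γ}
    {c'} (h : (machine p hι hA).Step w c c') :
    ∃ k' e, PStep (Machine.readInput w m.pos) m.tops k k' e ∧ Represents c' k' (m.apply w e) := by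
  obtain ⟨a, ⟨k', e, hs, rfl⟩, rfl⟩ := h
  refine ⟨k'.1, e, ?_, hc.apply w e k'⟩
  rw [← hc.tops, ← hc.pos, ← hc.cont]
  exact hs

theorem Represents.step_of_pstep {c : (machine p hι hA).Cfg} {k m} (hc : Represents c k m)
    {w : List Γ} {k' e} (h : PStep (Machine.readInput w m.pos) m.tops k k' e) :
    ∃ c', (machine p hι hA).Step w c c' ∧ Represents c' k' (m.apply w e) := by
  rw [← hc.tops, ← hc.pos, ← hc.cont] at h
  exact ⟨_, ⟨_, ⟨⟨k', reach_closed c.state.1.2 h⟩, e, h, rfl⟩, rfl⟩, hc.apply w e _⟩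

/-- Steps of machine and program correspond one to one in both directions, so running times agree
exactly and no nondeterministic branch is gained or lost. -/
theorem run_of_reachesIn {w : List Γ} : ∀ {t : ℕ} {c}, (machine p hι hA).ReachesIn w t c →
    ∃ k m, Run w t [p] Mem.init k m ∧ Represents c k m
  | 0, _, h => ⟨_, _, .zero _ _, h ▸ represents_initial⟩
  | t + 1, c, ⟨b, hb, hs⟩ => by
    obtain ⟨k, m, hr, hc⟩ := run_of_reachesIn hb
    obtain ⟨k', e, h1, h2⟩ := hc.step hs
    exact ⟨k', _, hr.trans (.one h1), h2⟩

theorem reachesIn_of_run {w : List Γ} : ∀ {t : ℕ} {k m}, Run w t [p] Mem.init k m →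
    ∃ c, (machine p hι hA).ReachesIn w t c ∧ Represents c k m
  | 0, _, _, h => by cases h; exact ⟨_, rfl, represents_initial⟩
  | t + 1, k, m, h => by
    obtain ⟨k1, m1, h1, h2⟩ := h.split
    obtain ⟨c, hc, hr⟩ := reachesIn_of_run h1
    cases h2 with
    | succ hs hz =>
      cases hz
      obtain ⟨c', h3, h4⟩ := hr.step_of_pstep hs
      exact ⟨c', ⟨c, hc, h3⟩, h4⟩

end Simulation

/-- `Exec w p m t m'`: the program `p` can lead from `m` to `m'` in exactly `t` steps. -/
inductive Exec (w : List Γ) : Prog Γ Δ ι A → Mem Δ ι A → ℕ → Mem Δ ι A → Prop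
  | act {f m e} (h : f (Machine.readInput w m.pos) m.tops = some e) :
      Exec w (act f) m 1 (m.apply w e)
  | seq {p q m t m' t' m''} (hp : Exec w p m t m') (hq : Exec w q m' t' m'') :
      Exec w (seq p q) m (t + t' + 1) m''
  | ite_true {c p q m t m'} (h : c (Machine.readInput w m.pos) m.tops = true)
      (hp : Exec w p m t m') : Exec w (ite c p q) m (t + 1) m'
  | ite_false {c p q m t m'} (h : c (Machine.readInput w m.pos) m.tops = false)
      (hp : Exec w q m t m') : Exec w (ite c p q) m (t + 1) m'
  | loop_true {c p m t m' t' m''} (h : c (Machine.readInput w m.pos) m.tops = true)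
      (hp : Exec w p m t m') (hq : Exec w (loop c p) m' t' m'') :
      Exec w (loop c p) m (t + t' + 1) m''
  | loop_false {c p m} (h : c (Machine.readInput w m.pos) m.tops = false) :
      Exec w (loop c p) m 1 m
  | choice_left {p q m t m'} (hp : Exec w p m t m') : Exec w (choice p q) m (t + 1) m'
  | choice_right {p q m t m'} (hp : Exec w q m t m') : Exec w (choice p q) m (t + 1) m'
  | star_nil {p m} : Exec w (star p) m 1 m
  | star_cons {p m t m' t' m''} (hp : Exec w p m t m') (hq : Exec w (star p) m' t' m'') :
      Exec w (star p) m (t + t' + 1) m''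

theorem Run.head {w : List Γ} {k k' k'' : List (Prog Γ Δ ι A)} {m m'' : Mem Δ ι A} {t : ℕ}
    (h : PStep (Machine.readInput w m.pos) m.tops k k' .idle)
    (hr : Run w t k' m k'' m'') : Run w (t + 1) k m k'' m'' :=
  .succ h (by simpa using hr)

/-- Every rule of `Exec` counts one extra step for the transition that unfolds its program, so the
time is the same on both sides. -/
theorem Exec.run {w : List Γ} {p : Prog Γ Δ ι A} {m t m'} (h : Exec w p m t m') :
    ∀ k, Run w t (p :: k) m k m' := by
  induction h with
  | act h => intro k; exact .one (.act _ _ _ h)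
  | seq _ _ hp hq => intro k; exact .head (.seq _ _ _) ((hp _).trans (hq _))
  | ite_true h _ ih =>
    intro k
    refine .head (.ite _ _ _ _) ?_
    simpa [h] using ih k
  | ite_false h _ ih =>
    intro k
    refine .head (.ite _ _ _ _) ?_
    simpa [h] using ih k
  | loop_true h _ _ hp hq =>
    intro k
    refine .head (.loop _ _ _) ?_
    simpa [h] using (hp _).trans (hq _)
  | loop_false h =>
    intro k
    refine .head (.loop _ _ _) ?_
    simpa [h] using Run.zero _ _
  | choice_left _ ih => intro k; exact .head (.choice_left _ _ _) (ih k)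
  | choice_right _ ih => intro k; exact .head (.choice_right _ _ _) (ih k)
  | star_nil => intro k; exact .head (.star_nil _ _) (.zero _ _)
  | star_cons _ _ hp hq => intro k; exact .head (.star_cons _ _) ((hp _).trans (hq _))

/-- Running a list of programs one after the other. -/
def ExecAll (w : List Γ) : List (Prog Γ Δ ι A) → Mem Δ ι A → Mem Δ ι A → Prop
  | [], m, m' => m = m'
  | p :: k, m, m'' => ∃ t m', Exec w p m t m' ∧ ExecAll w k m' m''

/-- A terminated run is regrouped from its end: the first transition tells how the programs finished
afterwards are to be combined. The times are forgotten, since this direction serves soundness only.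
-/
theorem Run.execAll {w : List Γ} {t : ℕ} {k k' : List (Prog Γ Δ ι A)} {m m' : Mem Δ ι A}
    (h : Run w t k m k' m') (hk : k' = []) : ExecAll w k m m' := by
  induction h with
  | zero => subst hk; rfl
  | succ hs _ ih =>
    have ih := ih hk
    cases hs with
    | act f k e h => exact ⟨_, _, .act h, ih⟩
    | seq p q k =>
      rw [Mem.apply_idle] at ih
      obtain ⟨t, m1, h1, t', m2, h2, h3⟩ := ih
      exact ⟨_, _, .seq h1 h2, h3⟩
    | ite c p q k =>
      rw [Mem.apply_idle] at ih
      generalize hb : c _ _ = b at ih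
      cases b
      · obtain ⟨t, m1, h1, h2⟩ := ih
        exact ⟨_, _, .ite_false hb h1, h2⟩
      · obtain ⟨t, m1, h1, h2⟩ := ih
        exact ⟨_, _, .ite_true hb h1, h2⟩
    | loop c p k =>
      rw [Mem.apply_idle] at ih
      generalize hb : c _ _ = b at ih
      cases b
      · exact ⟨_, _, .loop_false hb, ih⟩
      · obtain ⟨t, m1, h1, t', m2, h2, h3⟩ := ih
        exact ⟨_, _, .loop_true hb h1 h2, h3⟩
    | choice_left p q k =>
      rw [Mem.apply_idle] at ih
      obtain ⟨t, m1, h1, h2⟩ := ih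
      exact ⟨_, _, .choice_left h1, h2⟩
    | choice_right p q k =>
      rw [Mem.apply_idle] at ih
      obtain ⟨t, m1, h1, h2⟩ := ih
      exact ⟨_, _, .choice_right h1, h2⟩
    | star_nil p k =>
      rw [Mem.apply_idle] at ih
      exact ⟨_, _, .star_nil, ih⟩
    | star_cons p k =>
      rw [Mem.apply_idle] at ih
      obtain ⟨t, m1, h1, t', m2, h2, h3⟩ := ih
      exact ⟨_, _, .star_cons h1 h2, h3⟩

end Prog

/-- A language is in NP if a program accepts it within polynomial time. -/
theorem InNP.of_prog {Γ ι A : Type} [Finite ι] [Finite A] {L : Language Γ} (p : Prog Γ Empty ι A)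
    (b : Polynomial ℕ)
    (complete : ∀ w ∈ L, ∃ t m, t ≤ b.eval w.length ∧ p.Exec w .init t m)
    (sound : ∀ w t m, p.Exec w .init t m → w ∈ L) : InNP L := by
  refine ⟨p.machine inferInstance inferInstance, b, fun w => ⟨fun hw => ?_, ?_⟩⟩
  · obtain ⟨t, m, ht, he⟩ := complete w hw
    obtain ⟨c, hc, hr⟩ := Prog.reachesIn_of_run (he.run [])
    exact ⟨t, ht, c, hc, hr.cont⟩
  · rintro ⟨t, c, hc, ha⟩
    obtain ⟨k, m, hr, hrep⟩ := Prog.run_of_reachesIn hc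
    -- Accepting states are those with nothing left to run, so the run is a complete execution of
    -- `p`.
    obtain ⟨t', m', he, -⟩ := hr.execAll (hrep.cont.symm.trans ha)
    exact sound w t' m' he

/-! ### Deterministic programs and growing stacks. -/

namespace Prog

variable {Γ Δ ι A : Type}

/-- Programs without nondeterministic choices. -/
def Det : Prog Γ Δ ι A → Prop
  | act _ => True
  | seq p q => p.Det ∧ q.Det
  | ite _ p q => p.Det ∧ q.Det
  | loop _ p => p.Det
  | choice _ _ => False
  | star _ => False

theorem det_of_mem_conts (p : Prog Γ Δ ι A) :
    p.Det → ∀ k, (∀ q ∈ k, q.Det) → ∀ l ∈ conts p k, ∀ q ∈ l, q.Det := by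
  induction p with
  | act f => rintro hp k hk l rfl q (_ | ⟨_, hq⟩); exacts [hp, hk q hq]
  | seq p q ihp ihq =>
    rintro hp k hk l (rfl | hl | hl)
    · rintro q (_ | ⟨_, hq⟩); exacts [hp, hk _ hq]
    · exact ihp hp.1 (q :: k) (by rintro q (_ | ⟨_, hq⟩); exacts [hp.2, hk _ hq]) l hl
    · exact ihq hp.2 k hk l hl
  | ite c p q ihp ihq =>
    rintro hp k hk l (rfl | hl | hl)
    · rintro q (_ | ⟨_, hq⟩); exacts [hp, hk _ hq]
    · exact ihp hp.1 k hk l hl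
    · exact ihq hp.2 k hk l hl
  | loop c p ihp =>
    rintro hp k hk l (rfl | hl)
    · rintro q (_ | ⟨_, hq⟩); exacts [hp, hk _ hq]
    · exact ihp hp (loop c p :: k) (by rintro q (_ | ⟨_, hq⟩); exacts [hp, hk _ hq]) l hl
  | choice p q => exact fun h => h.elim
  | star p => exact fun h => h.elim

theorem PStep.unique {x : Option Γ} {s : ι → Option A} {k k₁ k₂ : List (Prog Γ Δ ι A)} {e₁ e₂}
    (hk : ∀ q ∈ k, q.Det) (h₁ : PStep x s k k₁ e₁) (h₂ : PStep x s k k₂ e₂) :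
    k₁ = k₂ ∧ e₁ = e₂ := by
  cases h₁ with
  | act f k e h =>
    cases h₂ with
    | act _ _ _ h' => rw [h] at h'; exact ⟨rfl, Option.some.inj h'⟩
  | seq => cases h₂; exact ⟨rfl, rfl⟩
  | ite => cases h₂; exact ⟨rfl, rfl⟩
  | loop => cases h₂; exact ⟨rfl, rfl⟩
  | choice_left => exact absurd (hk _ List.mem_cons_self) id
  | choice_right => exact absurd (hk _ List.mem_cons_self) id
  | star_nil => exact absurd (hk _ List.mem_cons_self) id
  | star_cons => exact absurd (hk _ List.mem_cons_self) id

theorem deterministic_machine {p : Prog Γ Δ ι A} (hp : p.Det) (hι : Finite ι) (hA : Finite A) :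
    (machine p hι hA).Deterministic := by
  rintro ⟨⟨k, hk⟩, c⟩ x s a b ⟨k₁, e₁, h₁, rfl⟩ ⟨k₂, e₂, h₂, rfl⟩
  have hd : ∀ q ∈ k, q.Det := by
    rcases hk with rfl | hk
    · simp
    · exact det_of_mem_conts p hp [] (by simp) k hk
  obtain ⟨h, rfl⟩ := h₁.unique hd h₂
  rw [Subtype.ext h]

theorem _root_.Complexity.Machine.ReachesIn.unique {M : Machine Γ Δ} (hM : M.Deterministic)
    {w : List Γ} : ∀ {t : ℕ} {c c' : M.Cfg}, M.ReachesIn w t c → M.ReachesIn w t c' → c = c'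
  | 0, _, _, h, h' => h.trans h'.symm
  | t + 1, _, _, ⟨b, hb, a, ha, hc⟩, ⟨b', hb', a', ha', hc'⟩ => by
    obtain rfl := Machine.ReachesIn.unique hM hb hb'
    obtain rfl := hM _ _ _ _ _ ha ha'
    exact hc.trans hc'.symm

/-- A longer computation passes at time `t` through a configuration that has a successor; by
determinism this is the halted one. -/
theorem _root_.Complexity.Machine.ReachesIn.le_of_halted {M : Machine Γ Δ} (hM : M.Deterministic)
    {w : List Γ} {t t' : ℕ} {c c' : M.Cfg} (h : M.ReachesIn w t c) (hc : M.Halted w c)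
    (h' : M.ReachesIn w t' c') : t' ≤ t := by
  by_contra! hlt
  obtain ⟨d, rfl⟩ := Nat.exists_eq_add_of_lt hlt
  have : ∀ d c', M.ReachesIn w (t + d) c' →
      ∃ b, M.ReachesIn w t b ∧ (d ≠ 0 → ∃ b', M.Step w b b') := by
    intro d
    induction d with
    | zero => intro c' h'; exact ⟨c', h', by simp⟩
    | succ d ih =>
      rintro c' ⟨b, hb, hs⟩
      obtain ⟨b0, h0, h1⟩ := ih b hb
      refine ⟨b0, h0, fun _ => ?_⟩
      rcases eq_or_ne d 0 with rfl | hd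
      · exact ⟨c', (Machine.ReachesIn.unique hM h0 hb) ▸ hs⟩
      · exact h1 hd
  obtain ⟨b, hb, hs⟩ := this (d + 1) c' h'
  obtain ⟨b', hb'⟩ := hs (by simp)
  obtain rfl := Machine.ReachesIn.unique hM h hb
  exact hc b' hb'

/-- The total height of the stacks. -/
def _root_.Complexity.Mem.height [Fintype ι] (m : Mem Δ ι A) : ℕ := ∑ i, (m.stk i).length

/-- The change of height caused by an operation, at least. -/
def _root_.Complexity.StackOp.growth : StackOp A → ℤ
  | .keep => 0
  | .pop => -1
  | .push _ => 1
  | .set _ => 0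

/-- Equality fails only for `pop` on the empty stack, which removes nothing. -/
theorem _root_.Complexity.StackOp.growth_le (op : StackOp A) (l : List A) :
    (l.length : ℤ) + op.growth ≤ (op.run l).length := by
  cases op <;> cases l <;> simp [StackOp.growth, StackOp.run]

/-- Programs none of whose actions decreases the total height of the stacks. -/
def NonShrinking [Fintype ι] : Prog Γ Δ ι A → Prop
  | act f => ∀ x s e, f x s = some e → 0 ≤ ∑ i, (e.ops i).growth
  | seq p q => p.NonShrinking ∧ q.NonShrinking
  | ite _ p q => p.NonShrinking ∧ q.NonShrinking
  | loop _ p => p.NonShrinking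
  | choice p q => p.NonShrinking ∧ q.NonShrinking
  | star p => p.NonShrinking

theorem height_le_apply [Fintype ι] (m : Mem Δ ι A) (w : List Γ) {e : Effect Δ ι A}
    (h : 0 ≤ ∑ i, (e.ops i).growth) : m.height ≤ (m.apply w e).height := by
  zify [Mem.height]
  have : ∀ i ∈ Finset.univ, ((m.stk i).length : ℤ) + (e.ops i).growth ≤
      (((m.apply w e).stk i).length : ℤ) := fun i _ => (e.ops i).growth_le _
  have := Finset.sum_le_sum this
  rw [Finset.sum_add_distrib] at this
  linarith

theorem PStep.nonShrinking [Fintype ι] {x : Option Γ} {s : ι → Option A}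
    {k k' : List (Prog Γ Δ ι A)} {e} (hk : ∀ q ∈ k, q.NonShrinking) (h : PStep x s k k' e) :
    (∀ q ∈ k', q.NonShrinking) ∧ 0 ≤ ∑ i, (e.ops i).growth := by
  have idle : 0 ≤ ∑ i, ((Effect.idle : Effect Δ ι A).ops i).growth := by
    simp [Effect.idle, StackOp.growth]
  cases h with
  | act f k e h => exact ⟨fun q hq => hk q (List.mem_cons_of_mem _ hq),
      (hk _ List.mem_cons_self : NonShrinking (Prog.act f)) _ _ _ h⟩
  | seq p q k =>
    have := hk _ (List.mem_cons_self)
    refine ⟨?_, idle⟩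
    rintro q (_ | ⟨_, _ | ⟨_, hq⟩⟩)
    exacts [this.1, this.2, hk _ (List.mem_cons_of_mem _ hq)]
  | ite c p q k =>
    have := hk _ (List.mem_cons_self)
    refine ⟨?_, idle⟩
    cases c x s
    all_goals
      rintro q (_ | ⟨_, hq⟩)
      exacts [by first | exact this.1 | exact this.2, hk _ (List.mem_cons_of_mem _ hq)]
  | loop c p k =>
    have := hk _ (List.mem_cons_self)
    refine ⟨?_, idle⟩
    cases c x s
    · intro q hq; exact hk _ (by simp_all)
    · rintro q (_ | ⟨_, _ | ⟨_, hq⟩⟩)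
      exacts [this, this, hk _ (List.mem_cons_of_mem _ hq)]
  | choice_left p q k =>
    have := hk _ (List.mem_cons_self)
    refine ⟨?_, idle⟩
    rintro q (_ | ⟨_, hq⟩)
    exacts [this.1, hk _ (List.mem_cons_of_mem _ hq)]
  | choice_right p q k =>
    have := hk _ (List.mem_cons_self)
    refine ⟨?_, idle⟩
    rintro q (_ | ⟨_, hq⟩)
    exacts [this.2, hk _ (List.mem_cons_of_mem _ hq)]
  | star_nil p k => exact ⟨fun q hq => hk _ (List.mem_cons_of_mem _ hq), idle⟩
  | star_cons p k =>
    have := hk _ (List.mem_cons_self)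
    refine ⟨?_, idle⟩
    rintro q (_ | ⟨_, _ | ⟨_, hq⟩⟩)
    exacts [this, this, hk _ (List.mem_cons_of_mem _ hq)]

/-- With this monotonicity the height at the end of a run bounds the height at every earlier moment.
-/
theorem Run.height_le [Fintype ι] {w : List Γ} {t : ℕ} {k k' : List (Prog Γ Δ ι A)}
    {m m' : Mem Δ ι A} (h : Run w t k m k' m') (hk : ∀ q ∈ k, q.NonShrinking) :
    (∀ q ∈ k', q.NonShrinking) ∧ m.height ≤ m'.height := by
  induction h with
  | zero => exact ⟨hk, le_rfl⟩
  | succ hs _ ih =>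
    obtain ⟨h1, h2⟩ := hs.nonShrinking hk
    exact ⟨(ih h1).1, (height_le_apply _ w h2).trans (ih h1).2⟩

end Prog

/-- A function is computable in logarithmic space if it is computed by a deterministic program that
never decreases the total height of its stacks and ends with stacks of logarithmic height. -/
theorem LogSpaceComputable.of_prog {Γ Δ ι A : Type} [Fintype ι] [Finite A] {f : List Γ → List Δ}
    (p : Prog Γ Δ ι A) (hd : p.Det) (hn : p.NonShrinking) (c : ℕ)
    (h : ∀ w, ∃ t m, p.Exec w .init t m ∧ m.out = f w ∧
      m.height ≤ c * (Nat.log 2 w.length + 1)) : LogSpaceComputable f := by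
  have hdet := Prog.deterministic_machine hd (inferInstance : Finite ι) (inferInstance : Finite A)
  refine ⟨p.machine inferInstance inferInstance, c, hdet, fun w => ?_⟩
  obtain ⟨t, m, he, hout, hc⟩ := h w
  obtain ⟨b, hb, hr⟩ :=
    Prog.reachesIn_of_run (hι := inferInstance) (hA := inferInstance) (he.run [])
  have halted : (p.machine inferInstance inferInstance).Halted w b := by
    intro b' hs
    obtain ⟨k', e, hp, -⟩ := hr.step hs
    cases hp
  refine ⟨⟨t, b, hb, halted, hr.out.trans hout⟩, fun t' b' hb' i => ?_⟩
  -- Since the machine is deterministic, every reachable configuration lies on the halting run,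
  -- which is split at the time `t'`.
  obtain ⟨d, rfl⟩ := Nat.exists_eq_add_of_le (hb.le_of_halted hdet halted hb')
  obtain ⟨k₁, m₁, h₁, h₂⟩ := (he.run []).split
  obtain ⟨b₁, hb₁, hr₁⟩ := Prog.reachesIn_of_run (hι := inferInstance) (hA := inferInstance) h₁
  obtain rfl := hb₁.unique hdet hb'
  have hns := (h₁.height_le (by simpa using hn)).1
  -- The distance of a head is at most the height of its stack, and the total height can only grow
  -- until the end of the run.
  calc (b₁.head i).natAbs ≤ (m₁.stk i).length := (hr₁.stk i).natAbs_le
    _ ≤ m₁.height := Finset.single_le_sum (s := (Finset.univ : Finset ι))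
      (f := fun i : ι => (m₁.stk i).length) (fun _ _ => Nat.zero_le _) (Finset.mem_univ (α := ι) i)
    _ ≤ m.height := (h₂.height_le hns).2
    _ ≤ _ := hc

end Complexity

/-! ## Parsing and matching star-free expressions along a trace -/

namespace PRE

/-- The entries of the trace of a match over a single-letter alphabet: a matched letter, the opening
parenthesis of a matched group, the opening parenthesis of a group in a branch that is not taken,
and the closing parenthesis of a matched group. Traces are written latest entry first. -/
inductive Mark where
  | zero
  | opened
  | skipped
  | closed
  deriving DecidableEq

/-! ### Balanced traces and the values they encode. -/

namespace Mark

theorem finite : Finite Mark :=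
  Finite.of_surjective (α := Fin 4)
    (fun i => match i with
      | 0 => zero
      | 1 => opened
      | 2 => skipped
      | 3 => closed)
    (fun m => by cases m; exacts [⟨0, rfl⟩, ⟨1, rfl⟩, ⟨2, rfl⟩, ⟨3, rfl⟩])

/-- The number of opening parentheses of a trace. -/
def opens : List Mark → ℕ
  | [] => 0
  | opened :: T => opens T + 1
  | skipped :: T => opens T + 1
  | zero :: T => opens T
  | closed :: T => opens T

/-- The number of matched letters of a trace. -/
def zeros : List Mark → ℕ
  | [] => 0
  | zero :: T => zeros T + 1
  | opened :: T => zeros T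
  | skipped :: T => zeros T
  | closed :: T => zeros T

/-- The change of the nesting depth by an entry, if it is possible. -/
def depthStep : Mark → ℕ → Option ℕ
  | zero, d => some d
  | skipped, d => some d
  | opened, d => some (d + 1)
  | closed, 0 => none
  | closed, d + 1 => some d

/-- The nesting depth after a trace that starts at depth `d`, if it never becomes negative. -/
def depth (d : ℕ) : List Mark → Option ℕ
  | [] => some d
  | m :: T => (depth d T).bind m.depthStep

@[simp]
theorem opens_append (S T : List Mark) : opens (S ++ T) = opens S + opens T := by
  induction S with
  | nil => simp [opens]
  | cons m S ih => cases m <;> simp [opens, ih] <;> omega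

@[simp]
theorem zeros_append (S T : List Mark) : zeros (S ++ T) = zeros S + zeros T := by
  induction S with
  | nil => simp [zeros]
  | cons m S ih => cases m <;> simp [zeros, ih]; omega

theorem depth_append (d : ℕ) (S T : List Mark) :
    depth d (S ++ T) = (depth d T).bind fun d' => depth d' S := by
  induction S with
  | nil => simp [depth]
  | cons m S ih => simp [depth, ih, Option.bind_assoc]

theorem depthStep_add (m : Mark) {d d' : ℕ} (j : ℕ) (h : m.depthStep d = some d') :
    m.depthStep (d + j) = some (d' + j) := by
  cases m with
  | zero => simp_all [depthStep]
  | skipped => simp_all [depthStep]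
  | opened => simp only [depthStep, Option.some.injEq] at h ⊢; omega
  | closed =>
    cases d with
    | zero => simp [depthStep] at h
    | succ d =>
      simp only [depthStep, Option.some.injEq] at h
      subst h
      rw [Nat.add_right_comm]
      rfl

theorem depth_add {d d' : ℕ} (j : ℕ) {T : List Mark} (h : depth d T = some d') :
    depth (d + j) T = some (d' + j) := by
  induction T generalizing d' with
  | nil => simp_all [depth]
  | cons m T ih =>
    rw [depth, Option.bind_eq_some_iff] at h
    obtain ⟨d₁, h₁, h₂⟩ := h
    rw [depth, ih h₁]
    exact depthStep_add m j h₂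

/-- A trace whose parentheses are balanced. -/
def Balanced (T : List Mark) : Prop := depth 0 T = some 0

theorem Balanced.depth {T : List Mark} (h : Balanced T) (d : ℕ) : depth d T = some d := by
  simpa using depth_add d h

theorem Balanced.append {S T : List Mark} (hS : Balanced S) (hT : Balanced T) :
    Balanced (S ++ T) := by
  rw [Balanced, depth_append, hT, Option.bind_some, hS]

theorem balanced_replicate_zero (v : ℕ) : Balanced (List.replicate v zero) := by
  induction v with
  | zero => rfl
  | succ v ih => rw [Balanced, List.replicate_succ, Mark.depth, ih]; rfl

theorem balanced_replicate_skipped (v : ℕ) : Balanced (List.replicate v skipped) := by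
  induction v with
  | zero => rfl
  | succ v ih => rw [Balanced, List.replicate_succ, Mark.depth, ih]; rfl

theorem Balanced.group {T : List Mark} (h : Balanced T) : Balanced (closed :: (T ++ [opened])) := by
  rw [Balanced, Mark.depth, depth_append]
  simp only [Mark.depth, depthStep, Option.bind_some]
  rw [h.depth]
  rfl

@[simp]
theorem opens_replicate_zero (v : ℕ) : opens (List.replicate v zero) = 0 := by
  induction v with
  | zero => rfl
  | succ v ih => simpa [List.replicate_succ, opens] using ih

@[simp]
theorem zeros_replicate_zero (v : ℕ) : zeros (List.replicate v zero) = v := by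
  induction v with
  | zero => rfl
  | succ v ih => simpa [List.replicate_succ, zeros] using ih

@[simp]
theorem opens_replicate_skipped (v : ℕ) : opens (List.replicate v skipped) = v := by
  induction v with
  | zero => rfl
  | succ v ih => simpa [List.replicate_succ, opens] using ih

@[simp]
theorem zeros_replicate_skipped (v : ℕ) : zeros (List.replicate v skipped) = 0 := by
  induction v with
  | zero => rfl
  | succ v ih => simpa [List.replicate_succ, zeros] using ih

theorem opens_le_length (T : List Mark) : opens T ≤ T.length := by
  induction T with
  | nil => simp [opens]
  | cons m T ih => cases m <;> simp [opens] <;> omega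

/-- `Lookup T k v`: the `k`-th opening parenthesis of the trace `T` is that of a matched group, the
group is closed, and it matched `v` letters. -/
def Lookup (T : List Mark) (k v : ℕ) : Prop :=
  ∃ T₁ S T₂, T = T₂ ++ closed :: (S ++ opened :: T₁) ∧ Balanced S ∧ opens T₁ + 1 = k ∧ zeros S = v

/-- Only a closing parenthesis can give a value to a variable. -/
theorem lookup_cons_iff {m : Mark} (hm : m ≠ closed) (T : List Mark) (k v : ℕ) :
    Lookup (m :: T) k v ↔ Lookup T k v := by
  constructor
  · rintro ⟨T₁, S, T₂, h, hS⟩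
    cases T₂ with
    | nil => simp only [List.nil_append, List.cons.injEq] at h; exact absurd h.1 hm
    | cons m' T₂ =>
      simp only [List.cons_append, List.cons.injEq] at h
      exact ⟨T₁, S, T₂, h.2, hS⟩
  · rintro ⟨T₁, S, T₂, rfl, hS⟩
    exact ⟨T₁, S, m :: T₂, rfl, hS⟩

theorem lookup_append_iff {S : List Mark} (hS : closed ∉ S) (T : List Mark) (k v : ℕ) :
    Lookup (S ++ T) k v ↔ Lookup T k v := by
  induction S with
  | nil => rfl
  | cons m S ih =>
    simp only [List.mem_cons, not_or] at hS
    rw [List.cons_append, lookup_cons_iff (Ne.symm hS.1), ih hS.2]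

theorem Lookup.le_opens {T : List Mark} {k v : ℕ} (h : Lookup T k v) : k ≤ opens T := by
  obtain ⟨T₁, S, T₂, rfl, -, rfl, -⟩ := h
  simp [opens]
  omega

/-- The partner of a closing parenthesis is unique. If one of the two balanced parts contained the
opening parenthesis in front of the other, then its depth would be raised there and never come back
to `0`. -/
theorem eq_of_balanced_append {S S' T T' : List Mark} (hS : Balanced S) (hS' : Balanced S')
    (h : S ++ opened :: T = S' ++ opened :: T') : S = S' ∧ T = T' := by
  have key : ∀ {S S' X : List Mark}, Balanced S → Balanced S' → S' ≠ S ++ opened :: X := by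
    rintro S S' X hS hS' rfl
    rw [Balanced, depth_append, Option.bind_eq_some_iff] at hS'
    obtain ⟨d, hd, h0⟩ := hS'
    rw [Mark.depth, Option.bind_eq_some_iff] at hd
    obtain ⟨d', -, hd⟩ := hd
    simp only [depthStep, Option.some.injEq] at hd
    rw [hS.depth, Option.some.injEq] at h0
    omega
  rcases List.append_eq_append_iff.mp h with ⟨X, h1, h2⟩ | ⟨X, h1, h2⟩
  · cases X with
    | nil => simp_all
    | cons m X =>
      simp only [List.cons_append, List.cons.injEq] at h2
      obtain ⟨rfl, rfl⟩ := h2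
      exact absurd h1 (key hS hS')
  · cases X with
    | nil => simp_all
    | cons m X =>
      simp only [List.cons_append, List.cons.injEq] at h2
      obtain ⟨rfl, rfl⟩ := h2
      exact absurd h1 (key hS' hS)

/-- The new closing parenthesis completes exactly one group, the one opened directly before the
balanced part `S`; all older completed groups persist. -/
theorem lookup_closed_iff {S T : List Mark} (hS : Balanced S) (k v : ℕ) :
    Lookup (closed :: (S ++ opened :: T)) k v ↔
      Lookup (S ++ opened :: T) k v ∨ (k = opens T + 1 ∧ v = zeros S) := by
  constructor
  · rintro ⟨T₁, S', T₂, h, hS', hk, hv⟩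
    cases T₂ with
    | nil =>
      simp only [List.nil_append, List.cons.injEq, true_and] at h
      obtain ⟨rfl, rfl⟩ := eq_of_balanced_append hS hS' h
      exact .inr ⟨hk.symm, hv.symm⟩
    | cons m' T₂ =>
      simp only [List.cons_append, List.cons.injEq] at h
      exact .inl ⟨T₁, S', T₂, h.2, hS', hk, hv⟩
  · rintro (⟨T₁, S', T₂, h, hS'⟩ | ⟨rfl, rfl⟩)
    · exact ⟨T₁, S', closed :: T₂, by rw [h]; rfl, hS'⟩
    · exact ⟨T, S, [], rfl, hS, rfl, rfl⟩

/-- The number of opening parentheses before an opening parenthesis determines its position, because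
the number grows there. -/
theorem eq_of_opens_eq {S S' T T' : List Mark} (hT : opens T = opens T')
    (h : S ++ opened :: T = S' ++ opened :: T') : S = S' ∧ T = T' := by
  rcases List.append_eq_append_iff.mp h with ⟨X, h1, h2⟩ | ⟨X, h1, h2⟩
  · cases X with
    | nil => simp_all
    | cons m X =>
      simp only [List.cons_append, List.cons.injEq] at h2
      obtain ⟨rfl, rfl⟩ := h2
      simp [opens] at hT
      omega
  · cases X with
    | nil => simp_all
    | cons m X =>
      simp only [List.cons_append, List.cons.injEq] at h2
      obtain ⟨rfl, rfl⟩ := h2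
      simp [opens] at hT
      omega

/-- The group opened in front of the balanced part is still open. If it were closed inside `S`, then
`S` would contain a closing parenthesis met at depth `0`. -/
theorem not_lookup_of_balanced {S T : List Mark} (hS : Balanced S) (v : ℕ) :
    ¬ Lookup (S ++ opened :: T) (opens T + 1) v := by
  rintro ⟨T₁, S', T₂, h, hS', hk, -⟩
  rw [← List.cons_append, ← List.append_assoc] at h
  obtain ⟨rfl, rfl⟩ := eq_of_opens_eq (by omega) h
  rw [Balanced, depth_append, Mark.depth, hS'] at hS
  simp [depthStep] at hS

/-- The trace determines the values of the variables. -/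
def Rep (T : List Mark) (e : ℕ → Option (List Unit)) : Prop :=
  ∀ k v, Lookup T k v ↔ e k = some (List.replicate v ())

theorem Rep.append {S T : List Mark} {e} (h : Rep T e) (hS : closed ∉ S) : Rep (S ++ T) e :=
  fun k v => (lookup_append_iff hS T k v).trans (h k v)

theorem rep_nil : Rep [] fun _ => none := by
  rintro k v
  simp [Lookup]

/-- By `not_lookup_of_balanced` the variable had no value before, so the trace never assigns two
values to it and the update is faithful. Words over `Unit` are determined by their lengths, hence
`zeros` is all that has to be recorded. -/
theorem Rep.group {S T : List Mark} {e} (hS : Balanced S) (h : Rep (S ++ opened :: T) e)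
    {w : List Unit} (hw : zeros S = w.length) :
    Rep (closed :: (S ++ opened :: T)) (Function.update e (opens T + 1) (some w)) := by
  intro k v
  rw [lookup_closed_iff hS]
  rcases eq_or_ne k (opens T + 1) with rfl | hk
  · simp only [not_lookup_of_balanced hS, false_or, true_and, Function.update_self,
      Option.some.injEq, hw]
    constructor
    · rintro rfl; exact List.eq_replicate_iff.mpr ⟨rfl, fun _ _ => rfl⟩
    · rintro rfl; simp
  · simp [hk, h k v]

end Mark

/-! ### Reading an expression along a trace. -/

open Mark

/-- The levels of the grammar of expressions. -/
inductive Level where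
  | alt
  | cat
  | atom

/-- The expressions of a level. -/
def Level.Admits {σ : Type} : Level → PRE σ → Prop
  | alt, _ => True
  | cat, r => ¬ r.IsAlt
  | atom, r => ¬ r.IsAlt ∧ ¬ r.IsCat

/-- The effect of a back reference on the trace. -/
def RefEffect : Bool → ℕ → List Mark → List Mark → Prop
  | true, k, T, T' => ∃ v, Lookup T k v ∧ T' = List.replicate v zero ++ T
  | false, k, T, T' => k ≤ opens T ∧ T' = T

/-- `Parse l a I T I' T'`: an expression of level `l` can be read from the tokens `I`, with the
tokens `I'` left over. If `a` is `true`, it is matched; if `a` is `false`, it is skipped. The trace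
is `T` before and `T'` after that. -/
inductive Parse : Level → Bool → List (PREToken Unit) → List Mark → List (PREToken Unit) →
    List Mark → Prop
  | alt_cat {a I T I' T'} (h : Parse .cat a I T I' T') : Parse .alt a I T I' T'
  | alt_bar {a a₁ a₂ I T I₁ T₁ I₂ T₂} (ha : a = (a₁ || a₂)) (ha' : (a₁ && a₂) = false)
      (h₁ : Parse .alt a₁ I T (.bar :: I₁) T₁) (h₂ : Parse .cat a₂ I₁ T₁ I₂ T₂) :
      Parse .alt a I T I₂ T₂
  | cat_atom {a I T I' T'} (h : Parse .atom a I T I' T') : Parse .cat a I T I' T'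
  | cat_cat {a I T I₁ T₁ I₂ T₂} (h₁ : Parse .cat a I T I₁ T₁) (h₂ : Parse .atom a I₁ T₁ I₂ T₂) :
      Parse .cat a I T I₂ T₂
  | letter (a I T) : Parse .atom a (.letter () :: I) T I (bif a then zero :: T else T)
  | ref {a k I T T'} (hk : 1 ≤ k) (h : RefEffect a k T T') :
      Parse .atom a (.backslash :: ((Nat.bits k).reverse.map .digit ++ I)) T I T'
  | group {a I T I' T'} (h : Parse .alt a I ((bif a then opened else skipped) :: T)
      (.rparen :: I') T') : Parse .atom a (.lparen :: I) T I' (bif a then closed :: T' else T')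

theorem Level.Admits.alt {σ : Type} (r : PRE σ) : Level.alt.Admits r := trivial

/-- The tree is obtained before any environment is mentioned, since it depends on the tokens only. A
skipped part adds neither letters nor closing parentheses, so it changes no variable; but its
opening parentheses are recorded, which keeps the numbering of later groups correct. -/
theorem Parse.sound {l a I T I' T'} (h : Parse l a I T I' T') :
    ∃ (r : PRE Unit) (S : List Mark), r.IsParseTree ∧ r.StarFree ∧ l.Admits r ∧
      r.RefsValid (opens T) ∧ I = r.toTokens ++ I' ∧ T' = S ++ T ∧ opens S = r.groups ∧
      Balanced S ∧ (a = false → closed ∉ S ∧ zeros S = 0) ∧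
      (a = true → ∀ e, Rep T e → ∃ w e', Matches (opens T) r e w e' ∧ zeros S = w.length ∧
        Rep T' e') := by
  induction h with
  | alt_cat _ ih =>
    obtain ⟨r, S, h1, h2, h3, h4⟩ := ih
    exact ⟨r, S, h1, h2, trivial, h4⟩
  | cat_atom _ ih =>
    obtain ⟨r, S, h1, h2, h3, h4⟩ := ih
    exact ⟨r, S, h1, h2, h3.1, h4⟩
  | @alt_bar a a₁ a₂ I T I₁ T₁ I₂ T₂ ha ha' _ _ ih₁ ih₂ =>
    obtain ⟨r, S, h1, h2, h3, h4, rfl, rfl, h7, h8, h9, h10⟩ := ih₁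
    obtain ⟨r', S', h1', h2', h3', h4', rfl, rfl, h7', h8', h9', h10'⟩ := ih₂
    refine ⟨.alt r r', S' ++ S, ⟨h1, h1', h3'⟩, ⟨h2, h2'⟩, trivial, ⟨h4, ?_⟩, ?_, by simp, ?_,
      h8'.append h8, ?_, ?_⟩
    · rwa [opens_append, h7, add_comm] at h4'
    · simp [toTokens]
    · simp [groups, h7, h7', add_comm]
    · rintro rfl
      simp only [Bool.false_eq, Bool.or_eq_false_iff] at ha
      simp [h9 ha.1, h9' ha.2]
    · rintro rfl e he
      -- When the alternation is matched, exactly one of its branches is; the other one is skipped.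
      cases a₁ <;> cases a₂ <;> simp at ha ha'
      · obtain ⟨w, e', hm, hz, hr⟩ := h10' rfl e (he.append (h9 rfl).1)
        rw [opens_append, h7, add_comm] at hm
        exact ⟨w, e', .alt_right _ _ _ _ _ _ hm, by simp [hz, (h9 rfl).2], hr⟩
      · obtain ⟨w, e', hm, hz, hr⟩ := h10 rfl e he
        exact ⟨w, e', .alt_left _ _ _ _ _ _ hm, by simp [hz, (h9' rfl).2], hr.append (h9' rfl).1⟩
  | @cat_cat a I T I₁ T₁ I₂ T₂ _ _ ih₁ ih₂ =>
    obtain ⟨r, S, h1, h2, h3, h4, rfl, rfl, h7, h8, h9, h10⟩ := ih₁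
    obtain ⟨r', S', h1', h2', h3', h4', rfl, rfl, h7', h8', h9', h10'⟩ := ih₂
    rw [opens_append, h7, add_comm] at h4'
    refine ⟨.cat r r', S' ++ S, ⟨h1, h1', h3, h3'⟩, ⟨h2, h2'⟩, id, ⟨h4, h4'⟩, ?_, by simp, ?_,
      h8'.append h8, ?_, ?_⟩
    · simp [toTokens]
    · simp [groups, h7, h7', add_comm]
    · rintro rfl
      simp [h9 rfl, h9' rfl]
    · rintro rfl e he
      obtain ⟨w, e', hm, hz, hr⟩ := h10 rfl e he
      obtain ⟨w', e'', hm', hz', hr'⟩ := h10' rfl e' hr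
      rw [opens_append, h7, add_comm] at hm'
      exact ⟨w ++ w', e'', .cat _ _ _ _ _ _ _ _ hm hm', by simp [hz, hz', add_comm], hr'⟩
  | letter a I T =>
    cases a
    · exact ⟨.sym (), [], trivial, trivial, ⟨id, id⟩, trivial, rfl, rfl, rfl, rfl,
        by simp [zeros], by simp⟩
    · exact ⟨.sym (), [zero], trivial, trivial, ⟨id, id⟩, trivial, rfl, rfl, rfl, rfl, by simp,
        fun _ e he => ⟨[()], e, .sym _ _ _, rfl, he.append (S := [zero]) (by simp)⟩⟩
  | @ref a k I T T' hk h =>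
    cases a
    · obtain ⟨h, rfl⟩ := h
      exact ⟨.ref k, [], trivial, trivial, ⟨id, id⟩, ⟨hk, h⟩, rfl, rfl, rfl, rfl,
        by simp [zeros], by simp⟩
    · obtain ⟨v, h, rfl⟩ := h
      refine ⟨.ref k, List.replicate v zero, trivial, trivial, ⟨id, id⟩, ⟨hk, h.le_opens⟩, rfl, rfl,
        by simp [groups], balanced_replicate_zero v, by simp, fun _ e he =>
          ⟨List.replicate v (), e, .ref _ _ _ _ ((he k v).mp h), by simp, he.append (by simp)⟩⟩
  | @group a I T I' T' _ ih =>
    obtain ⟨r, S, h1, h2, h3, h4, rfl, rfl, h7, h8, h9, h10⟩ := ih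
    cases a
    · refine ⟨.group r, S ++ [skipped], h1, h2, ⟨id, id⟩, h4, by simp [toTokens], by simp, ?_,
        h8.append rfl, fun _ => by simp [h9 rfl, zeros], by simp⟩
      simp [h7, groups, opens]
    · refine ⟨.group r, closed :: (S ++ [opened]), h1, h2, ⟨id, id⟩, h4, by simp [toTokens],
        by simp, ?_, h8.group, by simp, fun _ e he => ?_⟩
      · simp [h7, groups, opens]
      · obtain ⟨w, e', hm, hz, hr⟩ := h10 rfl e (he.append (S := [opened]) (by simp))
        exact ⟨w, _, .group _ _ _ _ _ hm, by simp [zeros, hz], hr.group h8 hz⟩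

/-- A skipped group leaves one mark for its opening parenthesis and none for the closing one.
Validity of references must be maintained, because `RefEffect` checks it also in skipped parts. -/
theorem Parse.skip {r : PRE Unit} (hp : r.IsParseTree) (hs : r.StarFree) :
    ∀ {T : List Mark}, r.RefsValid (opens T) → ∀ {l : Level}, l.Admits r → ∀ I,
      Parse l false (r.toTokens ++ I) T I (List.replicate r.groups skipped ++ T) := by
  have lift : ∀ {r : PRE Unit} {T T' : List Mark} {I I'}, Level.atom.Admits r →
      Parse .atom false I T I' T' → ∀ {l : Level}, l.Admits r → Parse l false I T I' T' := by
    rintro r T T' I I' - h (_ | _ | _) -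
    exacts [.alt_cat (.cat_atom h), .cat_atom h, h]
  induction r with
  | sym a =>
    intro T hv l hl I
    exact lift (r := .sym a) ⟨id, id⟩ (.letter false I T) hl
  | ref k =>
    intro T hv l hl I
    exact lift (r := .ref k) ⟨id, id⟩ (.ref hv.1 ⟨hv.2, rfl⟩) hl
  | alt r r' ih ih' =>
    intro T hv l hl I
    cases l with
    | alt =>
      have h₁ := ih hp.1 hs.1 hv.1 (l := .alt) trivial (.bar :: (r'.toTokens ++ I))
      have h₂ := ih' hp.2.1 hs.2 (T := List.replicate r.groups skipped ++ T)
        (by rw [opens_append, opens_replicate_skipped, add_comm]; exact hv.2) (l := .cat) hp.2.2 I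
      have := Parse.alt_bar (a := false) rfl rfl h₁ h₂
      rw [← List.append_assoc, List.replicate_append_replicate] at this
      simpa [toTokens, groups, add_comm] using this
    | cat => exact absurd trivial hl
    | atom => exact absurd trivial hl.1
  | cat r r' ih ih' =>
    intro T hv l hl I
    have h₁ := ih hp.1 hs.1 hv.1 (l := .cat) hp.2.2.1 (r'.toTokens ++ I)
    have h₂ := ih' hp.2.1 hs.2 (T := List.replicate r.groups skipped ++ T)
      (by rw [opens_append, opens_replicate_skipped, add_comm]; exact hv.2) (l := .atom) hp.2.2.2 I
    have := Parse.cat_cat h₁ h₂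
    rw [← List.append_assoc (List.replicate _ _), List.replicate_append_replicate, add_comm,
      ← List.append_assoc] at this
    cases l with
    | alt => exact .alt_cat this
    | cat => exact this
    | atom => exact absurd trivial hl.2
  | star r ih => exact hs.elim
  | group r ih =>
    intro T hv l hl I
    refine lift (r := .group r) ⟨id, id⟩ ?_ hl
    have h := ih hp hs (T := skipped :: T) hv (l := .alt) trivial (.rparen :: I)
    have := Parse.group (a := false) h
    simpa [toTokens, groups, List.replicate_succ'] using this

theorem groups_le_length {σ : Type} (r : PRE σ) : r.groups ≤ r.toTokens.length := by
  induction r <;> simp [groups, toTokens] <;> omega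

/-- The last conclusion makes the search polynomial: each mark other than a letter is paid for by a
parenthesis token, and each letter mark by a letter of the matched word, even when it lies in many
nested groups. -/
theorem Matches.parse {n : ℕ} {r : PRE Unit} {e w e'} (hm : Matches n r e w e')
    (hp : r.IsParseTree) (hs : r.StarFree) :
    ∀ {T : List Mark}, n = opens T → Rep T e → r.RefsValid n → ∀ {l : Level}, l.Admits r → ∀ I,
      ∃ S, Parse l true (r.toTokens ++ I) T I (S ++ T) ∧ opens S = r.groups ∧ Balanced S ∧
        zeros S = w.length ∧ Rep (S ++ T) e' ∧ S.length ≤ r.toTokens.length + w.length := by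
  have lift : ∀ {r : PRE Unit} {T T' : List Mark} {I I'}, Level.atom.Admits r →
      Parse .atom true I T I' T' → ∀ {l : Level}, l.Admits r → Parse l true I T I' T' := by
    rintro r T T' I I' - h (_ | _ | _) -
    exacts [.alt_cat (.cat_atom h), .cat_atom h, h]
  induction hm with
  | sym n a e =>
    intro T hn hr hv l hl I
    exact ⟨[zero], lift (r := .sym a) ⟨id, id⟩ (.letter true I T) hl, rfl, rfl, rfl,
      hr.append (S := [zero]) (by simp), by simp⟩
  | ref n k e w h =>
    intro T hn hr hv l hl I
    have hw : w = List.replicate w.length () := List.eq_replicate_iff.mpr ⟨rfl, fun _ _ => rfl⟩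
    rw [hw] at h
    exact ⟨List.replicate w.length zero, lift (r := .ref k) ⟨id, id⟩
      (.ref hv.1 ⟨_, (hr _ _).mpr h, rfl⟩) hl, by simp [groups], balanced_replicate_zero _, by simp,
      hr.append (by simp), by simp⟩
  | alt_left n r r' e e' w h ih =>
    intro T hn hr hv l hl I
    cases l with
    | alt =>
      obtain ⟨S, h₁, ho, hb, hz, hr', hl'⟩ := ih hp.1 hs.1 hn hr hv.1 (l := .alt) trivial
        (.bar :: (r'.toTokens ++ I))
      have h₂ := Parse.skip hp.2.1 hs.2 (T := S ++ T)
        (by rw [opens_append, ho, add_comm, ← hn]; exact hv.2) (l := .cat) hp.2.2 I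
      have := Parse.alt_bar (a := true) rfl rfl h₁ h₂
      refine ⟨List.replicate r'.groups skipped ++ S, ?_, ?_, ?_, ?_, ?_, ?_⟩
      · simpa [toTokens] using this
      · simp [groups, ho, add_comm]
      · exact (balanced_replicate_skipped _).append hb
      · simp [hz]
      · rw [List.append_assoc]; exact hr'.append (by simp)
      · have := groups_le_length r'
        simp [toTokens]; omega
    | cat => exact absurd trivial hl
    | atom => exact absurd trivial hl.1
  | alt_right n r r' e e' w h ih =>
    intro T hn hr hv l hl I
    cases l with
    | alt =>
      have h₁ := Parse.skip hp.1 hs.1 (T := T) (by rw [← hn]; exact hv.1) (l := .alt) trivial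
        (.bar :: (r'.toTokens ++ I))
      obtain ⟨S, h₂, ho, hb, hz, hr', hl'⟩ := ih hp.2.1 hs.2
        (T := List.replicate r.groups skipped ++ T) (by simp [hn, add_comm])
        (hr.append (by simp)) hv.2 (l := .cat) hp.2.2 I
      have := Parse.alt_bar (a := true) rfl rfl h₁ h₂
      refine ⟨S ++ List.replicate r.groups skipped, ?_, ?_, ?_, ?_, ?_, ?_⟩
      · simpa [toTokens] using this
      · simp [groups, ho, add_comm]
      · exact hb.append (balanced_replicate_skipped _)
      · simp [hz]
      · rw [List.append_assoc]; exact hr'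
      · have := groups_le_length r
        simp [toTokens]; omega
    | cat => exact absurd trivial hl
    | atom => exact absurd trivial hl.1
  | cat n r r' e e' e'' u v h h' ih ih' =>
    intro T hn hr hv l hl I
    obtain ⟨S, h₁, ho, hb, hz, hr', hl'⟩ := ih hp.1 hs.1 hn hr hv.1 (l := .cat) hp.2.2.1
      (r'.toTokens ++ I)
    obtain ⟨S', h₂, ho', hb', hz', hr'', hl''⟩ := ih' hp.2.1 hs.2 (T := S ++ T)
      (by simp [hn, ho, add_comm]) hr' hv.2 (l := .atom) hp.2.2.2 I
    have := Parse.cat_cat h₁ h₂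
    refine ⟨S' ++ S, ?_, ?_, ?_, ?_, ?_, ?_⟩
    · rw [← List.append_assoc, ← List.append_assoc] at this
      cases l with
      | alt => exact .alt_cat this
      | cat => exact this
      | atom => exact absurd trivial hl.2
    · simp [groups, ho, ho', add_comm]
    · exact hb'.append hb
    · simp [hz, hz', add_comm]
    · rw [List.append_assoc]; exact hr''
    · simp [toTokens]; omega
  | star_nil => exact hs.elim
  | star_cons => exact hs.elim
  | group n r e e' w h ih =>
    intro T hn hr hv l hl I
    obtain ⟨S, h₁, ho, hb, hz, hr', hl'⟩ := ih hp hs (T := opened :: T) (by simp [opens, hn])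
      (hr.append (S := [opened]) (by simp)) hv (l := .alt) trivial (.rparen :: I)
    have := Parse.group (a := true) h₁
    refine ⟨closed :: (S ++ [opened]), lift (r := .group r) ⟨id, id⟩ ?_ hl, ?_, hb.group, ?_, ?_,
      ?_⟩
    · simpa [toTokens] using this
    · simp [groups, ho, opens]
    · simp [zeros, hz]
    · have := hr'.group hb hz
      simpa [hn] using this
    · simp [toTokens]; omega

end PRE

/-! ## A nondeterministic program for star-free expressions -/

namespace Complexity.Prog

variable {Γ Δ ι A : Type}

/-- Some run of `p` leads from `m` to `m'`. -/
def Sem (w : List Γ) (p : Prog Γ Δ ι A) (m m' : Mem Δ ι A) : Prop := ∃ t, Exec w p m t m'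

/-- Some run of `p` of at most `t` steps leads from `m` to `m'`. -/
def Within (w : List Γ) (p : Prog Γ Δ ι A) (m : Mem Δ ι A) (t : ℕ) (m' : Mem Δ ι A) : Prop :=
  ∃ t' ≤ t, Exec w p m t' m'

variable {w : List Γ} {p q : Prog Γ Δ ι A} {m m' m'' : Mem Δ ι A} {t t' : ℕ}

theorem Within.mono (h : Within w p m t m') (ht : t ≤ t') : Within w p m t' m' :=
  let ⟨s, hs, he⟩ := h
  ⟨s, hs.trans ht, he⟩

theorem Within.seq (h : Within w p m t m') (h' : Within w q m' t' m'') :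
    Within w (seq p q) m (t + t' + 1) m'' :=
  let ⟨_, hs, he⟩ := h
  let ⟨_, hs', he'⟩ := h'
  ⟨_, by omega, .seq he he'⟩

theorem Within.choice_left (h : Within w p m t m') : Within w (choice p q) m (t + 1) m' :=
  let ⟨_, hs, he⟩ := h
  ⟨_, by omega, .choice_left he⟩

theorem Within.choice_right (h : Within w q m t m') : Within w (choice p q) m (t + 1) m' :=
  let ⟨_, hs, he⟩ := h
  ⟨_, by omega, .choice_right he⟩

theorem Within.star_nil : Within w (star p) m 1 m := ⟨_, le_rfl, .star_nil⟩

theorem Within.star_cons (h : Within w p m t m') (h' : Within w (star p) m' t' m'') :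
    Within w (star p) m (t + t' + 1) m'' :=
  let ⟨_, hs, he⟩ := h
  let ⟨_, hs', he'⟩ := h'
  ⟨_, by omega, .star_cons he he'⟩

theorem Exec.star_trans {p r : Prog Γ Δ ι A} (h : Exec w r m t m') (hr : r = star p)
    (h' : Exec w r m' t' m'') : ∃ s ≤ t + t', Exec w r m s m'' := by
  induction h with
  | star_nil => exact ⟨t', by omega, h'⟩
  | star_cons hp hq _ ih =>
    obtain ⟨s, hs, he⟩ := ih hr h'
    exact ⟨_, by omega, .star_cons hp he⟩
  | _ => cases hr

/-- Iterations unfold from the front, whereas the digits of a number are handled by an induction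
that adds the last digit at the end. -/
theorem Within.star_snoc (h : Within w (star p) m t m') (h' : Within w p m' t' m'') :
    Within w (star p) m (t + t' + 2) m'' :=
  let ⟨_, hs, he⟩ := h
  let ⟨_, hs', he'⟩ := h'.star_cons .star_nil
  let ⟨_, hs'', he''⟩ := he.star_trans rfl he'
  ⟨_, by omega, he''⟩

@[simp]
theorem sem_seq : Sem w (seq p q) m m'' ↔ ∃ m', Sem w p m m' ∧ Sem w q m' m'' := by
  constructor
  · rintro ⟨t, h⟩
    cases h with
    | seq hp hq => exact ⟨_, ⟨_, hp⟩, _, hq⟩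
  · rintro ⟨m', ⟨t, hp⟩, t', hq⟩
    exact ⟨_, .seq hp hq⟩

@[simp]
theorem sem_choice : Sem w (choice p q) m m' ↔ Sem w p m m' ∨ Sem w q m m' := by
  constructor
  · rintro ⟨t, h⟩
    cases h with
    | choice_left h => exact .inl ⟨_, h⟩
    | choice_right h => exact .inr ⟨_, h⟩
  · rintro (⟨t, h⟩ | ⟨t, h⟩)
    exacts [⟨_, .choice_left h⟩, ⟨_, .choice_right h⟩]

/-- The tool for soundness: a guessed loop may stop after any number of rounds, so only an invariant
is known; the test that follows the loop then pins down the outcome. -/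
theorem Sem.star_invariant (h : Sem w (star p) m m') (R : Mem Δ ι A → Prop) (h0 : R m)
    (hs : ∀ m m', R m → Sem w p m m' → R m') : R m' := by
  obtain ⟨t, h⟩ := h
  generalize hr : star p = r at h
  induction h with
  | star_nil => exact h0
  | star_cons hp hq _ ih =>
    cases hr
    exact ih (hs _ _ h0 ⟨_, hp⟩) rfl
  | _ => cases hr

/-- Running programs one after the other. -/
def seqs : List (Prog Γ Δ ι A) → Prog Γ Δ ι A
  | [] => act fun _ _ => some .idle
  | p :: L => seq p (seqs L)

/-- A choice between several programs. -/
def choices : List (Prog Γ Δ ι A) → Prog Γ Δ ι A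
  | [] => act fun _ _ => none
  | p :: L => choice p (choices L)

@[simp]
theorem sem_seqs_nil : Sem w (seqs []) m m' ↔ m' = m := by
  constructor
  · rintro ⟨t, h⟩
    cases h with
    | act h => cases h; simp
  · rintro rfl
    refine ⟨1, ?_⟩
    have := Exec.act (w := w) (m := m') (f := fun _ _ => some .idle) rfl
    rwa [Mem.apply_idle] at this

theorem Within.seqs_nil : Within w (seqs []) m 1 m := by
  refine ⟨1, le_rfl, ?_⟩
  have := Exec.act (w := w) (m := m) (f := fun _ _ => some .idle) rfl
  rwa [Mem.apply_idle] at this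

@[simp]
theorem sem_choices {L : List (Prog Γ Δ ι A)} :
    Sem w (choices L) m m' ↔ ∃ p ∈ L, Sem w p m m' := by
  induction L with
  | nil =>
    simp only [List.not_mem_nil, false_and, exists_false, iff_false]
    rintro ⟨t, h⟩
    cases h with
    | act h => cases h
  | cons p L ih => simp [choices, sem_choice, ih]

theorem Within.choices {L : List (Prog Γ Δ ι A)} (hp : p ∈ L) (h : Within w p m t m') :
    Within w (choices L) m (t + L.length) m' := by
  induction L with
  | nil => simp at hp
  | cons q L ih =>
    rcases List.mem_cons.mp hp with rfl | hp
    · exact h.choice_left.mono (by simp)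
    · exact (ih hp).choice_right.mono (by simp [add_assoc])

open Classical in
/-- Remove the symbol `a` from the top of the stack `i`. -/
noncomputable def pop (i : ι) (a : A) : Prog Γ Δ ι A :=
  act fun _ s => if s i = some a then
    some ⟨.stay, Function.update (fun _ => .keep) i .pop, none⟩ else none

open Classical in
/-- Put the symbol `a` on the stack `i`. -/
noncomputable def push (i : ι) (a : A) : Prog Γ Δ ι A :=
  act fun _ _ => some ⟨.stay, Function.update (fun _ => .keep) i (.push a), none⟩

open Classical in
/-- Check that the stack `i` is empty. -/
noncomputable def empty (i : ι) : Prog Γ Δ ι A :=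
  act fun _ s => if s i = none then some .idle else none

open Classical in
/-- The memory with a new content of one stack. -/
noncomputable def _root_.Complexity.Mem.withStk (m : Mem Δ ι A) (i : ι) (l : List A) : Mem Δ ι A :=
  ⟨m.pos, Function.update m.stk i l, m.out⟩

theorem Mem.apply_update (m : Mem Δ ι A) (i : ι) (op : StackOp A) [DecidableEq ι] :
    m.apply w ⟨.stay, Function.update (fun _ => .keep) i op, none⟩ =
      m.withStk i (op.run (m.stk i)) := by
  ext1
  · rfl
  · funext j
    rcases eq_or_ne j i with rfl | hj
    · simp [Mem.apply, Mem.withStk]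
    · simp [Mem.apply, Mem.withStk, hj, StackOp.run]
  · simp [Mem.apply, Mem.withStk]

theorem Sem.within_act {f} (h : Sem w (act f) m m') : Within w (act f) m 1 m' := by
  obtain ⟨t, h⟩ := h
  cases h with
  | act h => exact ⟨1, le_rfl, .act h⟩

theorem sem_pop {i : ι} {a : A} :
    Sem w (pop i a) m m' ↔ ∃ l, m.stk i = a :: l ∧ m' = m.withStk i l := by
  constructor
  · rintro ⟨t, h⟩
    cases h with
    | act h =>
      dsimp only at h
      split_ifs at h with hs
      cases h
      obtain ⟨l, hl⟩ := List.head?_eq_some_iff.mp hs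
      refine ⟨l, hl, ?_⟩
      rw [Mem.apply_update, hl]
      rfl
  · rintro ⟨l, hl, rfl⟩
    refine ⟨1, ?_⟩
    have : m.withStk i l = m.withStk i (StackOp.pop.run (m.stk i)) := by rw [hl]; rfl
    classical
    rw [this, ← Mem.apply_update (w := w)]
    refine .act ?_
    rw [if_pos (by rw [Mem.tops, hl]; rfl)]

theorem Within.pop {i : ι} {a : A} {l : List A} (h : m.stk i = a :: l) :
    Within w (pop i a) m 1 (m.withStk i l) := by
  exact Sem.within_act (sem_pop.mpr ⟨l, h, rfl⟩)

theorem sem_push {i : ι} {a : A} :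
    Sem w (push i a) m m' ↔ m' = m.withStk i (a :: m.stk i) := by
  constructor
  · rintro ⟨t, h⟩
    cases h with
    | act h => cases h; rw [Mem.apply_update]; rfl
  · rintro rfl
    refine ⟨1, ?_⟩
    classical
    have := Mem.apply_update (w := w) m i (.push a)
    rw [show a :: m.stk i = (StackOp.push a).run (m.stk i) from rfl, ← this]
    exact .act rfl

theorem Within.push {i : ι} {a : A} :
    Within w (push i a) m 1 (m.withStk i (a :: m.stk i)) := by
  exact Sem.within_act (sem_push.mpr rfl)

theorem sem_empty {i : ι} : Sem w (empty i) m m' ↔ m.stk i = [] ∧ m' = m := by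
  constructor
  · rintro ⟨t, h⟩
    cases h with
    | act h =>
      dsimp only at h
      split_ifs at h with hs
      cases h
      exact ⟨List.head?_eq_none_iff.mp hs, by simp⟩
  · rintro ⟨hl, rfl⟩
    refine ⟨1, ?_⟩
    have : Exec w (empty i) m' 1 (m'.apply w .idle) :=
      .act (by rw [if_pos (by rw [Mem.tops, hl]; rfl)])
    rwa [Mem.apply_idle] at this

theorem Within.empty {i : ι} (h : m.stk i = []) : Within w (empty i) m 1 m := by
  exact Sem.within_act (sem_empty.mpr ⟨h, rfl⟩)

end Complexity.Prog

namespace PREAcceptor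

open Complexity Complexity.Prog PRE.Mark
open PRE (Level Mark Parse RefEffect)

/-- The stacks of the program. -/
inductive Stk where
  | goals
  | input
  | trace
  | aux
  | cnt
  | dbl

/-- The stack symbols of the program. -/
inductive StkSym where
  | goal (l : Level) (a : Bool)
  | bar
  | close (a : Bool)
  | tok (t : PREToken Unit)
  | mark (m : Mark)
  | unit

theorem finite_stk : Finite Stk :=
  Finite.of_surjective (α := Fin 6)
    (fun i => match i with
      | 0 => Stk.goals
      | 1 => .input
      | 2 => .trace
      | 3 => .aux
      | 4 => .cnt
      | 5 => .dbl)
    (fun m => by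
      cases m; exacts [⟨0, rfl⟩, ⟨1, rfl⟩, ⟨2, rfl⟩, ⟨3, rfl⟩, ⟨4, rfl⟩, ⟨5, rfl⟩])

theorem finite_level : Finite Level :=
  Finite.of_surjective (α := Fin 3)
    (fun i => match i with
      | 0 => Level.alt
      | 1 => .cat
      | 2 => .atom)
    (fun m => by cases m; exacts [⟨0, rfl⟩, ⟨1, rfl⟩, ⟨2, rfl⟩])

theorem finite_stkSym : Finite StkSym := by
  have := finite_level
  have := Mark.finite
  refine Finite.of_injective
    (β := (Level × Bool) ⊕ Bool ⊕ PREToken Unit ⊕ Mark ⊕ Bool)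
    (fun t => match t with
      | .goal l a => Sum.inl (l, a)
      | .close a => Sum.inr (Sum.inl a)
      | .tok t => Sum.inr (Sum.inr (Sum.inl t))
      | .mark m => Sum.inr (Sum.inr (Sum.inr (Sum.inl m)))
      | .bar => Sum.inr (Sum.inr (Sum.inr (Sum.inr true)))
      | .unit => Sum.inr (Sum.inr (Sum.inr (Sum.inr false)))) ?_
  intro x y h
  cases x <;> cases y <;> simp_all

/-- Programs of the acceptor. -/
abbrev AProg := Prog (PREToken Unit) Empty Stk StkSym

/-- The memory with given contents of the stacks. -/
def st (P : List StkSym) (I : List (PREToken Unit)) (T X : List Mark) (u v : ℕ) :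
    Mem Empty Stk StkSym :=
  ⟨0, fun i => match i with
    | .goals => P
    | .input => I.map .tok
    | .trace => T.map .mark
    | .aux => X.map .mark
    | .cnt => List.replicate u .unit
    | .dbl => List.replicate v .unit, []⟩

/-! ### Single stack operations of the acceptor. -/

section Primitives

variable {w : List (PREToken Unit)} {P P' : List StkSym} {I I' : List (PREToken Unit)}
  {T X T' X' : List Mark} {u v u' v' : ℕ} {m' : Mem Empty Stk StkSym}

@[simp] theorem withStk_goals : (st P I T X u v).withStk .goals P' = st P' I T X u v := by
  ext1 <;> first | rfl | (funext i; cases i <;> simp [Mem.withStk, st])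

@[simp] theorem withStk_input :
    (st P I T X u v).withStk .input (I'.map .tok) = st P I' T X u v := by
  ext1 <;> first | rfl | (funext i; cases i <;> simp [Mem.withStk, st])

@[simp] theorem withStk_trace :
    (st P I T X u v).withStk .trace (T'.map .mark) = st P I T' X u v := by
  ext1 <;> first | rfl | (funext i; cases i <;> simp [Mem.withStk, st])

@[simp] theorem withStk_aux :
    (st P I T X u v).withStk .aux (X'.map .mark) = st P I T X' u v := by
  ext1 <;> first | rfl | (funext i; cases i <;> simp [Mem.withStk, st])

@[simp] theorem withStk_cnt :
    (st P I T X u v).withStk .cnt (List.replicate u' .unit) = st P I T X u' v := by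
  ext1 <;> first | rfl | (funext i; cases i <;> simp [Mem.withStk, st])

@[simp] theorem withStk_dbl :
    (st P I T X u v).withStk .dbl (List.replicate v' .unit) = st P I T X u v' := by
  ext1 <;> first | rfl | (funext i; cases i <;> simp [Mem.withStk, st])

@[simp]
theorem sem_pop_goals {a} : Sem w (pop .goals a) (st P I T X u v) m' ↔
    ∃ P', P = a :: P' ∧ m' = st P' I T X u v := by
  rw [sem_pop]
  simp only [withStk_goals]
  rfl

@[simp]
theorem sem_pop_input {a} : Sem w (pop .input (.tok a)) (st P I T X u v) m' ↔
    ∃ I', I = a :: I' ∧ m' = st P I' T X u v := by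
  rw [sem_pop]
  constructor
  · rintro ⟨l, h, rfl⟩
    cases I with
    | nil => simp [st] at h
    | cons b I =>
      simp only [st, List.map_cons, List.cons.injEq, StkSym.tok.injEq] at h
      obtain ⟨rfl, rfl⟩ := h
      exact ⟨I, rfl, by simp⟩
  · rintro ⟨I', rfl, rfl⟩
    exact ⟨I'.map .tok, rfl, by simp⟩

@[simp]
theorem sem_pop_trace {a} : Sem w (pop .trace (.mark a)) (st P I T X u v) m' ↔
    ∃ T', T = a :: T' ∧ m' = st P I T' X u v := by
  rw [sem_pop]
  constructor
  · rintro ⟨l, h, rfl⟩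
    cases T with
    | nil => simp [st] at h
    | cons b T =>
      simp only [st, List.map_cons, List.cons.injEq, StkSym.mark.injEq] at h
      obtain ⟨rfl, rfl⟩ := h
      exact ⟨T, rfl, by simp⟩
  · rintro ⟨T', rfl, rfl⟩
    exact ⟨T'.map .mark, rfl, by simp⟩

@[simp]
theorem sem_pop_aux {a} : Sem w (pop .aux (.mark a)) (st P I T X u v) m' ↔
    ∃ X', X = a :: X' ∧ m' = st P I T X' u v := by
  rw [sem_pop]
  constructor
  · rintro ⟨l, h, rfl⟩
    cases X with
    | nil => simp [st] at h
    | cons b X =>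
      simp only [st, List.map_cons, List.cons.injEq, StkSym.mark.injEq] at h
      obtain ⟨rfl, rfl⟩ := h
      exact ⟨X, rfl, by simp⟩
  · rintro ⟨X', rfl, rfl⟩
    exact ⟨X'.map .mark, rfl, by simp⟩

@[simp]
theorem sem_pop_cnt : Sem w (pop .cnt .unit) (st P I T X u v) m' ↔
    ∃ u', u = u' + 1 ∧ m' = st P I T X u' v := by
  rw [sem_pop]
  constructor
  · rintro ⟨l, h, rfl⟩
    cases u with
    | zero => simp [st] at h
    | succ u =>
      simp only [st, List.replicate_succ, List.cons.injEq, true_and] at h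
      subst h
      exact ⟨u, rfl, by simp⟩
  · rintro ⟨u', rfl, rfl⟩
    exact ⟨List.replicate u' .unit, rfl, by simp⟩

@[simp]
theorem sem_pop_dbl : Sem w (pop .dbl .unit) (st P I T X u v) m' ↔
    ∃ v', v = v' + 1 ∧ m' = st P I T X u v' := by
  rw [sem_pop]
  constructor
  · rintro ⟨l, h, rfl⟩
    cases v with
    | zero => simp [st] at h
    | succ u =>
      simp only [st, List.replicate_succ, List.cons.injEq, true_and] at h
      subst h
      exact ⟨u, rfl, by simp⟩
  · rintro ⟨u', rfl, rfl⟩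
    exact ⟨List.replicate u' .unit, rfl, by simp⟩

theorem push_goals_eq (a) : (st P I T X u v).withStk .goals (a :: (st P I T X u v).stk .goals) =
    st (a :: P) I T X u v := withStk_goals

theorem push_trace_eq (a) :
    (st P I T X u v).withStk .trace (.mark a :: (st P I T X u v).stk .trace) =
      st P I (a :: T) X u v := by
  rw [show StkSym.mark a :: (st P I T X u v).stk .trace = (a :: T).map .mark from rfl,
    withStk_trace]

theorem push_aux_eq (a) :
    (st P I T X u v).withStk .aux (.mark a :: (st P I T X u v).stk .aux) =
      st P I T (a :: X) u v := by
  rw [show StkSym.mark a :: (st P I T X u v).stk .aux = (a :: X).map .mark from rfl,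
    withStk_aux]

theorem push_cnt_eq :
    (st P I T X u v).withStk .cnt (.unit :: (st P I T X u v).stk .cnt) =
      st P I T X (u + 1) v := by
  rw [show StkSym.unit :: (st P I T X u v).stk .cnt = List.replicate (u + 1) .unit from rfl,
    withStk_cnt]

theorem push_dbl_eq :
    (st P I T X u v).withStk .dbl (.unit :: (st P I T X u v).stk .dbl) =
      st P I T X u (v + 1) := by
  rw [show StkSym.unit :: (st P I T X u v).stk .dbl = List.replicate (v + 1) .unit from rfl,
    withStk_dbl]

@[simp]
theorem sem_push_goals {a} : Sem w (push .goals a) (st P I T X u v) m' ↔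
    m' = st (a :: P) I T X u v := by rw [sem_push, push_goals_eq]

@[simp]
theorem sem_push_trace {a} : Sem w (push .trace (.mark a)) (st P I T X u v) m' ↔
    m' = st P I (a :: T) X u v := by rw [sem_push, push_trace_eq]

@[simp]
theorem sem_push_aux {a} : Sem w (push .aux (.mark a)) (st P I T X u v) m' ↔
    m' = st P I T (a :: X) u v := by rw [sem_push, push_aux_eq]

@[simp]
theorem sem_push_cnt : Sem w (push .cnt .unit) (st P I T X u v) m' ↔
    m' = st P I T X (u + 1) v := by rw [sem_push, push_cnt_eq]

@[simp]
theorem sem_push_dbl : Sem w (push .dbl .unit) (st P I T X u v) m' ↔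
    m' = st P I T X u (v + 1) := by rw [sem_push, push_dbl_eq]

@[simp]
theorem sem_empty_goals : Sem w (empty .goals) (st P I T X u v) m' ↔
    P = [] ∧ m' = st P I T X u v := by rw [sem_empty]; simp [st]

@[simp]
theorem sem_empty_input : Sem w (empty .input) (st P I T X u v) m' ↔
    I = [] ∧ m' = st P I T X u v := by rw [sem_empty]; simp [st]

@[simp]
theorem sem_empty_trace : Sem w (empty .trace) (st P I T X u v) m' ↔
    T = [] ∧ m' = st P I T X u v := by rw [sem_empty]; simp [st]

@[simp]
theorem sem_empty_aux : Sem w (empty .aux) (st P I T X u v) m' ↔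
    X = [] ∧ m' = st P I T X u v := by rw [sem_empty]; simp [st]

@[simp]
theorem sem_empty_cnt : Sem w (empty .cnt) (st P I T X u v) m' ↔
    u = 0 ∧ m' = st P I T X u v := by rw [sem_empty]; simp [st]

@[simp]
theorem sem_empty_dbl : Sem w (empty .dbl) (st P I T X u v) m' ↔
    v = 0 ∧ m' = st P I T X u v := by rw [sem_empty]; simp [st]

theorem pop_goals {a} : Within w (pop .goals a) (st (a :: P) I T X u v) 1 (st P I T X u v) := by
  simpa using Within.pop (w := w) (m := st (a :: P) I T X u v) (i := .goals) rfl

theorem pop_input {a} :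
    Within w (pop .input (.tok a)) (st P (a :: I) T X u v) 1 (st P I T X u v) := by
  simpa using Within.pop (w := w) (m := st P (a :: I) T X u v) (i := .input) (l := I.map .tok) rfl

theorem pop_trace {a} :
    Within w (pop .trace (.mark a)) (st P I (a :: T) X u v) 1 (st P I T X u v) := by
  simpa using Within.pop (w := w) (m := st P I (a :: T) X u v) (i := .trace) (l := T.map .mark) rfl

theorem pop_aux {a} :
    Within w (pop .aux (.mark a)) (st P I T (a :: X) u v) 1 (st P I T X u v) := by
  simpa using Within.pop (w := w) (m := st P I T (a :: X) u v) (i := .aux) (l := X.map .mark) rfl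

theorem pop_cnt :
    Within w (pop .cnt .unit) (st P I T X (u + 1) v) 1 (st P I T X u v) := by
  simpa using Within.pop (w := w) (m := st P I T X (u + 1) v) (i := .cnt)
    (l := List.replicate u .unit) rfl

theorem pop_dbl :
    Within w (pop .dbl .unit) (st P I T X u (v + 1)) 1 (st P I T X u v) := by
  simpa using Within.pop (w := w) (m := st P I T X u (v + 1)) (i := .dbl)
    (l := List.replicate v .unit) rfl

theorem push_goals {a} :
    Within w (push .goals a) (st P I T X u v) 1 (st (a :: P) I T X u v) := by
  have := Within.push (w := w) (m := st P I T X u v) (i := .goals) (a := a)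
  rwa [push_goals_eq] at this

theorem push_trace {a} :
    Within w (push .trace (.mark a)) (st P I T X u v) 1 (st P I (a :: T) X u v) := by
  have := Within.push (w := w) (m := st P I T X u v) (i := .trace) (a := .mark a)
  rwa [push_trace_eq] at this

theorem push_aux {a} :
    Within w (push .aux (.mark a)) (st P I T X u v) 1 (st P I T (a :: X) u v) := by
  have := Within.push (w := w) (m := st P I T X u v) (i := .aux) (a := .mark a)
  rwa [push_aux_eq] at this

theorem push_cnt :
    Within w (push .cnt .unit) (st P I T X u v) 1 (st P I T X (u + 1) v) := by
  have := Within.push (w := w) (m := st P I T X u v) (i := .cnt) (a := .unit)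
  rwa [push_cnt_eq] at this

theorem push_dbl :
    Within w (push .dbl .unit) (st P I T X u v) 1 (st P I T X u (v + 1)) := by
  have := Within.push (w := w) (m := st P I T X u v) (i := .dbl) (a := .unit)
  rwa [push_dbl_eq] at this

theorem empty_goals : Within w (empty .goals) (st [] I T X u v) 1 (st [] I T X u v) :=
  Within.empty rfl

theorem empty_input : Within w (empty .input) (st P [] T X u v) 1 (st P [] T X u v) :=
  Within.empty rfl

theorem empty_trace : Within w (empty .trace) (st P I [] X u v) 1 (st P I [] X u v) :=
  Within.empty rfl

theorem empty_aux : Within w (empty .aux) (st P I T [] u v) 1 (st P I T [] u v) :=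
  Within.empty rfl

theorem empty_cnt : Within w (empty .cnt) (st P I T X 0 v) 1 (st P I T X 0 v) :=
  Within.empty rfl

theorem empty_dbl : Within w (empty .dbl) (st P I T X u 0) 1 (st P I T X u 0) :=
  Within.empty rfl

end Primitives

end PREAcceptor

/-! ## The programs for back references -/

namespace PREAcceptor

open Complexity Complexity.Prog PRE.Mark
open PRE (Level Mark Parse RefEffect)

/-- Double the counter. -/
noncomputable def double : AProg :=
  seq (star (seq (pop .cnt .unit) (seq (push .dbl .unit) (push .dbl .unit))))
    (seq (empty .cnt) (seq (star (seq (pop .dbl .unit) (push .cnt .unit))) (empty .dbl)))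

/-- Move one mark between the trace and the auxiliary stack. -/
noncomputable def mv (i j : Stk) (m : Mark) : AProg := seq (pop i (.mark m)) (push j (.mark m))

/-- Move one arbitrary mark. -/
noncomputable def mvAny (i j : Stk) : AProg :=
  choice (mv i j zero) (choice (mv i j opened) (choice (mv i j skipped) (mv i j closed)))

/-- Move the whole trace to the auxiliary stack. -/
noncomputable def rewind : AProg := seq (star (mvAny .trace .aux)) (empty .trace)

/-- Move the whole auxiliary stack to the trace. -/
noncomputable def restore : AProg := seq (star (mvAny .aux .trace)) (empty .aux)

/-- Move marks back to the trace, while the counter is decreased with every opening parenthesis. -/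
noncomputable def scan : AProg :=
  star (choice (mv .aux .trace zero) (choice (mv .aux .trace closed)
    (choice (seq (pop .cnt .unit) (mv .aux .trace opened))
      (seq (pop .cnt .unit) (mv .aux .trace skipped)))))

/-- Move the marks of a group back to the trace and count its letters. -/
noncomputable def scanGroup : AProg :=
  star (choice (seq (mv .aux .trace zero) (push .dbl .unit)) (choice (mv .aux .trace skipped)
    (choice (seq (push .cnt .unit) (mv .aux .trace opened))
      (seq (pop .cnt .unit) (mv .aux .trace closed)))))

/-- Match the counted letters. -/
noncomputable def copyLetters : AProg :=
  seq (star (seq (pop .dbl .unit) (push .trace (.mark zero)))) (empty .dbl)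

/-- Carry out a reference to the variable whose number is on the counter. -/
noncomputable def lookup : Bool → AProg
  | true => seq rewind (seq scan (seq (pop .cnt .unit) (seq (mv .aux .trace opened)
      (seq (empty .cnt) (seq scanGroup (seq (empty .cnt) (seq (mv .aux .trace closed)
        (seq restore copyLetters))))))))
  | false => seq rewind (seq scan (seq (empty .cnt) restore))

/-- Read the number of a back reference. -/
noncomputable def readNumber : AProg :=
  seq (pop .input (.tok (.digit true))) (seq (push .cnt .unit)
    (star (choice (seq (pop .input (.tok (.digit false))) double)
      (seq (pop .input (.tok (.digit true))) (seq double (push .cnt .unit))))))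

/-! ### Soundness and running time of the programs for back references. -/

section

variable {w : List (PREToken Unit)} {P P' : List StkSym} {I I' : List (PREToken Unit)}
  {T X T' X' : List Mark} {u v u' v' : ℕ} {m' : Mem Empty Stk StkSym}

/-- The loops may be left too early, but then a test for emptiness blocks; the invariants `2 * a + b
= 2 * u` and `a + b = 2 * u` leave one result. -/
theorem sem_double (h : Sem w double (st P I T X u 0) m') : m' = st P I T X (2 * u) 0 := by
  simp only [double, sem_seq] at h
  obtain ⟨m₁, h₁, m₂, h₂, m₃, h₃, h₄⟩ := h
  obtain ⟨a, b, rfl, h⟩ := h₁.star_invariant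
    (fun m => ∃ a b, m = st P I T X a b ∧ 2 * a + b = 2 * u)
    ⟨u, 0, rfl, by omega⟩ (by
      rintro _ m ⟨a, b, rfl, h⟩ hs
      simp at hs
      obtain ⟨a, rfl, rfl⟩ := hs
      exact ⟨a, b + 2, rfl, by omega⟩)
  simp at h₂
  obtain ⟨rfl, rfl⟩ := h₂
  obtain ⟨a, b, rfl, h⟩ := h₃.star_invariant (fun m => ∃ a b, m = st P I T X a b ∧ a + b = 2 * u)
    ⟨0, b, rfl, by omega⟩ (by
      rintro _ m ⟨a, b, rfl, h⟩ hs
      simp at hs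
      obtain ⟨a, rfl, rfl⟩ := hs
      exact ⟨_, _, rfl, by omega⟩)
  simp at h₄
  obtain ⟨rfl, rfl⟩ := h₄
  rw [← h]; rfl

theorem sem_mv_trace_aux {m} (h : Sem w (mv .trace .aux m) (st P I T X u v) m') :
    ∃ T', T = m :: T' ∧ m' = st P I T' (m :: X) u v := by
  simpa [mv] using h

theorem sem_mv_aux_trace {m} : Sem w (mv .aux .trace m) (st P I T X u v) m' ↔
    ∃ X', X = m :: X' ∧ m' = st P I (m :: T) X' u v := by
  simp [mv]

theorem sem_rewind (h : Sem w rewind (st P I T [] u v) m') : m' = st P I [] T.reverse u v := by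
  simp only [rewind, sem_seq] at h
  obtain ⟨m₁, h₁, h₂⟩ := h
  obtain ⟨T', X', rfl, h⟩ := h₁.star_invariant
    (fun m => ∃ T' X', m = st P I T' X' u v ∧ T = X'.reverse ++ T') ⟨T, [], rfl, rfl⟩ (by
      rintro _ m ⟨T', X', rfl, rfl⟩ hs
      simp only [mvAny, sem_choice] at hs
      rcases hs with hs | hs | hs | hs <;>
      · obtain ⟨T', rfl, rfl⟩ := sem_mv_trace_aux hs
        exact ⟨_, _, rfl, by simp⟩)
  simp at h₂
  obtain ⟨rfl, rfl⟩ := h₂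
  simp [h]

theorem sem_restore (h : Sem w restore (st P I T X u v) m') :
    m' = st P I (X.reverse ++ T) [] u v := by
  simp only [restore, sem_seq] at h
  obtain ⟨m₁, h₁, h₂⟩ := h
  obtain ⟨T', X', rfl, h⟩ := h₁.star_invariant
    (fun m => ∃ T' X', m = st P I T' X' u v ∧ X.reverse ++ T = X'.reverse ++ T')
    ⟨T, X, rfl, rfl⟩ (by
      rintro _ m ⟨T', X', rfl, h⟩ hs
      simp only [mvAny, sem_choice] at hs
      rcases hs with hs | hs | hs | hs <;>
      · obtain ⟨T', rfl, rfl⟩ := sem_mv_aux_trace.mp hs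
        exact ⟨_, _, rfl, by simp [h]⟩)
  simp at h₂
  obtain ⟨rfl, rfl⟩ := h₂
  simp [h]

/-- Where the scan stops is a guess; the invariant only records how many opening parentheses were
passed. -/
theorem sem_scan (h : Sem w scan (st P I [] X u v) m') :
    ∃ T X' u', m' = st P I T X' u' v ∧ X.reverse = X'.reverse ++ T ∧ u = u' + opens T := by
  refine h.star_invariant (fun m => ∃ T' X' u', m = st P I T' X' u' v ∧
    X.reverse = X'.reverse ++ T' ∧ u = u' + opens T') ⟨[], X, u, rfl, by simp, rfl⟩ ?_
  rintro _ m ⟨T', X', u', rfl, h, rfl⟩ hs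
  simp [mv] at hs
  rcases hs with ⟨X', rfl, rfl⟩ | ⟨X', rfl, rfl⟩ | ⟨u', rfl, X', rfl, rfl⟩ | ⟨u', rfl, X', rfl, rfl⟩
  all_goals exact ⟨_, _, _, rfl, by simp [h], by simp [opens]; try omega⟩

/-- The counter is now the nesting depth. A closing parenthesis requires a positive depth, so the
scan cannot run past the end of the group, and an empty counter afterwards certifies that the
scanned part is balanced. -/
theorem sem_scanGroup (h : Sem w scanGroup (st P I T X 0 0) m') :
    ∃ S X' d, m' = st P I (S ++ T) X' d (zeros S) ∧ X.reverse = X'.reverse ++ S ∧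
      depth 0 S = some d := by
  refine h.star_invariant (fun m => ∃ S X' d, m = st P I (S ++ T) X' d (zeros S) ∧
    X.reverse = X'.reverse ++ S ∧ depth 0 S = some d) ⟨[], X, 0, rfl, by simp, rfl⟩ ?_
  rintro _ m ⟨S, X', d, rfl, h, hd⟩ hs
  simp [mv] at hs
  rcases hs with ⟨X', rfl, rfl⟩ | ⟨X', rfl, rfl⟩ | ⟨X', rfl, rfl⟩ | ⟨u', rfl, X', rfl, rfl⟩
  · exact ⟨zero :: S, X', d, rfl, by simp [h], by simp [depth, hd, depthStep]⟩
  · exact ⟨skipped :: S, X', d, rfl, by simp [h], by simp [depth, hd, depthStep]⟩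
  · exact ⟨opened :: S, X', d + 1, rfl, by simp [h], by simp [depth, hd, depthStep]⟩
  · exact ⟨closed :: S, X', u', rfl, by simp [h], by simp [depth, hd, depthStep]⟩

theorem sem_copyLetters (h : Sem w copyLetters (st P I T X u v) m') :
    m' = st P I (List.replicate v zero ++ T) X u 0 := by
  simp only [copyLetters, sem_seq] at h
  obtain ⟨m₁, h₁, h₂⟩ := h
  obtain ⟨a, b, rfl, h⟩ := h₁.star_invariant
    (fun m => ∃ a b, m = st P I (List.replicate a zero ++ T) X u b ∧ a + b = v)
    ⟨0, v, rfl, by omega⟩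
    (by
      rintro _ m ⟨a, b, rfl, h⟩ hs
      simp at hs
      obtain ⟨b, rfl, rfl⟩ := hs
      exact ⟨a + 1, b, by simp [List.replicate_succ], by omega⟩)
  simp at h₂
  obtain ⟨rfl, rfl⟩ := h₂
  simp [← h]

/-- The trace is reversed so that its earliest mark is on top. The tests confirm the guesses: the
counter runs out exactly at the `u`-th opening parenthesis, which must be that of a matched group,
and the part up to the next closing parenthesis is balanced. In a skipped part only the existence of
that many parentheses is checked. -/
theorem sem_lookup {a : Bool} (h : Sem w (lookup a) (st P I T [] u 0) m') :
    ∃ T', RefEffect a u T T' ∧ m' = st P I T' [] 0 0 := by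
  cases a
  · simp only [lookup, sem_seq] at h
    obtain ⟨m₁, h₁, m₂, h₂, m₃, h₃, h₄⟩ := h
    obtain rfl := sem_rewind h₁
    obtain ⟨T', X', u', rfl, h, hu'⟩ := sem_scan h₂
    simp at h₃
    obtain ⟨rfl, rfl⟩ := h₃
    obtain rfl := sem_restore h₄
    rw [List.reverse_reverse] at h
    exact ⟨T, ⟨by rw [h, opens_append]; omega, rfl⟩, by rw [h]⟩
  · simp only [lookup, sem_seq] at h
    obtain ⟨m₁, h₁, m₂, h₂, m₃, h₃, m₄, h₄, m₅, h₅, m₆, h₆, m₇, h₇, m₈, h₈, m₉, h₉, h₁₀⟩ := h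
    obtain rfl := sem_rewind h₁
    obtain ⟨T', X', u', rfl, h, hu'⟩ := sem_scan h₂
    simp at h₃
    obtain ⟨u', rfl, rfl⟩ := h₃
    obtain ⟨X', rfl, rfl⟩ := sem_mv_aux_trace.mp h₄
    simp at h₅
    obtain ⟨rfl, rfl⟩ := h₅
    obtain ⟨S, X₁, d, rfl, h', hd⟩ := sem_scanGroup h₆
    simp at h₇
    obtain ⟨rfl, rfl⟩ := h₇
    obtain ⟨X₁, rfl, rfl⟩ := sem_mv_aux_trace.mp h₈
    obtain rfl := sem_restore h₉
    obtain rfl := sem_copyLetters h₁₀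
    rw [List.reverse_reverse] at h
    simp only [List.reverse_cons] at h h'
    rw [h'] at h
    have hT : T = X₁.reverse ++ closed :: (S ++ opened :: T') := by simp [h]
    exact ⟨_, ⟨zeros S, ⟨T', S, _, hT, hd, by omega, rfl⟩, rfl⟩, by rw [← hT]⟩

theorem bits_bit {k : ℕ} (b : Bool) (hk : 1 ≤ k) : Nat.bits (Nat.bit b k) = b :: Nat.bits k :=
  Nat.bits_append_bit _ _ (by omega)

/-- The demanded first digit one excludes the number zero and leading zeros, so the digits read so
far are always exactly those of the counter. -/
theorem sem_readNumber (h : Sem w readNumber (st P I T X 0 0) m') :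
    ∃ k I', 1 ≤ k ∧ I = (Nat.bits k).reverse.map .digit ++ I' ∧ m' = st P I' T X k 0 := by
  simp only [readNumber, sem_seq] at h
  obtain ⟨m₁, h₁, m₂, h₂, h₃⟩ := h
  simp at h₁
  obtain ⟨I, rfl, rfl⟩ := h₁
  simp at h₂
  obtain rfl := h₂
  refine h₃.star_invariant (fun m => ∃ k I', 1 ≤ k ∧
    PREToken.digit true :: I = (Nat.bits k).reverse.map .digit ++ I' ∧ m = st P I' T X k 0)
    ⟨1, I, le_rfl, by simp, rfl⟩ ?_
  rintro _ m ⟨k, I', hk, hI, rfl⟩ hs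
  simp only [sem_choice, sem_seq, sem_pop_input, ↓existsAndEq, and_true] at hs
  rcases hs with ⟨I₁, rfl, hs⟩ | ⟨I₁, rfl, m₁, hs, hs'⟩
  · obtain rfl := sem_double hs
    exact ⟨Nat.bit false k, I₁, by simp; omega, by rw [hI, bits_bit _ hk]; simp, by simp⟩
  · obtain rfl := sem_double hs
    simp at hs'
    obtain rfl := hs'
    exact ⟨Nat.bit true k, I₁, by simp, by rw [hI, bits_bit _ hk]; simp, by simp⟩

theorem within_double : Within w double (st P I T X u 0) (14 * u + 7) (st P I T X (2 * u) 0) := by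
  have h₁ : ∀ u v, Within w (star (seq (pop .cnt .unit) (seq (push .dbl .unit) (push .dbl .unit))))
      (st P I T X u v) (6 * u + 1) (st P I T X 0 (v + 2 * u)) := by
    intro u
    induction u with
    | zero => intro v; exact .star_nil
    | succ u ih =>
      intro v
      have := ((pop_cnt.seq (push_dbl.seq push_dbl)).star_cons (ih (v + 1 + 1))).mono
        (t' := 6 * (u + 1) + 1) (by omega)
      rwa [show v + 1 + 1 + 2 * u = v + 2 * (u + 1) by omega] at this
  have h₂ : ∀ v u, Within w (star (seq (pop .dbl .unit) (push .cnt .unit)))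
      (st P I T X u v) (4 * v + 1) (st P I T X (u + v) 0) := by
    intro v
    induction v with
    | zero => intro u; exact .star_nil
    | succ v ih =>
      intro u
      have := ((pop_dbl.seq push_cnt).star_cons (ih (u + 1))).mono
        (t' := 4 * (v + 1) + 1) (by omega)
      rwa [show u + 1 + v = u + (v + 1) by omega] at this
  have := (h₁ u 0).seq (empty_cnt.seq ((h₂ (0 + 2 * u) 0).seq empty_dbl))
  simp only [zero_add] at this
  exact this.mono (by omega)

theorem within_mv_trace_aux {m} :
    Within w (mv .trace .aux m) (st P I (m :: T) X u v) 3 (st P I T (m :: X) u v) :=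
  pop_trace.seq push_aux

theorem within_mv_aux_trace {m} :
    Within w (mv .aux .trace m) (st P I T (m :: X) u v) 3 (st P I (m :: T) X u v) :=
  pop_aux.seq push_trace

theorem Within.mvAny {i j : Stk} {m : Mark} {μ μ' : Mem Empty Stk StkSym}
    (h : Within w (mv i j m) μ 3 μ') : Within w (mvAny i j) μ 6 μ' := by
  cases m with
  | zero => exact h.choice_left.mono (by omega)
  | opened => exact h.choice_left.choice_right.mono (by omega)
  | skipped => exact h.choice_left.choice_right.choice_right.mono (by omega)
  | closed => exact h.choice_right.choice_right.choice_right.mono (by omega)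

theorem within_rewind : Within w rewind (st P I T [] u v) (7 * T.length + 3)
    (st P I [] T.reverse u v) := by
  have : ∀ T X, Within w (star (mvAny .trace .aux)) (st P I T X u v) (7 * T.length + 1)
      (st P I [] (T.reverse ++ X) u v) := by
    intro T
    induction T with
    | nil => intro X; exact .star_nil
    | cons m T ih =>
      intro X
      have := ((Within.mvAny within_mv_trace_aux).star_cons (ih (m :: X)))
      simp only [List.reverse_cons, List.append_assoc, List.singleton_append, List.length_cons]
      exact this.mono (by omega)
  have := (this T []).seq empty_trace
  rw [List.append_nil] at this
  exact this

theorem within_restore : Within w restore (st P I T X u v) (7 * X.length + 3)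
    (st P I (X.reverse ++ T) [] u v) := by
  have : ∀ X T, Within w (star (mvAny .aux .trace)) (st P I T X u v) (7 * X.length + 1)
      (st P I (X.reverse ++ T) [] u v) := by
    intro X
    induction X with
    | nil => intro T; exact .star_nil
    | cons m X ih =>
      intro T
      have := ((Within.mvAny within_mv_aux_trace).star_cons (ih (m :: T)))
      simp only [List.reverse_cons, List.append_assoc, List.singleton_append, List.length_cons]
      exact this.mono (by omega)
  exact (this X T).seq empty_aux

theorem within_scan : ∀ (Y : List Mark) (T X : List Mark) (u v : ℕ),
    Within w scan (st P I T (Y ++ X) (u + opens Y) v) (9 * Y.length + 1)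
      (st P I (Y.reverse ++ T) X u v)
  | [], T, X, u, v => .star_nil
  | m :: Y, T, X, u, v => by
    have ih := within_scan Y (m :: T) X u v
    rw [List.reverse_cons, List.append_assoc, List.singleton_append, List.cons_append]
    cases m with
    | zero => exact (within_mv_aux_trace.choice_left.star_cons ih).mono (by simp; omega)
    | closed =>
      exact (within_mv_aux_trace.choice_left.choice_right.star_cons ih).mono (by simp; omega)
    | opened =>
      exact ((pop_cnt.seq within_mv_aux_trace).choice_left.choice_right.choice_right.star_cons
        ih).mono (by simp; omega)
    | skipped =>
      exact ((pop_cnt.seq within_mv_aux_trace).choice_right.choice_right.choice_right.star_cons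
        ih).mono (by simp; omega)

theorem within_scanGroup : ∀ (Y : List Mark) (T X : List Mark) (d d' v : ℕ),
    depth d Y.reverse = some d' →
    Within w scanGroup (st P I T (Y ++ X) d v) (9 * Y.length + 1)
      (st P I (Y.reverse ++ T) X d' (v + zeros Y))
  | [], T, X, d, d', v, h => by
    simp only [List.reverse_nil, depth, Option.some.injEq] at h
    subst h
    exact .star_nil
  | m :: Y, T, X, d, d', v, h => by
    rw [List.reverse_cons, depth_append] at h
    rw [List.reverse_cons, List.append_assoc, List.singleton_append, List.cons_append]
    cases m with
    | zero =>
      have ih := within_scanGroup Y (zero :: T) X d d' (v + 1) (by simpa [depth, depthStep] using h)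
      rw [show v + 1 + zeros Y = v + zeros (zero :: Y) by simp [zeros]; omega] at ih
      exact ((within_mv_aux_trace.seq push_dbl).choice_left.star_cons ih).mono (by simp; omega)
    | skipped =>
      have ih := within_scanGroup Y (skipped :: T) X d d' v (by simpa [depth, depthStep] using h)
      exact (within_mv_aux_trace.choice_left.choice_right.star_cons ih).mono (by simp; omega)
    | opened =>
      have ih := within_scanGroup Y (opened :: T) X (d + 1) d' v
        (by simpa [depth, depthStep] using h)
      exact ((push_cnt.seq within_mv_aux_trace).choice_left.choice_right.choice_right.star_cons
        ih).mono (by simp; omega)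
    | closed =>
      cases d with
      | zero => simp [depth, depthStep] at h
      | succ d =>
        have ih := within_scanGroup Y (closed :: T) X d d' v (by simpa [depth, depthStep] using h)
        exact ((pop_cnt.seq within_mv_aux_trace).choice_right.choice_right.choice_right.star_cons
          ih).mono (by simp; omega)

theorem within_copyLetters : Within w copyLetters (st P I T X u v) (4 * v + 3)
    (st P I (List.replicate v zero ++ T) X u 0) := by
  have : ∀ v T, Within w (star (seq (pop .dbl .unit) (push .trace (.mark zero))))
      (st P I T X u v) (4 * v + 1) (st P I (List.replicate v zero ++ T) X u 0) := by
    intro v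
    induction v with
    | zero => intro T; exact .star_nil
    | succ v ih =>
      intro T
      have := ((pop_dbl.seq push_trace).star_cons (ih (zero :: T))).mono
        (t' := 4 * (v + 1) + 1) (by omega)
      rw [List.replicate_succ', List.append_assoc]
      exact this
  exact (this v T).seq empty_dbl

theorem exists_suffix_opens : ∀ {T : List Mark} {k : ℕ}, k ≤ opens T →
    ∃ A B, T = A ++ B ∧ opens B = k
  | [], k, h => ⟨[], [], rfl, by simp [opens] at h ⊢; omega⟩
  | m :: T, k, h => by
    by_cases hk : k ≤ opens T
    · obtain ⟨A, B, rfl, hB⟩ := exists_suffix_opens hk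
      exact ⟨m :: A, B, rfl, hB⟩
    · refine ⟨[], m :: T, rfl, ?_⟩
      cases m <;> simp [opens] at h ⊢ <;> omega

@[simp]
theorem opens_reverse (T : List Mark) : opens T.reverse = opens T := by
  induction T with
  | nil => rfl
  | cons m T ih => cases m <;> simp [opens, ih]

@[simp]
theorem zeros_reverse (T : List Mark) : zeros T.reverse = zeros T := by
  induction T with
  | nil => rfl
  | cons m T ih => cases m <;> simp [zeros, ih]

theorem zeros_le_length (T : List Mark) : zeros T ≤ T.length := by
  induction T with
  | nil => simp [zeros]
  | cons m T ih => cases m <;> simp [zeros] <;> omega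

/-- The witnesses of `RefEffect` say where the scans have to stop, so the successful run uses
boundedly many passes over the trace. -/
theorem within_lookup {a : Bool} (h : RefEffect a u T T') :
    Within w (lookup a) (st P I T [] u 0) (40 * T.length + 40) (st P I T' [] 0 0) := by
  cases a
  · obtain ⟨h, rfl⟩ := h
    obtain ⟨A, B, rfl, rfl⟩ := exists_suffix_opens h
    have h₁ := within_rewind (w := w) (P := P) (I := I) (T := A ++ B) (u := opens B) (v := 0)
    have h₂ := within_scan (w := w) (P := P) (I := I) B.reverse [] A.reverse 0 0
    have h₃ := within_restore (w := w) (P := P) (I := I) (T := B) (X := A.reverse) (u := 0) (v := 0)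
    simp only [opens_reverse, zero_add, List.reverse_reverse, List.append_nil, List.reverse_append]
      at h₁ h₂ h₃
    exact (h₁.seq (h₂.seq (empty_cnt.seq h₃))).mono (by simp; omega)
  · obtain ⟨v, ⟨T₁, S, T₂, rfl, hS, rfl, rfl⟩, rfl⟩ := h
    have h₁ := within_rewind (w := w) (P := P) (I := I)
      (T := T₂ ++ closed :: (S ++ opened :: T₁)) (u := opens T₁ + 1) (v := 0)
    have h₂ := within_scan (w := w) (P := P) (I := I) T₁.reverse []
      (opened :: (S.reverse ++ closed :: T₂.reverse)) 1 0
    have h₃ := within_scanGroup (w := w) (P := P) (I := I) S.reverse (opened :: T₁)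
      (closed :: T₂.reverse) 0 0 0 (by rwa [List.reverse_reverse])
    have h₄ := within_restore (w := w) (P := P) (I := I) (T := closed :: (S ++ opened :: T₁))
      (X := T₂.reverse) (u := 0) (v := zeros S)
    have h₅ := within_copyLetters (w := w) (P := P) (I := I)
      (T := T₂ ++ closed :: (S ++ opened :: T₁)) (X := []) (u := 0) (v := zeros S)
    simp only [opens_reverse, zeros_reverse, zero_add, List.reverse_reverse, List.append_nil,
      List.reverse_append, List.reverse_cons, List.append_assoc, List.nil_append,
      List.cons_append] at h₁ h₂ h₃ h₄ h₅
    rw [add_comm 1] at h₂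
    have := zeros_le_length S
    exact (h₁.seq (h₂.seq (pop_cnt.seq (within_mv_aux_trace.seq (empty_cnt.seq (h₃.seq
      (empty_cnt.seq (within_mv_aux_trace.seq (h₄.seq h₅))))))))).mono (by simp; omega)

/-- The number is built up in unary. This is affordable because a reference `k` that passes the
later test satisfies `k ≤ opens T`. -/
theorem within_readNumber {k : ℕ} (hk : 1 ≤ k) :
    Within w readNumber (st P ((Nat.bits k).reverse.map .digit ++ I) T X 0 0) (20 * k ^ 2 + 4)
      (st P I T X k 0) := by
  have key : ∀ k, 1 ≤ k → ∀ I, ∃ D, (Nat.bits k).reverse.map PREToken.digit ++ I =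
      .digit true :: D ∧
      Within w (star (choice (seq (pop .input (.tok (.digit false))) double)
        (seq (pop .input (.tok (.digit true))) (seq double (push .cnt .unit)))))
        (st P D T X 1 0) (20 * k ^ 2) (st P I T X k 0) := by
    intro k
    induction k using Nat.binaryRec with
    | zero => intro h; omega
    | bit b k ih =>
      intro _ I
      rcases Nat.eq_zero_or_pos k with rfl | hk
      · cases b
        · simp at *
        · exact ⟨I, by simp, Within.star_nil.mono (by simp)⟩
      · obtain ⟨D, hD, hw⟩ := ih hk (.digit b :: I)
        refine ⟨D, by rw [bits_bit _ hk, ← hD]; simp, ?_⟩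
        -- Appending a digit costs time linear in `k`, while the allowance `20 * k ^ 2` at least
        -- quadruples when `k` is doubled.
        have hq : k ≤ k ^ 2 := Nat.le_self_pow two_ne_zero k
        cases b
        · have := hw.star_snoc (pop_input.seq within_double).choice_left
          rw [Nat.bit_false_apply]
          refine this.mono ?_
          rw [mul_pow]; omega
        · have := hw.star_snoc (pop_input.seq (within_double.seq push_cnt)).choice_right
          rw [Nat.bit_true_apply]
          refine this.mono ?_
          nlinarith
  obtain ⟨D, hD, hw⟩ := key k hk I
  rw [hD]
  exact (pop_input.seq (push_cnt.seq hw)).mono (by omega)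

end

end PREAcceptor

/-! ## The acceptor and its correctness -/

namespace PREAcceptor

open Complexity Complexity.Prog PRE.Mark
open PRE (Level Mark Parse RefEffect)

/-- Programs for the goals that are matched or skipped. -/
noncomputable def goalSteps (a : Bool) : List AProg :=
  [seq (pop .goals (.goal .alt a)) (push .goals (.goal .cat a)),
    seq (pop .goals (.goal .cat a)) (push .goals (.goal .atom a)),
    seq (pop .goals (.goal .cat a)) (seq (push .goals (.goal .atom a))
      (push .goals (.goal .cat a))),
    seq (pop .goals (.goal .atom a)) (seq (pop .input (.tok (.letter ())))
      (bif a then push .trace (.mark zero) else seqs [])),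
    seq (pop .goals (.goal .atom a)) (seq (pop .input (.tok .backslash))
      (seq readNumber (lookup a))),
    seq (pop .goals (.goal .atom a)) (seq (pop .input (.tok .lparen))
      (seq (push .trace (.mark (bif a then opened else skipped)))
        (seq (push .goals (.close a)) (push .goals (.goal .alt a))))),
    seq (pop .goals (.close a)) (seq (pop .input (.tok .rparen))
      (bif a then push .trace (.mark closed) else seqs []))]

/-- The program that replaces an alternation by its branches. -/
noncomputable def altStep (a a₁ a₂ : Bool) : AProg :=
  seq (pop .goals (.goal .alt a)) (seq (push .goals (.goal .cat a₂))
    (seq (push .goals .bar) (push .goals (.goal .alt a₁))))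

/-- All ways to treat the topmost goal. -/
noncomputable def stepList : List AProg :=
  goalSteps true ++ goalSteps false ++ [altStep false false false, altStep true true false,
    altStep true false true, seq (pop .goals .bar) (pop .input (.tok .bar))]

/-- Treat the topmost goal. -/
noncomputable def step : AProg := choices stepList

/-- A list of goals is achieved. -/
inductive GoalsParse : List StkSym → List (PREToken Unit) → List Mark → List (PREToken Unit) →
    List Mark → Prop
  | nil {I T} : GoalsParse [] I T I T
  | goal {l a P I T I₁ T₁ I' T'} (h : Parse l a I T I₁ T₁) (hP : GoalsParse P I₁ T₁ I' T') :
      GoalsParse (.goal l a :: P) I T I' T'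
  | bar {P I T I' T'} (hP : GoalsParse P I T I' T') : GoalsParse (.bar :: P) (.bar :: I) T I' T'
  | close {a P I T I' T'} (hP : GoalsParse P I (bif a then closed :: T else T) I' T') :
      GoalsParse (.close a :: P) (.rparen :: I) T I' T'

/-! ### Goal stacks: soundness and running time of the search. -/

section

variable {w : List (PREToken Unit)} {P P' : List StkSym} {I I' : List (PREToken Unit)}
  {T X T' X' : List Mark} {u v u' v' : ℕ} {m m' : Mem Empty Stk StkSym}

/-- The statement runs backwards: if the goals after the step can be achieved, so could those before
it. Composed over a run that ends without goals, this builds a parse for the initial goal. -/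
theorem sem_goalSteps {a : Bool} {p : AProg} (hp : p ∈ goalSteps a)
    (h : Sem w p (st P I T [] 0 0) m') :
    ∃ P₁ I₁ T₁, m' = st P₁ I₁ T₁ [] 0 0 ∧
      ∀ I' T', GoalsParse P₁ I₁ T₁ I' T' → GoalsParse P I T I' T' := by
  simp only [goalSteps, List.mem_cons, List.not_mem_nil, or_false] at hp
  rcases hp with rfl | rfl | rfl | rfl | rfl | rfl | rfl
  · simp at h
    obtain ⟨P, rfl, rfl⟩ := h
    refine ⟨_, _, _, rfl, fun I' T' h => ?_⟩
    cases h with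
    | goal h hP => exact .goal (.alt_cat h) hP
  · simp at h
    obtain ⟨P, rfl, rfl⟩ := h
    refine ⟨_, _, _, rfl, fun I' T' h => ?_⟩
    cases h with
    | goal h hP => exact .goal (.cat_atom h) hP
  · simp at h
    obtain ⟨P, rfl, rfl⟩ := h
    refine ⟨_, _, _, rfl, fun I' T' h => ?_⟩
    cases h with
    | goal h hP =>
      cases hP with
      | goal h' hP => exact .goal (.cat_cat h h') hP
  · simp only [sem_seq, sem_pop_goals, sem_pop_input, ↓existsAndEq, and_true] at h
    obtain ⟨P, rfl, I, rfl, h⟩ := h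
    refine ⟨P, I, bif a then zero :: T else T, ?_, fun I' T' h => .goal (.letter a I T) h⟩
    cases a <;> simpa using h
  · simp only [sem_seq, sem_pop_goals, sem_pop_input, ↓existsAndEq, and_true] at h
    obtain ⟨P, rfl, I, rfl, m, h, h'⟩ := h
    obtain ⟨k, I', hk, rfl, rfl⟩ := sem_readNumber h
    obtain ⟨T', hT, rfl⟩ := sem_lookup h'
    exact ⟨_, _, _, rfl, fun I' T' h => .goal (.ref hk hT) h⟩
  · simp at h
    obtain ⟨P, rfl, I, rfl, rfl⟩ := h
    refine ⟨_, _, _, rfl, fun I' T' h => ?_⟩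
    cases h with
    | goal h hP =>
      cases hP with
      | close hP => exact .goal (.group h) hP
  · simp only [sem_seq, sem_pop_goals, sem_pop_input, ↓existsAndEq, and_true] at h
    obtain ⟨P, rfl, I, rfl, h⟩ := h
    refine ⟨P, I, bif a then closed :: T else T, ?_, fun I' T' h => .close h⟩
    cases a <;> simpa using h

theorem sem_altStep {a a₁ a₂ : Bool} (ha : a = (a₁ || a₂)) (ha' : (a₁ && a₂) = false)
    (h : Sem w (altStep a a₁ a₂) (st P I T [] 0 0) m') :
    ∃ P₁ I₁ T₁, m' = st P₁ I₁ T₁ [] 0 0 ∧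
      ∀ I' T', GoalsParse P₁ I₁ T₁ I' T' → GoalsParse P I T I' T' := by
  simp [altStep] at h
  obtain ⟨P, rfl, rfl⟩ := h
  refine ⟨_, _, _, rfl, fun I' T' h => ?_⟩
  cases h with
  | goal h hP =>
    cases hP with
    | bar hP =>
      cases hP with
      | goal h' hP => exact .goal (.alt_bar ha ha' h h') hP

theorem sem_step (h : Sem w step (st P I T [] 0 0) m') :
    ∃ P₁ I₁ T₁, m' = st P₁ I₁ T₁ [] 0 0 ∧
      ∀ I' T', GoalsParse P₁ I₁ T₁ I' T' → GoalsParse P I T I' T' := by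
  rw [step, sem_choices] at h
  obtain ⟨p, hp, h⟩ := h
  simp only [stepList, List.mem_append, List.mem_cons, List.not_mem_nil, or_false] at hp
  rcases hp with (hp | hp) | rfl | rfl | rfl | rfl
  · exact sem_goalSteps hp h
  · exact sem_goalSteps hp h
  · exact sem_altStep (a₁ := false) (a₂ := false) rfl rfl h
  · exact sem_altStep (a₁ := true) (a₂ := false) rfl rfl h
  · exact sem_altStep (a₁ := false) (a₂ := true) rfl rfl h
  · simp at h
    obtain ⟨P, rfl, I, rfl, rfl⟩ := h
    exact ⟨_, _, _, rfl, fun I' T' h => .bar h⟩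

theorem sem_steps (h : Sem w (seq (star step) (empty .goals)) (st P I T [] 0 0) m') :
    ∃ I' T', m' = st [] I' T' [] 0 0 ∧ GoalsParse P I T I' T' := by
  rw [sem_seq] at h
  obtain ⟨m, h, h'⟩ := h
  obtain ⟨P₁, I₁, T₁, rfl, hg⟩ := h.star_invariant (fun m => ∃ P₁ I₁ T₁, m = st P₁ I₁ T₁ [] 0 0 ∧
      ∀ I' T', GoalsParse P₁ I₁ T₁ I' T' → GoalsParse P I T I' T') ⟨P, I, T, rfl, fun _ _ => id⟩ (by
    rintro _ m ⟨P₁, I₁, T₁, rfl, hg⟩ hs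
    obtain ⟨P₂, I₂, T₂, rfl, hg'⟩ := sem_step hs
    exact ⟨P₂, I₂, T₂, rfl, fun I' T' h => hg _ _ (hg' _ _ h)⟩)
  simp at h'
  obtain ⟨rfl, rfl⟩ := h'
  exact ⟨_, _, rfl, hg _ _ .nil⟩

/-- Every continuation of a loop from `m'` gives one from `m` with at most `t` more steps. -/
def Leads (w : List (PREToken Unit)) (m : Mem Empty Stk StkSym) (t : ℕ)
    (m' : Mem Empty Stk StkSym) : Prop :=
  ∀ t' m'', Within w (star step) m' t' m'' → Within w (star step) m (t + t') m''

theorem Leads.trans {m₁ m₂ m₃ : Mem Empty Stk StkSym} {t t' : ℕ} (h : Leads w m₁ t m₂)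
    (h' : Leads w m₂ t' m₃) : Leads w m₁ (t + t') m₃ := fun s m hs => by
  rw [add_assoc]
  exact h _ _ (h' _ _ hs)

theorem Leads.mono {t t' : ℕ} (h : Leads w m t m') (ht : t ≤ t') : Leads w m t' m' :=
  fun s _ hs => (h s _ hs).mono (by omega)

/-- The constant is the number `18` of alternatives in `stepList` plus one step for entering the
loop. -/
theorem Leads.of_mem {p : AProg} (hp : p ∈ stepList) {t : ℕ} (h : Within w p m t m') :
    Leads w m (t + 19) m' := fun s _ hs =>
  ((Within.choices hp h).star_cons hs).mono (by simp [stepList, goalSteps])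

theorem Leads.goalStep {a : Bool} (i : Fin 7) {t : ℕ}
    (h : Within w ((goalSteps a)[i.1]'i.2) m t m') : Leads w m (t + 19) m' := by
  refine .of_mem ?_ h
  have : (goalSteps a)[i.1]'i.2 ∈ goalSteps a := List.getElem_mem _
  cases a <;> simp [stepList, this]

/-- A bound for the number of steps needed for one goal. -/
def cost (B : ℕ) : ℕ := 200 * (B + 1) ^ 2

theorem const_le_cost {t : ℕ} (h : t ≤ 200) (B : ℕ) : t ≤ cost B := by
  have : 1 ≤ (B + 1) ^ 2 := Nat.one_le_pow _ _ (by omega)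
  rw [cost]
  omega

/-- The number of goals that may be needed to reach a lower level. -/
def slack : Level → ℕ
  | .alt => 0
  | .cat => 1
  | .atom => 2

/-- Each token pays for three rounds: the descents from alternation to concatenation and to an atom,
and the treatment of the atom itself. A goal of a lower level has saved `slack l` rounds; this
surplus covers the extra rounds needed for the two binary rules. -/
theorem Leads.of_parse {l a} {B : ℕ} (h : Parse l a I T I' T') :
    (∃ S, T' = S ++ T) ∧ ∃ J, I = J ++ I' ∧ 1 ≤ J.length ∧ (T'.length ≤ B → ∀ P,
      ∃ n, n + slack l ≤ 3 * J.length ∧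
        Leads w (st (.goal l a :: P) I T [] 0 0) (n * cost B) (st P I' T' [] 0 0)) := by
  have bound : ∀ {t}, t ≤ 181 → t + 19 ≤ cost B := fun h => const_le_cost (by omega) B
  induction h with
  | alt_cat h ih =>
    obtain ⟨hS, J, hI, hJ, ih⟩ := ih
    refine ⟨hS, J, hI, hJ, fun hB P => ?_⟩
    obtain ⟨n, hn, ih⟩ := ih hB P
    refine ⟨n + 1, by simp only [slack] at hn ⊢; omega, Leads.mono
      (Leads.trans ((Leads.goalStep (w := w) 0 (pop_goals.seq push_goals)).mono
        (bound (by norm_num))) ih) (le_of_eq (by ring))⟩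
  | cat_atom h ih =>
    obtain ⟨hS, J, hI, hJ, ih⟩ := ih
    refine ⟨hS, J, hI, hJ, fun hB P => ?_⟩
    obtain ⟨n, hn, ih⟩ := ih hB P
    refine ⟨n + 1, by simp only [slack] at hn ⊢; omega, Leads.mono
      (Leads.trans ((Leads.goalStep (w := w) 1 (pop_goals.seq push_goals)).mono
        (bound (by norm_num))) ih) (le_of_eq (by ring))⟩
  | @alt_bar a a₁ a₂ I T I₁ T₁ I₂ T₂ ha ha' _ _ ih ih' =>
    obtain ⟨⟨S, rfl⟩, J, hI, hJ, ih⟩ := ih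
    obtain ⟨⟨S', rfl⟩, J', rfl, hJ', ih'⟩ := ih'
    refine ⟨⟨S' ++ S, by simp⟩, J ++ .bar :: J', by simp [hI], by simp; omega, fun hB P => ?_⟩
    obtain ⟨n, hn, ih⟩ := ih (by simp at hB ⊢; omega) (.bar :: .goal .cat a₂ :: P)
    obtain ⟨n', hn', ih'⟩ := ih' hB P
    refine ⟨n + n' + 2, ?_, Leads.mono (Leads.trans ((Leads.of_mem (w := w) (p := altStep a a₁ a₂)
      (by subst ha; cases a₁ <;> cases a₂ <;> simp [stepList] at ha' ⊢)
      (pop_goals (P := P).seq (push_goals.seq (push_goals.seq push_goals)))).mono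
      (bound (by norm_num))) (ih.trans (((Leads.of_mem (w := w)
      (p := seq (pop .goals .bar) (pop .input (.tok .bar))) (by simp [stepList])
      (pop_goals.seq pop_input)).mono (bound (by norm_num))).trans ih'))) (le_of_eq (by ring))⟩
    simp only [slack, List.length_append, List.length_cons] at hn hn' ⊢
    omega
  | @cat_cat a I T I₁ T₁ I₂ T₂ _ _ ih ih' =>
    obtain ⟨⟨S, rfl⟩, J, hI, hJ, ih⟩ := ih
    obtain ⟨⟨S', rfl⟩, J', rfl, hJ', ih'⟩ := ih'
    refine ⟨⟨S' ++ S, by simp⟩, J ++ J', by simp [hI], by simp; omega, fun hB P => ?_⟩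
    obtain ⟨n, hn, ih⟩ := ih (by simp at hB ⊢; omega) (.goal .atom a :: P)
    obtain ⟨n', hn', ih'⟩ := ih' hB P
    refine ⟨n + n' + 1, ?_, Leads.mono (Leads.trans ((Leads.goalStep (w := w)
      (a := a) 2 (pop_goals.seq (push_goals.seq push_goals))).mono
      (bound (by norm_num))) (ih.trans ih')) (le_of_eq (by ring))⟩
    simp only [slack, List.length_append] at hn hn' ⊢
    omega
  | letter a I T =>
    refine ⟨by cases a; exacts [⟨[], rfl⟩, ⟨[zero], rfl⟩], [.letter ()], rfl, le_rfl, fun _ P =>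
      ⟨1, by simp [slack], ?_⟩⟩
    rw [one_mul]
    refine (Leads.goalStep (w := w) (a := a) 3 (pop_goals.seq (pop_input.seq (t' := 1) ?_))).mono
      (bound (t := 5) (by norm_num))
    cases a
    exacts [.seqs_nil, push_trace]
  | @ref a k I T T' hk h =>
    have hT : ∃ S, T' = S ++ T := by
      cases a
      exacts [⟨[], h.2⟩, let ⟨v, _, h⟩ := h; ⟨_, h⟩]
    have hkT : k ≤ opens T := by
      cases a
      exacts [h.1, let ⟨v, h, _⟩ := h; h.le_opens]
    refine ⟨hT, .backslash :: (Nat.bits k).reverse.map .digit, rfl, by simp, fun hB P =>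
      ⟨1, by simp [slack], ?_⟩⟩
    have := opens_le_length T
    obtain ⟨S, hS⟩ := hT
    have hTB : T.length ≤ B := by rw [hS] at hB; simp at hB; omega
    refine (Leads.goalStep (w := w) (a := a) 4 (pop_goals.seq (pop_input.seq
      ((within_readNumber hk).seq (within_lookup h))))).mono ?_
    rw [cost, one_mul]
    have hkB : k ≤ B := by omega
    -- Reading the number is quadratic in `k` and the lookup linear in the length of `T`; both
    -- quantities are at most `B`.
    nlinarith [Nat.pow_le_pow_left hkB 2]
  | @group a I T I' T' _ ih =>
    obtain ⟨⟨S, rfl⟩, J, hI, hJ, ih⟩ := ih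
    refine ⟨?_, .lparen :: (J ++ [.rparen]), by simp [hI], by simp, fun hB P => ?_⟩
    · cases a
      exacts [⟨S ++ [skipped], by simp⟩, ⟨closed :: (S ++ [opened]), by simp⟩]
    obtain ⟨n, hn, ih⟩ := ih (by refine le_trans ?_ hB; cases a <;> simp) (.close a :: P)
    refine ⟨n + 2, ?_, Leads.mono (Leads.trans ((Leads.goalStep (w := w) (a := a) 5
      (pop_goals.seq (pop_input.seq (push_trace.seq (push_goals.seq push_goals))))).mono
      (bound (by norm_num))) (ih.trans ((Leads.goalStep (w := w) (a := a)
      (m := st (.close a :: P) (.rparen :: I') (S ++ (bif a then opened else skipped) :: T) [] 0 0)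
      (m' := st P I' (bif a then closed :: (S ++ (bif a then opened else skipped) :: T)
        else S ++ (bif a then opened else skipped) :: T) [] 0 0)
      6 (pop_goals.seq (pop_input.seq (t' := 1) (by
        cases a
        exacts [.seqs_nil, push_trace])))).mono (bound (by norm_num))))) (le_of_eq (by ring))⟩
    simp only [slack, List.length_append, List.length_cons, List.length_nil] at hn ⊢
    omega

theorem within_steps {B : ℕ} {a} (h : Parse .alt a I T I' T') (hB : T'.length ≤ B) :
    Within w (seq (star step) (empty .goals)) (st [.goal .alt a] I T [] 0 0)
      (3 * I.length * cost B + 3) (st [] I' T' [] 0 0) := by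
  obtain ⟨-, J, hI, -, h⟩ := Leads.of_parse (w := w) (B := B) h
  obtain ⟨n, hn, h⟩ := h hB []
  refine ((h 1 _ .star_nil).seq empty_goals).mono ?_
  have : n ≤ 3 * I.length := by rw [hI]; simp [slack] at hn ⊢; omega
  have := Nat.mul_le_mul_right (cost B) this
  omega

/-- The program that compares the matched letters with the string. If `exact` is `false`, letters of
the string may be left over. -/
noncomputable def finish (exact : Bool) : AProg :=
  seq (pop .input (.tok .sep)) (seq (star (choice (pop .trace (.mark opened))
    (choice (pop .trace (.mark skipped)) (choice (pop .trace (.mark closed))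
      (seq (pop .trace (.mark zero)) (pop .input (.tok (.letter ())))))))) (seq (empty .trace)
        (seq (bif exact then seqs [] else star (pop .input (.tok (.letter ())))) (empty .input))))

/-- Parentheses of the trace are dropped and each matched letter is cancelled against a letter of
the string; the guessed loops are controlled by the emptiness tests. -/
theorem sem_finish {exact : Bool} (h : Sem w (finish exact) (st P I T X u v) m') :
    ∃ n, I = .sep :: List.replicate n (.letter ()) ∧ zeros T ≤ n ∧
      (exact = true → zeros T = n) := by
  simp only [finish, sem_seq, sem_pop_input, ↓existsAndEq, and_true] at h
  obtain ⟨I, rfl, m₁, h₁, m₂, h₂, m₃, h₃, h₄⟩ := h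
  obtain ⟨T', I', j, rfl, rfl, hj⟩ := h₁.star_invariant (fun m => ∃ T' I' j, m = st P I' T' X u v ∧
    I = List.replicate j (.letter ()) ++ I' ∧ zeros T = j + zeros T')
    ⟨T, I, 0, rfl, rfl, by omega⟩ (by
      rintro _ m ⟨T', I', j, rfl, rfl, hj⟩ hs
      simp at hs
      rcases hs with ⟨T', rfl, rfl⟩ | ⟨T', rfl, rfl⟩ | ⟨T', rfl, rfl⟩ | ⟨T', rfl, I', rfl, rfl⟩
      · exact ⟨_, _, _, rfl, rfl, hj⟩
      · exact ⟨_, _, _, rfl, rfl, hj⟩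
      · exact ⟨_, _, _, rfl, rfl, hj⟩
      · exact ⟨_, _, j + 1, rfl, by simp [List.replicate_succ'], by simp [hj, zeros]; omega⟩)
  simp at h₂
  obtain ⟨rfl, rfl⟩ := h₂
  simp only [zeros, add_zero] at hj
  cases exact
  · obtain ⟨I₁, i, rfl, rfl⟩ := h₃.star_invariant (fun m => ∃ I₁ i, m = st P I₁ [] X u v ∧
      I' = List.replicate i (.letter ()) ++ I₁) ⟨I', 0, rfl, rfl⟩ (by
        rintro _ m ⟨I₁, i, rfl, rfl⟩ hs
        simp at hs
        obtain ⟨I₁, rfl, rfl⟩ := hs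
        exact ⟨_, i + 1, rfl, by simp [List.replicate_succ']⟩)
    simp at h₄
    obtain ⟨rfl, rfl⟩ := h₄
    exact ⟨j + i, by simp, by omega, by simp⟩
  · simp at h₃
    subst h₃
    simp at h₄
    obtain ⟨rfl, rfl⟩ := h₄
    exact ⟨j, by simp, hj.le, fun _ => hj⟩

theorem within_finish {exact : Bool} {n : ℕ} (hn : zeros T ≤ n) (he : exact = true → zeros T = n) :
    ∃ m', Within w (finish exact) (st P (.sep :: List.replicate n (.letter ())) T X u v)
      (7 * T.length + 2 * n + 20) m' := by
  have h₁ : ∀ (T : List Mark) (I : List (PREToken Unit)), Within w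
      (star (choice (pop .trace (.mark opened))
        (choice (pop .trace (.mark skipped)) (choice (pop .trace (.mark closed))
          (seq (pop .trace (.mark zero)) (pop .input (.tok (.letter ()))))))))
      (st P (List.replicate (zeros T) (.letter ()) ++ I) T X u v) (7 * T.length + 1)
      (st P I [] X u v) := by
    intro T I
    induction T with
    | nil => exact .star_nil
    | cons m T ih =>
      cases m with
      | zero => exact ((pop_trace.seq pop_input).choice_right.choice_right.choice_right.star_cons
          ih).mono (by simp; omega)
      | opened => exact (pop_trace.choice_left.star_cons ih).mono (by simp; omega)
      | skipped => exact (pop_trace.choice_left.choice_right.star_cons ih).mono (by simp; omega)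
      | closed =>
        exact (pop_trace.choice_left.choice_right.choice_right.star_cons ih).mono (by simp; omega)
  have h₂ : ∀ i : ℕ, Within w (star (pop .input (.tok (.letter ()))))
      (st P (List.replicate i (.letter ())) [] X u v) (2 * i + 1) (st P [] [] X u v) := by
    intro i
    induction i with
    | zero => exact .star_nil
    | succ i ih => exact (pop_input.star_cons ih).mono (by omega)
  obtain ⟨i, rfl⟩ := Nat.exists_eq_add_of_le hn
  have h₃ := h₁ T (List.replicate i (.letter ()))
  rw [List.replicate_append_replicate] at h₃
  refine ⟨st P [] [] X u v, ?_⟩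
  cases exact
  · exact (pop_input.seq (h₃.seq (empty_trace.seq ((h₂ i).seq empty_input)))).mono (by omega)
  · obtain rfl : i = 0 := by have := he rfl; omega
    exact (pop_input.seq (h₃.seq (empty_trace.seq (Within.seqs_nil.seq empty_input)))).mono
      (by omega)

end

end PREAcceptor

/-! ## Membership in NP -/

namespace PREAcceptor

open Complexity Complexity.Prog PRE.Mark
open PRE (Level Mark Parse RefEffect)

/-- The memory at the beginning, with the input head at `p` and a part of the input copied. -/
def copied (p : ℕ) (I : List (PREToken Unit)) : Mem Empty Stk StkSym :=
  ⟨p, (st [] I [] [] 0 0).stk, []⟩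

theorem copied_zero (I : List (PREToken Unit)) : copied 0 I = st [] I [] [] 0 0 := rfl

theorem init_eq : (Mem.init : Mem Empty Stk StkSym) = copied 0 [] := by
  ext1 <;> first | rfl | (funext i; cases i <;> rfl)

/-- Move the input head. -/
def move (d : Dir) : Effect Empty Stk StkSym := ⟨d, fun _ => .keep, none⟩

/-- Copy a token and move the input head to the left. -/
def copyToken (x : PREToken Unit) : Effect Empty Stk StkSym :=
  ⟨.left, fun i => match i with | .input => .push (.tok x) | _ => .keep, none⟩

/-- The program that copies the input to a stack. -/
def copy : AProg :=
  seq (act fun _ _ => some (move .right)) (seq (star (act fun x _ => x.map fun _ => move .right))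
    (seq (act fun x _ => if x.isNone then some (move .left) else none)
      (seq (star (act fun x _ => x.map copyToken))
        (act fun x _ => if x.isNone then some .idle else none))))

/-! ### Copying the input, and correctness of the whole acceptor. -/

section

variable {w : List (PREToken Unit)} {p : ℕ} {I : List (PREToken Unit)} {m' : Mem Empty Stk StkSym}

theorem sem_act {f : Option (PREToken Unit) → (Stk → Option StkSym) → _}
    {m : Mem Empty Stk StkSym} : Sem w (act f) m m' ↔
    ∃ e, f (Machine.readInput w m.pos) m.tops = some e ∧ m' = m.apply w e := by
  constructor
  · rintro ⟨t, h⟩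
    cases h with
    | act h => exact ⟨_, h, rfl⟩
  · rintro ⟨e, h, rfl⟩
    exact ⟨1, .act h⟩

theorem apply_move (d : Dir) :
    (copied p I).apply w (move d) = copied (Machine.moveInput w p d) I := by
  simp [Mem.apply, move, copied, StackOp.run]

theorem apply_copyToken (x : PREToken Unit) :
    (copied p I).apply w (copyToken x) = copied (p - 1) (x :: I) := by
  ext1
  · rfl
  · funext i; cases i <;> rfl
  · rfl

theorem readInput_succ (p : ℕ) : Machine.readInput w (p + 1) = w[p]? := rfl

/-- The head first runs to the right end and pushes the tokens on its way back, so that the first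
token ends on top. -/
theorem sem_copy (h : Sem w copy (copied 0 []) m') : m' = copied 0 w := by
  simp only [copy, sem_seq] at h
  obtain ⟨m₁, h₁, m₂, h₂, m₃, h₃, m₄, h₄, h₅⟩ := h
  obtain ⟨_, he, rfl⟩ := sem_act.mp h₁
  cases he
  rw [apply_move] at h₂
  obtain ⟨p, rfl, hp⟩ := h₂.star_invariant (fun m => ∃ p, m = copied (p + 1) [] ∧ p ≤ w.length)
    ⟨0, by simp [Machine.moveInput], by simp⟩ (by
      rintro _ m ⟨p, rfl, hp⟩ hs
      obtain ⟨e, he, rfl⟩ := sem_act.mp hs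
      simp only [Option.map_eq_some_iff] at he
      obtain ⟨x, hx, rfl⟩ := he
      have : p < w.length := by
        by_contra hn
        simp [copied, readInput_succ, List.getElem?_eq_none (not_lt.mp hn)] at hx
      exact ⟨p + 1, by rw [apply_move]; simp only [Machine.moveInput]; congr 1; omega, this⟩)
  obtain ⟨e, he, rfl⟩ := sem_act.mp h₃
  -- The guessed loop cannot have stopped inside the word, because the next action insists on an
  -- endmarker.
  have hp' : p = w.length := by
    by_contra hn
    have : p < w.length := by omega
    simp [copied, readInput_succ, List.getElem?_eq_getElem this] at he
  split_ifs at he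
  cases he
  rw [apply_move] at h₄
  obtain ⟨q, rfl, hq⟩ := h₄.star_invariant
    (fun m => ∃ q, m = copied q (w.drop q) ∧ q ≤ w.length)
    ⟨p, by simp [Machine.moveInput, hp'], hp⟩ (by
      rintro _ m ⟨q, rfl, hq⟩ hs
      obtain ⟨e, he, rfl⟩ := sem_act.mp hs
      simp only [Option.map_eq_some_iff] at he
      obtain ⟨x, hx, rfl⟩ := he
      cases q with
      | zero => simp [copied, Machine.readInput] at hx
      | succ q =>
        refine ⟨q, ?_, by omega⟩
        rw [apply_copyToken, List.drop_eq_getElem_cons (i := q) (by omega)]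
        simp only [copied, readInput_succ, List.getElem?_eq_getElem (l := w) (i := q) (by omega),
          Option.some.injEq] at hx
        simp [hx])
  obtain ⟨e, he, rfl⟩ := sem_act.mp h₅
  cases q with
  | zero =>
    simp [copied, Machine.readInput] at he
    simp [← he]
  | succ q =>
    simp [copied, readInput_succ, List.getElem?_eq_getElem (l := w) (i := q) (by omega)] at he

theorem within_act {f : Option (PREToken Unit) → (Stk → Option StkSym) → _}
    {m : Mem Empty Stk StkSym} {e} (h : f (Machine.readInput w m.pos) m.tops = some e)
    (hm : m' = m.apply w e) : Within w (act f) m 1 m' :=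
  Sem.within_act (sem_act.mpr ⟨e, h, hm⟩)

theorem within_copy : Within w copy (copied 0 []) (4 * w.length + 20) (copied 0 w) := by
  have h₁ : ∀ n p, p + n = w.length → Within w (star (act fun x _ => x.map fun _ => move .right))
      (copied (p + 1) []) (2 * n + 1) (copied (w.length + 1) []) := by
    intro n
    induction n with
    | zero => rintro p rfl; exact .star_nil
    | succ n ih =>
      intro p hp
      refine (Within.star_cons (within_act (e := move .right) ?_ rfl) (t' := 2 * n + 1) ?_).mono
        (by omega)
      · simp [copied, readInput_succ, List.getElem?_eq_getElem (l := w) (i := p) (by omega)]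
      · rw [apply_move]
        convert ih (p + 1) (by omega) using 2
        simp [Machine.moveInput]; omega
  have h₂ : ∀ p ≤ w.length, Within w (star (act fun x _ => x.map copyToken))
      (copied p (w.drop p)) (2 * p + 1) (copied 0 w) := by
    intro p
    induction p with
    | zero => intro _; exact .star_nil
    | succ p ih =>
      intro hp
      refine (Within.star_cons (within_act (e := copyToken w[p]) ?_ rfl) (t' := 2 * p + 1) ?_).mono
        (by omega)
      · simp [copied, readInput_succ, List.getElem?_eq_getElem (l := w) (i := p) (by omega)]
      · rw [apply_copyToken, ← List.drop_eq_getElem_cons (i := p) (by omega)]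
        exact ih (by omega)
  have h₂' := h₂ w.length le_rfl
  rw [List.drop_length] at h₂'
  refine ((within_act (e := move .right) rfl ?_).seq ((h₁ w.length 0 (by omega)).seq
    ((within_act (e := move .left) ?_ ?_).seq (h₂'.seq (within_act (e := .idle) ?_ ?_))))).mono
    (by omega)
  · rw [apply_move]; simp [Machine.moveInput]
  · simp [copied, readInput_succ]
  · rw [apply_move]; simp [Machine.moveInput]
  · simp [copied, Machine.readInput]
  · simp

/-- The program that accepts an instance if it is positive. -/
noncomputable def acceptor (exact : Bool) : AProg :=
  seq copy (seq (push .goals (.goal .alt true)) (seq (seq (star step) (empty .goals))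
    (finish exact)))

theorem list_unit_eq (u : List Unit) : u = List.replicate u.length () :=
  List.eq_replicate_iff.mpr ⟨rfl, fun _ _ => rfl⟩

theorem sem_acceptor {exact : Bool} (h : Sem w (acceptor exact) .init m') :
    ∃ (r : PRE Unit) (s u : List Unit), r.Valid ∧ r.StarFree ∧ w = PRE.encodeInstance r s ∧
      u ∈ r.language ∧ u.length ≤ s.length ∧ (exact = true → u.length = s.length) := by
  rw [init_eq] at h
  simp only [acceptor, sem_seq (p := copy), sem_seq (p := push _ _)] at h
  obtain ⟨m, h₁, m₂, h₂, h₃⟩ := h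
  rw [sem_copy h₁, copied_zero, sem_push_goals] at h₂
  subst h₂
  obtain ⟨m, h₃, h₄⟩ := sem_seq.mp h₃
  obtain ⟨I', T', rfl, hg⟩ := sem_steps h₃
  obtain ⟨n, rfl, hn, he⟩ := sem_finish h₄
  cases hg with
  | goal h hP =>
    cases hP
    obtain ⟨r, S, hp, hs, -, hv, hw, rfl, -, -, -, hm⟩ := h.sound
    obtain ⟨u, e', hu, hz, -⟩ := hm rfl _ rep_nil
    refine ⟨r, List.replicate n (), u, ⟨hp, hv⟩, hs, ?_, ⟨e', hu⟩, ?_, ?_⟩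
    · rw [hw, PRE.encodeInstance, List.map_replicate]
    · simp at hn ⊢; omega
    · intro h; have := he h; simp at this ⊢; omega

theorem within_acceptor {exact : Bool} {r : PRE Unit} {s u : List Unit} (hv : r.Valid)
    (hs : r.StarFree) (hu : u ∈ r.language) (hl : u.length ≤ s.length)
    (he : exact = true → u.length = s.length) (hw : w = PRE.encodeInstance r s) :
    ∃ m', Within w (acceptor exact) .init (1000 * (w.length + 1) ^ 3) m' := by
  obtain ⟨e', hu⟩ := hu
  obtain ⟨S, hp, -, -, hz, -, hS⟩ := hu.parse hv.1 hs (T := []) rfl rep_nil hv.2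
    (l := .alt) trivial (.sep :: s.map .letter)
  rw [List.append_nil] at hp
  have hlen : w.length = r.toTokens.length + s.length + 1 := by
    rw [hw]; simp [PRE.encodeInstance]; omega
  have hmap : s.map PREToken.letter = List.replicate s.length (.letter ()) := by
    conv_lhs => rw [list_unit_eq s]
    rw [List.map_replicate]
  rw [hmap] at hp
  have hwI : w = r.toTokens ++ .sep :: List.replicate s.length (.letter ()) := by
    rw [hw, PRE.encodeInstance, hmap]
  obtain ⟨m', hf⟩ := within_finish (w := w) (P := []) (T := S) (X := []) (u := 0) (v := 0)
    (exact := exact) (hz.trans_le hl) fun h => hz.trans (he h)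
  refine ⟨m', ?_⟩
  rw [init_eq]
  rw [← hwI] at hp
  -- The trace is no longer than the tokens of the expression plus the matched word, hence than the
  -- input: `B := w.length`.
  refine (within_copy.seq (push_goals.seq ((within_steps (B := w.length) hp (by omega)).seq
    hf))).mono ?_
  rw [cost]
  nlinarith [Nat.zero_le (w.length ^ 3), Nat.zero_le (w.length ^ 2)]

theorem inNP_of_acceptor (exact : Bool) {L : Language (PREToken Unit)}
    (hL : ∀ w, w ∈ L ↔ ∃ (r : PRE Unit) (s u : List Unit), r.Valid ∧ r.StarFree ∧
      w = PRE.encodeInstance r s ∧ u ∈ r.language ∧ u.length ≤ s.length ∧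
      (exact = true → u.length = s.length)) : InNP L := by
  have := finite_stk
  have := finite_stkSym
  refine InNP.of_prog (acceptor exact) (1000 * (Polynomial.X + 1) ^ 3) (fun w hw => ?_)
    fun w t m h => (hL w).mpr (sem_acceptor ⟨t, h⟩)
  obtain ⟨r, s, u, hv, hs, hwe, hu, hl, he⟩ := (hL w).mp hw
  obtain ⟨m', t, ht, h⟩ := within_acceptor hv hs hu hl he hwe
  refine ⟨t, m', ht.trans (le_of_eq ?_), h⟩
  simp

end

end PREAcceptor

/-! ### Both problems are in NP. -/

namespace PRE

theorem starFreeMembership_inNP : Complexity.InNP (starFreeMembership Unit) := by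
  refine PREAcceptor.inNP_of_acceptor true fun w => ⟨?_, ?_⟩
  · rintro ⟨r, s, hv, hs, hw, hu⟩
    exact ⟨r, s, s, hv, hs, hw, hu, le_rfl, fun _ => rfl⟩
  · rintro ⟨r, s, u, hv, hs, hw, hu, -, he⟩
    refine ⟨r, s, hv, hs, hw, ?_⟩
    rwa [PREAcceptor.list_unit_eq s, ← he rfl, ← PREAcceptor.list_unit_eq u]

/-- Over a single letter a word that is not longer than `s` is a prefix of `s`, so comparing lengths
decides whether it occurs. -/
theorem starFreeMatching_inNP : Complexity.InNP (starFreeMatching Unit) := by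
  refine PREAcceptor.inNP_of_acceptor false fun w => ⟨?_, ?_⟩
  · rintro ⟨r, s, hv, hs, hw, u, hu, h⟩
    exact ⟨r, s, u, hv, hs, hw, hu, h.length_le, by simp⟩
  · rintro ⟨r, s, u, hv, hs, hw, hu, hl, -⟩
    refine ⟨r, s, hv, hs, hw, u, hu,
      List.IsPrefix.isInfix ⟨List.replicate (s.length - u.length) (), ?_⟩⟩
    rw [PREAcceptor.list_unit_eq (u ++ _), PREAcceptor.list_unit_eq s]
    congr 1
    simp [hl]

end PRE

/-! ## Unique readability -/

namespace PRE

variable {σ : Type}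

theorem bits_injective : Function.Injective Nat.bits := by
  intro m
  induction m using Nat.binaryRec' with
  | zero =>
    intro n h
    cases n using Nat.binaryRec' with
    | zero => rfl
    | bit b n hn => rw [Nat.bits_append_bit _ _ hn] at h; simp at h
  | bit b m hm ih =>
    intro n h
    cases n using Nat.binaryRec' with
    | zero => rw [Nat.bits_append_bit _ _ hm] at h; simp at h
    | bit c n hn =>
      rw [Nat.bits_append_bit _ _ hm, Nat.bits_append_bit _ _ hn] at h
      simp only [List.cons.injEq] at h
      rw [h.1, ih h.2]

/-- An expression never ends in a token after which another one must begin. This separates tokens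
left over from a preceding operand from the admissible left boundaries. -/
theorem exists_toTokens_eq_concat (r : PRE σ) :
    ∃ y t, r.toTokens = y ++ [t] ∧ t ≠ .lparen ∧ t ≠ .bar := by
  induction r with
  | sym a => exact ⟨[], _, rfl, by simp, by simp⟩
  | ref k =>
    cases h : Nat.bits k with
    | nil => exact ⟨[], .backslash, by simp [toTokens, h], by simp, by simp⟩
    | cons b l =>
      exact ⟨.backslash :: l.reverse.map .digit, .digit b, by simp [toTokens, h], by simp, by simp⟩
  | alt r s _ ih =>
    exact let ⟨y, t, h, h'⟩ := ih; ⟨r.toTokens ++ .bar :: y, t, by simp [toTokens, h], h'⟩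
  | cat r s _ ih => exact let ⟨y, t, h, h'⟩ := ih; ⟨r.toTokens ++ y, t, by simp [toTokens, h], h'⟩
  | star r _ => exact ⟨_, _, rfl, by simp, by simp⟩
  | group r _ => exact ⟨.lparen :: r.toTokens, .rparen, by simp [toTokens], by simp, by simp⟩

theorem sep_notMem_toTokens (r : PRE σ) : PREToken.sep ∉ r.toTokens := by
  induction r <;> simp_all [toTokens]

/-- The tokens in front of an expression of a level do not continue it to the left. -/
def Level.Boundary : Level → List (PREToken σ) → Prop
  | alt, x => x = [] ∨ ∃ y, x = y ++ [.lparen]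
  | cat, x => (x = [] ∨ ∃ y, x = y ++ [.lparen]) ∨ ∃ y, x = y ++ [.bar]
  | atom, _ => True

theorem Level.Boundary.not_append {x : List (PREToken σ)} {r : PRE σ}
    (h : Level.cat.Boundary (x ++ r.toTokens)) : False := by
  obtain ⟨y, t, ht, h₁, h₂⟩ := r.exists_toTokens_eq_concat
  rw [ht, ← List.append_assoc] at h
  rcases h with (h | ⟨z, h⟩) | ⟨z, h⟩
  · simp at h
  · exact h₁ (by simpa using (List.append_inj' h rfl).2)
  · exact h₂ (by simpa using (List.append_inj' h rfl).2)

theorem Level.Boundary.not_append_bar {x : List (PREToken σ)}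
    (h : Level.alt.Boundary (x ++ [.bar])) : False := by
  rcases h with h | ⟨z, h⟩
  · simp at h
  · simpa using (List.append_inj' h rfl).2

/-- Digits are read off from the right until the backslash stops them. -/
theorem append_digits_inj {x x' : List (PREToken σ)} {l l' : List Bool}
    (h : x ++ .backslash :: l.map .digit = x' ++ .backslash :: l'.map .digit) :
    l = l' ∧ x = x' := by
  induction l using List.reverseRecOn generalizing l' with
  | nil =>
    cases l' using List.reverseRecOn with
    | nil => simpa using h
    | append_singleton l' b =>
      rw [List.map_append, ← List.cons_append, ← List.append_assoc] at h
      simpa using (List.append_inj' h rfl).2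
  | append_singleton l a ih =>
    cases l' using List.reverseRecOn with
    | nil =>
      rw [List.map_append, ← List.cons_append, ← List.append_assoc] at h
      simpa using (List.append_inj' h rfl).2
    | append_singleton l' b =>
      rw [List.map_append, List.map_append, ← List.cons_append, ← List.append_assoc,
        ← List.cons_append, ← List.append_assoc] at h
      obtain ⟨h₁, h₂⟩ := List.append_inj' h rfl
      obtain ⟨rfl, rfl⟩ := ih h₁
      simpa using h₂

/-- An expression of level `l` can be read off from the right. -/
def ReadableAt (l : Level) (r : PRE σ) : Prop :=
  ∀ (r' : PRE σ) (x x'), r'.IsParseTree → r'.StarFree → l.Admits r → l.Admits r' →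
    l.Boundary x → l.Boundary x' → x ++ r.toTokens = x' ++ r'.toTokens → r = r' ∧ x = x'

theorem Level.Boundary.cat {x : List (PREToken σ)} (h : Level.alt.Boundary x) :
    Level.cat.Boundary x := .inl h

/-- If the other reading were a concatenation, its last factor would be the atom, and its first
factor would stand at the end of `x`, against the boundary condition. -/
theorem ReadableAt.cat_of_atom {r : PRE σ} (h : ReadableAt .atom r) (hc : ¬ r.IsCat) :
    ReadableAt .cat r := by
  intro r' x x' hp hs ha ha' hb hb' he
  by_cases hc' : r'.IsCat
  · cases r' with
    | cat r₁ r₂ =>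
      rw [toTokens, ← List.append_assoc] at he
      obtain ⟨-, rfl⟩ := h _ _ _ hp.2.1 hs.2 ⟨ha, hc⟩ hp.2.2.2 trivial trivial he
      exact hb.not_append.elim
    | _ => exact hc'.elim
  · exact h _ _ _ hp hs ⟨ha, hc⟩ ⟨ha', hc'⟩ trivial trivial he

theorem ReadableAt.cat {r s : PRE σ} (hp : (cat r s).IsParseTree) (hr : ReadableAt .cat r)
    (hs : ReadableAt .atom s) : ReadableAt .cat (cat r s) := by
  intro r' x x' hp' hs' _ ha' hb hb' he
  rw [toTokens, ← List.append_assoc] at he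
  by_cases hc' : r'.IsCat
  · cases r' with
    | cat r' s' =>
      rw [toTokens, ← List.append_assoc] at he
      obtain ⟨rfl, he'⟩ := hs _ _ _ hp'.2.1 hs'.2 hp.2.2.2 hp'.2.2.2 trivial trivial he
      obtain ⟨rfl, rfl⟩ := hr _ _ _ hp'.1 hs'.1 hp.2.2.1 hp'.2.2.1 hb hb' he'
      exact ⟨rfl, rfl⟩
    | _ => exact hc'.elim
  · obtain ⟨-, rfl⟩ := hs _ _ _ hp' hs' hp.2.2.2 ⟨ha', hc'⟩ trivial trivial he
    exact hb'.not_append.elim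

/-- If the other reading were an alternation, its last branch would already exhaust the expression
and leave a bar at the end of `x`. -/
theorem ReadableAt.alt_of_cat {r : PRE σ} (h : ReadableAt .cat r) (hc : ¬ r.IsAlt) :
    ReadableAt .alt r := by
  intro r' x x' hp hs _ _ hb hb' he
  by_cases hc' : r'.IsAlt
  · cases r' with
    | alt r₁ r₂ =>
      rw [toTokens, List.append_cons, ← List.append_assoc, ← List.append_assoc] at he
      obtain ⟨-, rfl⟩ := h _ _ _ hp.2.1 hs.2 hc hp.2.2 hb.cat (.inr ⟨_, rfl⟩) he
      exact hb.not_append_bar.elim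
    | _ => exact hc'.elim
  · exact h _ _ _ hp hs hc hc' hb.cat hb'.cat he

theorem ReadableAt.alt {r s : PRE σ} (hp : (alt r s).IsParseTree) (hr : ReadableAt .alt r)
    (hs : ReadableAt .cat s) : ReadableAt .alt (alt r s) := by
  intro r' x x' hp' hs' _ _ hb hb' he
  rw [toTokens, List.append_cons, ← List.append_assoc, ← List.append_assoc] at he
  by_cases hc' : r'.IsAlt
  · cases r' with
    | alt r' s' =>
      rw [toTokens, List.append_cons r'.toTokens, ← List.append_assoc, ← List.append_assoc] at he
      obtain ⟨rfl, he'⟩ := hs _ _ _ hp'.2.1 hs'.2 hp.2.2 hp'.2.2 (.inr ⟨_, rfl⟩)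
        (.inr ⟨_, rfl⟩) he
      obtain ⟨rfl, rfl⟩ := hr _ _ _ hp'.1 hs'.1 trivial trivial hb hb'
          (List.append_cancel_right he')
      exact ⟨rfl, rfl⟩
    | _ => exact hc'.elim
  · obtain ⟨-, rfl⟩ := hs _ _ _ hp' hs' hp.2.2 hc' (.inr ⟨_, rfl⟩) hb'.cat he
    exact hb'.not_append_bar.elim

/-- Both binary operations associate to the left, so an expression splits from its right end: the
last token gives the kind of the last atom, and the boundary condition decides whether more operands
belong to the expression. Inside parentheses the opening parenthesis is again a boundary. -/
theorem readableAt {r : PRE σ} (hp : r.IsParseTree) (hs : r.StarFree) (l : Level) :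
    ReadableAt l r := by
  have lift : ∀ {r : PRE σ}, ¬ r.IsAlt → ¬ r.IsCat → ReadableAt .atom r → ∀ l, ReadableAt l r := by
    rintro r ha hc h (_ | _ | _)
    exacts [(ReadableAt.cat_of_atom h hc).alt_of_cat ha, ReadableAt.cat_of_atom h hc, h]
  have last : ∀ {x y : List (PREToken σ)} {a b}, x ++ [a] = y ++ [b] → x = y ∧ a = b := by
    intro x y a b h
    simpa using List.append_inj' h rfl
  induction r generalizing l with
  | star r _ => exact hs.elim
  | sym a =>
    refine lift (r := sym a) id id ?_ l
    intro r' x x' hp' hs' _ ha' _ _ he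
    cases r' with
    | sym b =>
      obtain ⟨h, h'⟩ := last he
      cases h'
      exact ⟨rfl, h⟩
    | ref k =>
      rw [toTokens, toTokens] at he
      rcases List.eq_nil_or_concat (Nat.bits k).reverse with h | ⟨l, b, h⟩
      · rw [h] at he
        cases (last he).2
      · rw [h, List.concat_eq_append, List.map_append, ← List.cons_append,
            ← List.append_assoc] at he
        cases (last he).2
    | group r' =>
      rw [toTokens, toTokens, ← List.cons_append,
            ← List.append_assoc] at he
      cases (last he).2
    | cat => exact (ha'.2 trivial).elim
    | alt => exact (ha'.1 trivial).elim
    | star => exact hs'.elim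
  | ref k =>
    refine lift (r := ref k) id id ?_ l
    intro r' x x' hp' hs' _ ha' _ _ he
    have aux : ∀ {z : List (PREToken σ)} {t}, (∀ b, t ≠ .digit b) → t ≠ .backslash →
        x ++ .backslash :: (Nat.bits k).reverse.map .digit = z ++ [t] → False := by
      intro z t h₁ h₂ he
      rcases List.eq_nil_or_concat (Nat.bits k).reverse with h | ⟨l, b, h⟩
      · rw [h] at he
        exact h₂ (last he).2.symm
      · rw [h, List.concat_eq_append, List.map_append, ← List.cons_append,
            ← List.append_assoc] at he
        exact h₁ _ (last he).2.symm
    cases r' with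
    | sym b => exact (aux (by simp) (by simp) he).elim
    | ref k' =>
      obtain ⟨h, h'⟩ := append_digits_inj he
      exact ⟨congrArg ref (bits_injective (List.reverse_injective h)), h'⟩
    | group r' =>
      rw [toTokens, toTokens, ← List.cons_append,
            ← List.append_assoc] at he
      exact (aux (by simp) (by simp) he).elim
    | cat => exact (ha'.2 trivial).elim
    | alt => exact (ha'.1 trivial).elim
    | star => exact hs'.elim
  | group r ih =>
    refine lift (r := group r) id id ?_ l
    intro r' x x' hp' hs' _ ha' _ _ he
    rw [toTokens, ← List.cons_append,
            ← List.append_assoc] at he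
    cases r' with
    | sym b => cases (last he).2
    | ref k =>
      rw [toTokens] at he
      rcases List.eq_nil_or_concat (Nat.bits k).reverse with h | ⟨l, b, h⟩
      · rw [h] at he
        cases (last he).2
      · rw [h, List.concat_eq_append, List.map_append, ← List.cons_append,
            ← List.append_assoc] at he
        cases (last he).2
    | group r' =>
      rw [toTokens, ← List.cons_append,
            ← List.append_assoc] at he
      have he := (last he).1
      rw [List.append_cons, List.append_cons x'] at he
      obtain ⟨rfl, h⟩ := ih hp hs .alt r' _ _ hp' hs' trivial trivial (.inr ⟨_, rfl⟩)
        (.inr ⟨_, rfl⟩) he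
      exact ⟨rfl, (last h).1⟩
    | cat => exact (ha'.2 trivial).elim
    | alt => exact (ha'.1 trivial).elim
    | star => exact hs'.elim
  | cat r s ih ih' =>
    have h := ReadableAt.cat hp (ih hp.1 hs.1 _) (ih' hp.2.1 hs.2 _)
    cases l with
    | alt => exact h.alt_of_cat id
    | cat => exact h
    | atom => intro _ _ _ _ _ ha; exact (ha.2 trivial).elim
  | alt r s ih ih' =>
    have h := ReadableAt.alt hp (ih hp.1 hs.1 _) (ih' hp.2.1 hs.2 _)
    cases l with
    | alt => exact h
    | cat => intro _ _ _ _ _ ha; exact (ha trivial).elim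
    | atom => intro _ _ _ _ _ ha; exact (ha.1 trivial).elim

/-- The written form of an instance determines the expression and the string. -/
theorem encodeInstance_inj {r r' : PRE σ} {s s' : List σ} (hp : r.IsParseTree) (hs : r.StarFree)
    (hp' : r'.IsParseTree) (hs' : r'.StarFree)
    (h : encodeInstance r s = encodeInstance r' s') : r = r' ∧ s = s' := by
  have hsep : ∀ s : List σ, PREToken.sep ∉ s.map PREToken.letter := by simp
  obtain ⟨h₁, -, h₂⟩ := (List.append_cons_inj_of_notMem (sep_notMem_toTokens _) (hsep _)).mp h
  refine ⟨(readableAt hp hs .alt _ [] [] hp' hs' trivial trivial (.inl rfl) (.inl rfl)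
    h₁).1, List.map_injective_iff.mpr (fun a b h => by simpa using h) h₂⟩

end PRE

/-! ## Computations as tableaux on a torus -/

namespace Complexity

/-- What the input tape carries at a position. -/
inductive InKind (Γ : Type) where
  | left
  | sym (a : Γ)
  | right

namespace InKind

variable {Γ : Type}

/-- The symbol that a machine reads; `none` stands for an endmarker. -/
def read : InKind Γ → Option Γ
  | sym a => some a
  | _ => none

/-- The movement of the head, which does not leave the part between the endmarkers. -/
def dir : InKind Γ → Dir → Dir
  | left, .left => .stay
  | right, .right => .stay
  | _, d => d

/-- The contents of the input tape. All positions to the right of the word count as endmarkers. -/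
def ofPos (w : List Γ) : ℕ → InKind Γ
  | 0 => left
  | j + 1 => w[j]?.elim right sym

theorem read_ofPos (w : List Γ) (j : ℕ) : (InKind.ofPos w j).read = Machine.readInput w j := by
  cases j with
  | zero => rfl
  | succ j =>
    rw [InKind.ofPos, Machine.readInput, if_neg (by omega), Nat.add_sub_cancel]
    cases w[j]? <;> rfl

theorem ofPos_eq_left_iff {w : List Γ} {j : ℕ} : InKind.ofPos w j = left ↔ j = 0 := by
  cases j with
  | zero => simp [InKind.ofPos]
  | succ j =>
    rw [InKind.ofPos]
    cases w[j]? <;> simp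

/-- The clamping of the input head becomes local: the endmarker under the head decides whether a
move is suppressed. The bound on `p` keeps the head from the infinitely many further positions that
also carry `right`. -/
theorem moveInput_eq {w : List Γ} {p : ℕ} (hp : p ≤ w.length + 1) (d : Dir) :
    (Machine.moveInput w p d : ℤ) = p + ((InKind.ofPos w p).dir d).offset := by
  cases p with
  | zero => cases d <;> simp [Machine.moveInput, InKind.ofPos, dir, Dir.offset]
  | succ p =>
    rcases Nat.lt_or_ge p w.length with h | h
    · rw [InKind.ofPos, List.getElem?_eq_getElem h]
      cases d <;> simp [Machine.moveInput, dir, Dir.offset]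
      omega
    · rw [InKind.ofPos, List.getElem?_eq_none h]
      cases d <;> simp [Machine.moveInput, dir, Dir.offset]
      omega

theorem finite [Finite Γ] : Finite (InKind Γ) := by
  refine Finite.of_injective (β := Option (Option Γ)) (fun k => match k with
    | left => none
    | right => some none
    | sym a => some (some a)) ?_
  intro x y h
  cases x <;> cases y <;> simp_all

end InKind

namespace Machine

variable {Γ : Type} (M : Machine Γ Empty)

/-- The information about a step that all cells of a row share: the state, what is scanned, the
action, and the effective movement of the input head. -/
structure Shared where
  state : M.Q
  input : Option Γ
  scanned : M.ι → M.A
  action : Action M.Q M.ι M.A Empty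
  dir : Dir

/-- The entries of a tableau. The rows are the computation between a row that shows the input and
rows that show nothing. A cell of a configuration shows a position of the input tape, the work
symbols at a position, and which heads are there. -/
inductive Cell where
  | top
  | ini (k : InKind Γ)
  | ord (k : InKind Γ) (h : Bool) (y : M.ι → M.A) (hd : M.ι → Bool) (g : M.Shared)

/-- The movement of a head, seen at two neighbouring cells. -/
def HeadRel : Dir → Bool → Bool → Bool → Bool → Prop
  | .stay, a, _, b, _ => b = a
  | .right, a, _, _, b' => b' = a
  | .left, _, a', b, _ => b = a'

variable {M} in
open Classical in
/-- A cell of the initial configuration. -/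
noncomputable def Cell.initial (k : InKind Γ) (g : M.Shared) : M.Cell :=
  .ord k (decide (k = .left)) (fun _ => M.blank) (fun _ => decide (k = .left)) g

/-- The correct windows of two neighbouring cells in a row and the next row. -/
inductive Window : M.Cell → M.Cell → M.Cell → M.Cell → Prop
  | top : Window .top .top .top .top
  | top_ini (k k') : Window .top .top (.ini k) (.ini k')
  | ini (k k') (g : M.Shared) (hg : g.state = M.start) :
      Window (.ini k) (.ini k') (.initial k g) (.initial k' g)
  | accept (k h y hd k' h' y' hd') (g : M.Shared) (hg : g.state ∈ M.accept) :
      Window (.ord k h y hd g) (.ord k' h' y' hd' g) .top .top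
  | step (k h y hd k' h' y' hd') (g : M.Shared) (h₁ hd₁ h₁' y₁' hd₁') (g' : M.Shared)
      (hδ : M.δ g.state g.input g.scanned g.action) (hq : g'.state = g.action.next)
      (hx : h = true → g.input = k.read ∧ g.dir = k.dir g.action.inMove)
      (hs : ∀ i, hd i = true → y i = g.scanned i)
      (hh : HeadRel g.dir h h' h₁ h₁')
      (hhd : ∀ i, HeadRel (g.action.move i) (hd i) (hd' i) (hd₁ i) (hd₁' i)) :
      Window (.ord k h y hd g) (.ord k' h' y' hd' g)
        (.ord k h₁ (fun i => bif hd i then g.action.write i else y i) hd₁ g')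
        (.ord k' h₁' y₁' hd₁' g')

theorem headRel_cast {N : ℕ} [NeZero N] (d : Dir) (p z : ZMod N) :
    HeadRel d (decide (z = p)) (decide (z + 1 = p)) (decide (z = p + d.offset))
      (decide (z + 1 = p + d.offset)) := by
  cases d <;> simp [HeadRel, Dir.offset, ← sub_eq_add_neg, eq_sub_iff_add_eq]

/-- A movement to the right is announced by the left cell of a window and realised in its right
cell; `hf` identifies that cell with the left cell of the next window. -/
theorem eq_of_headRel {N : ℕ} [NeZero N] {d : Dir} {p : ZMod N} {f f' : ZMod N → Bool}
    (hf : ∀ z, f' z = f (z + 1))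
    (h : ∀ z, HeadRel d (decide (z = p)) (decide (z + 1 = p)) (f z) (f' z)) (z : ZMod N) :
    f z = decide (z = p + d.offset) := by
  cases d with
  | left => simpa [HeadRel, Dir.offset, ← sub_eq_add_neg, eq_sub_iff_add_eq] using h z
  | stay => simpa [HeadRel, Dir.offset] using h z
  | right =>
    have := h (z - 1)
    rw [HeadRel, hf, sub_add_cancel] at this
    rw [this]
    simp [Dir.offset, sub_eq_iff_eq_add]

/-- Neighbouring windows overlap, so data common to the two cells of a window are common to the
whole row. -/
theorem eq_of_forall_add_one {N : ℕ} [NeZero N] {α : Type*} {f : ZMod N → α}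
    (h : ∀ z, f (z + 1) = f z) (z : ZMod N) : f z = f 0 := by
  have : ∀ n : ℕ, f (n : ZMod N) = f 0 := by
    intro n
    induction n with
    | zero => simp
    | succ n ih => rw [Nat.cast_succ, h, ih]
  rw [← ZMod.natCast_zmod_val z]
  exact this _

/-! ### Tableaux exist exactly for accepted words. -/

section

variable {M} {w : List Γ} {N : ℕ}

/-- The cells of a configuration. -/
def cell (w : List Γ) (c : M.Cfg) (g : M.Shared) (z : ZMod N) : M.Cell :=
  .ord (.ofPos w z.val) (decide (z = (c.inPos : ZMod N))) (fun i => c.tape i z.valMinAbs)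
    (fun i => decide (z = (c.head i : ZMod N))) g

theorem cell_initial (g : M.Shared) (z : ZMod N) :
    cell w M.initial g z = .initial (.ofPos w z.val) g := by
  have : z = 0 ↔ InKind.ofPos w z.val = .left := by
    rw [InKind.ofPos_eq_left_iff, ZMod.val_eq_zero]
  have h₁ : (M.initial.inPos : ZMod N) = 0 := Nat.cast_zero
  have h₂ : ∀ i, (M.initial.head i : ZMod N) = 0 := fun _ => Int.cast_zero
  rw [cell, Cell.initial]
  congr 1
  · rw [decide_eq_decide, h₁, this]
  · funext i
    rw [decide_eq_decide, h₂, this]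

variable [NeZero N]

/-- A configuration within the bounds of a tableau. -/
structure Cfg.Within (w : List Γ) (s : ℕ) (c : M.Cfg) : Prop where
  inPos : c.inPos ≤ w.length + 1
  head : ∀ i, (c.head i).natAbs ≤ s

theorem within_initial : (M.initial).Within w 0 := ⟨by simp [initial], by simp [initial]⟩

theorem Cfg.Within.apply {c : M.Cfg} {s : ℕ} (h : c.Within w s) (a) :
    (M.apply w c a).Within w (s + 1) := by
  constructor
  · have := h.inPos
    simp only [Machine.apply]
    cases a.inMove <;> simp [moveInput] <;> omega
  · intro i
    have := h.head i
    simp only [Machine.apply]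
    cases a.move i <;> simp [Dir.offset] <;> omega

/-- A two-way infinite tape is wound around the circle. Positions of absolute value less than `N /
2` remain distinct, so a head that stays within them sees its own cell. -/
theorem valMinAbs_eq_iff {z : ZMod N} {p : ℤ} (hp : 2 * p.natAbs < N) :
    z.valMinAbs = p ↔ z = (p : ZMod N) := by
  rw [ZMod.valMinAbs_spec]
  constructor
  · exact fun h => h.1
  · exact fun h => ⟨h, by constructor <;> omega⟩

/-- The cells of the next configuration. -/
theorem cell_apply {c : M.Cfg} {s : ℕ} (hc : c.Within w s) (hs : 2 * s < N)
    (a : Action M.Q M.ι M.A Empty) (g' : M.Shared) (z : ZMod N) :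
    cell w (M.apply w c a) g' z = .ord (.ofPos w z.val)
      (decide (z = (c.inPos : ZMod N) + (((InKind.ofPos w c.inPos).dir a.inMove).offset : ℤ)))
      (fun i => bif decide (z = (c.head i : ZMod N)) then a.write i else c.tape i z.valMinAbs)
      (fun i => decide (z = (c.head i : ZMod N) + ((a.move i).offset : ℤ))) g' := by
  have h₁ : ((M.apply w c a).inPos : ZMod N) =
      (c.inPos : ZMod N) + (((InKind.ofPos w c.inPos).dir a.inMove).offset : ℤ) := by
    have := congrArg (Int.cast (R := ZMod N)) (InKind.moveInput_eq hc.inPos a.inMove)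
    simpa [Machine.apply] using this
  have h₂ : ∀ i, (M.apply w c a).tape i z.valMinAbs =
      bif decide (z = (c.head i : ZMod N)) then a.write i else c.tape i z.valMinAbs := by
    intro i
    have := valMinAbs_eq_iff (z := z) (p := c.head i) (by have := hc.head i; omega)
    simp only [Machine.apply, Function.update_apply, this]
    split_ifs with h <;> simp [h]
  simp only [cell, h₁, h₂]
  simp [Machine.apply]

theorem natCast_inj_of_lt {N p : ℕ} (hp : p < N) {z : ZMod N} : z = (p : ZMod N) → z.val = p := by
  rintro rfl
  exact ZMod.val_cast_of_lt hp

/-- A tableau with `T` rows on a torus of width `N` that starts with the word `w`. -/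
def IsTableau (M : Machine Γ Empty) (w : List Γ) (T N : ℕ) (τ : ℕ → ZMod N → M.Cell) : Prop :=
  (∀ t < T, ∀ z, M.Window (τ t z) (τ t (z + 1)) (τ (t + 1) z) (τ (t + 1) (z + 1))) ∧
    (∀ z, τ T z = τ 0 z) ∧ ∀ z, τ 0 z = .ini (.ofPos w z.val)

/-- As long as no accepting state occurs, the windows force row `s + 1` to be the configuration
after `s` steps. The bound `2 * T ≤ N` prevents the work heads from meeting themselves around the
torus. -/
theorem IsTableau.row {T : ℕ} {τ : ℕ → ZMod N → M.Cell} (h : M.IsTableau w T N τ)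
    (hN : 2 * T ≤ N) (hw : w.length + 1 < N) (hna : ∀ t, ¬ M.AcceptsIn w t) :
    ∀ s, s + 1 ≤ T → ∃ c g, M.ReachesIn w s c ∧ g.state = c.state ∧ c.Within w s ∧
      ∀ z, τ (s + 1) z = cell w c g z := by
  intro s
  induction s with
  | zero =>
    intro hT
    have : ∀ z, ∃ g : M.Shared, g.state = M.start ∧
        τ 1 z = .initial (.ofPos w z.val) g ∧ τ 1 (z + 1) = .initial (.ofPos w (z + 1).val) g := by
      intro z
      have := h.1 0 hT z
      rw [h.2.2, h.2.2] at this
      generalize τ (0 + 1) z = c₁, τ (0 + 1) (z + 1) = c₂ at this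
      cases this with
      | ini _ _ g hg => exact ⟨g, hg, rfl, rfl⟩
    choose g hg h₁ h₂ using this
    have hconst := eq_of_forall_add_one (f := g) fun z => by
      have := (h₂ z).symm.trans (h₁ (z + 1))
      simp only [Cell.initial, Cell.ord.injEq, true_and] at this
      exact this.symm
    refine ⟨M.initial, g 0, rfl, hg 0, within_initial, fun z => ?_⟩
    rw [cell_initial, ← hconst z, h₁]
  | succ s ih =>
    intro hT
    obtain ⟨c, g, hc, hg, hb, hrow⟩ := ih (by omega)
    have : ∀ z, ∃ h₁ hd₁ h₁' y₁' hd₁' g', M.δ g.state g.input g.scanned g.action ∧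
        g'.state = g.action.next ∧
        (z = (c.inPos : ZMod N) → g.input = (InKind.ofPos w z.val).read ∧
          g.dir = (InKind.ofPos w z.val).dir g.action.inMove) ∧
        (∀ i, z = (c.head i : ZMod N) → c.tape i z.valMinAbs = g.scanned i) ∧
        HeadRel g.dir (decide (z = (c.inPos : ZMod N)))
          (decide (z + 1 = (c.inPos : ZMod N))) h₁ h₁' ∧
        (∀ i, HeadRel (g.action.move i) (decide (z = (c.head i : ZMod N)))
          (decide (z + 1 = (c.head i : ZMod N))) (hd₁ i) (hd₁' i)) ∧
        τ (s + 1 + 1) z = .ord (.ofPos w z.val) h₁ (fun i => bif decide (z = (c.head i : ZMod N))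
          then g.action.write i else c.tape i z.valMinAbs) hd₁ g' ∧
        τ (s + 1 + 1) (z + 1) = .ord (.ofPos w (z + 1).val) h₁' y₁' hd₁' g' := by
      intro z
      have := h.1 (s + 1) hT z
      rw [hrow, hrow, cell, cell] at this
      generalize τ (s + 1 + 1) z = c₁, τ (s + 1 + 1) (z + 1) = c₂ at this
      cases this with
      -- This window would reveal an accepting computation, which `hna` excludes.
      | accept _ _ _ _ _ _ _ _ _ ha => exact (hna s ⟨c, hc, hg ▸ ha⟩).elim
      | step _ _ _ _ _ _ _ _ _ h₁ hd₁ h₁' y₁' hd₁' g' hδ hq hx hs hh hhd =>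
        exact ⟨h₁, hd₁, h₁', y₁', hd₁', g', hδ, hq, by simpa using hx, by simpa using hs, hh, hhd,
          rfl, rfl⟩
    choose h₁ hd₁ h₁' y₁' hd₁' g' hδ hq hx hs hh hhd e₁ e₂ using this
    have hnext : ∀ z, h₁' z = h₁ (z + 1) ∧ hd₁' z = hd₁ (z + 1) ∧ g' (z + 1) = g' z := by
      intro z
      have := (e₂ z).symm.trans (e₁ (z + 1))
      simp only [Cell.ord.injEq, true_and] at this
      exact ⟨this.1, this.2.2.1, this.2.2.2.symm⟩
    have hconst := eq_of_forall_add_one (f := g') fun z => (hnext z).2.2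
    have hpos : ((c.inPos : ZMod N)).val = c.inPos :=
      ZMod.val_cast_of_lt (by have := hb.inPos; omega)
    -- Only the window whose left cell carries the input head ties the shared data to what is really
    -- scanned; the shared data then apply to the whole row.
    have hin := hx c.inPos rfl
    rw [hpos, InKind.read_ofPos] at hin
    refine ⟨M.apply w c g.action, g' 0, ⟨c, hc, g.action, ?_, rfl⟩, hq 0, hb.apply _, fun z => ?_⟩
    · convert hδ 0 using 1
      · exact hg.symm
      · exact hin.1.symm
      · funext i
        rw [← hs _ i rfl]
        congr 1
        exact ((valMinAbs_eq_iff (by have := hb.head i; omega)).mpr rfl).symm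
    · rw [cell_apply hb (by omega), e₁, ← hconst z]
      congr 1
      · rw [← hin.2]
        exact eq_of_headRel (fun z => (hnext z).1) hh z
      · funext i
        exact eq_of_headRel (f := fun z => hd₁ z i) (f' := fun z => hd₁' z i)
          (fun z => congrFun (hnext z).2.1 i) (fun z => hhd z i) z

/-- Without acceptance the row `T` would be a configuration, but it coincides with row `0`, which
shows the input. -/
theorem IsTableau.accepts {T : ℕ} {τ : ℕ → ZMod N → M.Cell} (h : M.IsTableau w T N τ)
    (hT : 0 < T) (hN : 2 * T ≤ N) (hw : w.length + 1 < N) : ∃ t, M.AcceptsIn w t := by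
  by_contra! hna
  obtain ⟨c, g, -, -, -, hrow⟩ := h.row hN hw hna (T - 1) (by omega)
  have := hrow 0
  rw [Nat.sub_add_cancel hT, h.2.1, h.2.2, cell] at this
  cases this

theorem ReachesIn.exists_run {t : ℕ} {c : M.Cfg} (h : M.ReachesIn w t c) :
    ∃ f : ℕ → M.Cfg, f 0 = M.initial ∧ f t = c ∧ (∀ s < t, M.Step w (f s) (f (s + 1))) := by
  induction t generalizing c with
  | zero => exact ⟨fun _ => c, h, rfl, by simp⟩
  | succ t ih =>
    obtain ⟨b, hb, hs⟩ := h
    obtain ⟨f, h0, ht, hf⟩ := ih hb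
    refine ⟨fun s => if s ≤ t then f s else c, by simpa using h0, by simp, fun s hst => ?_⟩
    rcases Nat.lt_or_ge s t with h | h
    · simpa [h.le, Nat.succ_le_of_lt h] using hf s h
    · obtain rfl : s = t := by omega
      simpa [ht] using hs

/-- Row `0` shows the input, the rows `1` to `t + 1` the computation, and at least one empty row
must follow before row `T` shows the input again; hence `t + 3 ≤ T`. -/
theorem AcceptsIn.exists_isTableau {t T : ℕ} (h : M.AcceptsIn w t) (ht : t + 3 ≤ T)
    (hN : 2 * T ≤ N) (hw : w.length + 1 < N) : ∃ τ, M.IsTableau w T N τ := by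
  obtain ⟨c, hc, ha⟩ := h
  obtain ⟨f, h0, rfl, hf⟩ := hc.exists_run
  have hb : ∀ s ≤ t, (f s).Within w s := by
    intro s hs
    induction s with
    | zero => rw [h0]; exact within_initial
    | succ s ih =>
      obtain ⟨a, -, h⟩ := hf s hs
      rw [h]
      exact (ih (by omega)).apply a
  have : ∀ s, ∃ a, s < t → M.δ (f s).state (readInput w (f s).inPos)
      (fun i => (f s).tape i ((f s).head i)) a ∧ f (s + 1) = M.apply w (f s) a := by
    intro s
    by_cases hs : s < t
    · exact let ⟨a, h⟩ := hf s hs; ⟨a, fun _ => h⟩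
    -- An arbitrary action. It is recorded in the row of the accepting configuration, whose window
    -- does not inspect it.
    · exact ⟨⟨M.start, .stay, fun _ => M.blank, fun _ => .stay, none⟩, fun h => (hs h).elim⟩
  choose a hfa using this
  let g : ℕ → M.Shared := fun s => ⟨(f s).state, readInput w (f s).inPos,
    fun i => (f s).tape i ((f s).head i), a s, (InKind.ofPos w (f s).inPos).dir (a s).inMove⟩
  let τ : ℕ → ZMod N → M.Cell := fun k z =>
    if k = 0 ∨ k = T then .ini (.ofPos w z.val)
    else if k ≤ t + 1 then cell w (f (k - 1)) (g (k - 1)) z else .top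
  have hini : ∀ z, τ 0 z = .ini (.ofPos w z.val) := fun z => if_pos (.inl rfl)
  have hlast : ∀ z, τ T z = .ini (.ofPos w z.val) := fun z => if_pos (.inr rfl)
  have hcell : ∀ s ≤ t, ∀ z, τ (s + 1) z = cell w (f s) (g s) z := fun s hs z => by
    simp only [τ]
    rw [if_neg (by omega), if_pos (by omega), Nat.add_sub_cancel]
  have htop : ∀ k, t + 1 < k → k < T → ∀ z, τ k z = .top := fun k hk hk' z => by
    simp only [τ]
    rw [if_neg (by omega), if_neg (by omega)]
  refine ⟨τ, fun k hk z => ?_, fun z => by rw [hini, hlast], hini⟩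
  rcases k with _ | s
  · rw [hini, hini, hcell 0 (by omega), hcell 0 (by omega), h0, cell_initial, cell_initial]
    exact .ini _ _ _ (congrArg Cfg.state h0)
  rcases Nat.lt_trichotomy s t with hs | rfl | hs
  · rw [hcell s hs.le, hcell s hs.le, hcell (s + 1) hs, hcell (s + 1) hs, (hfa s hs).2,
      cell_apply (hb s hs.le) (by omega), cell_apply (hb s hs.le) (by omega), cell, cell]
    refine .step _ _ _ _ _ _ _ _ (g s) _ _ _ _ _ _ (hfa s hs).1 ?_ ?_ ?_ ?_ ?_
    · exact congrArg Cfg.state (hfa s hs).2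
    · intro h
      rw [natCast_inj_of_lt (by have := (hb s hs.le).inPos; omega) (of_decide_eq_true h)]
      exact ⟨(InKind.read_ofPos w _).symm, rfl⟩
    · intro i h
      rw [(valMinAbs_eq_iff (by have := (hb s hs.le).head i; omega)).mpr (of_decide_eq_true h)]
    · exact headRel_cast _ _ _
    · exact fun i => headRel_cast _ _ _
  · rw [hcell s le_rfl, hcell s le_rfl, htop _ (by omega) (by omega), htop _ (by omega) (by omega)]
    exact .accept _ _ _ _ _ _ _ _ _ ha
  · rw [htop _ (by omega) (by omega), htop _ (by omega) (by omega)]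
    rcases Nat.lt_or_ge (s + 1 + 1) T with h | h
    · rw [htop _ (by omega) h, htop _ (by omega) h]
      exact .top
    · obtain rfl : s + 1 + 1 = T := by omega
      rw [hlast, hlast]
      exact .top_ini _ _

end

end Machine

end Complexity

/-! ## Long concatenations and alternations -/

namespace PRE

variable {σ : Type}

/-- The number of pairs of parentheses in a list of expressions. -/
def groupsSum (l : List (PRE σ)) : ℕ := (l.map groups).sum

@[simp]
theorem groupsSum_nil : groupsSum ([] : List (PRE σ)) = 0 := rfl

@[simp]
theorem groupsSum_cons (r : PRE σ) (l : List (PRE σ)) :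
    groupsSum (r :: l) = r.groups + groupsSum l := by simp [groupsSum]

/-- Expressions are matched one after the other. -/
inductive MatchesList : ℕ → List (PRE σ) → (ℕ → Option (List σ)) → List σ →
    (ℕ → Option (List σ)) → Prop
  | nil (n e) : MatchesList n [] e [] e
  | cons {n r l e e' e'' u v} (hr : Matches n r e u e')
      (hl : MatchesList (n + r.groups) l e' v e'') : MatchesList n (r :: l) e (u ++ v) e''

theorem matchesList_cons_iff {n : ℕ} {r : PRE σ} {l e w e''} :
    MatchesList n (r :: l) e w e'' ↔ ∃ u v e', w = u ++ v ∧ Matches n r e u e' ∧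
      MatchesList (n + r.groups) l e' v e'' := by
  constructor
  · rintro (_ | ⟨hr, hl⟩)
    exact ⟨_, _, _, rfl, hr, hl⟩
  · rintro ⟨u, v, e', rfl, hr, hl⟩
    exact .cons hr hl

theorem matchesList_nil_iff {n : ℕ} {e e' : ℕ → Option (List σ)} {w : List σ} :
    MatchesList n [] e w e' ↔ w = [] ∧ e' = e := by
  constructor
  · rintro ⟨⟩
    exact ⟨rfl, rfl⟩
  · rintro ⟨rfl, rfl⟩
    exact .nil _ _

theorem matchesList_append_iff {n : ℕ} {l l' : List (PRE σ)} {e w e''} :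
    MatchesList n (l ++ l') e w e'' ↔ ∃ u v e', w = u ++ v ∧ MatchesList n l e u e' ∧
      MatchesList (n + groupsSum l) l' e' v e'' := by
  induction l generalizing n e w with
  | nil => simp [matchesList_nil_iff]
  | cons r l ih =>
    simp only [List.cons_append, matchesList_cons_iff, ih, groupsSum_cons, ← add_assoc]
    constructor
    · rintro ⟨u, v, e', rfl, hr, u', v', e₁, rfl, hl, hl'⟩
      exact ⟨u ++ u', v', e₁, by simp, ⟨u, u', e', rfl, hr, hl⟩, hl'⟩
    · rintro ⟨u, v, e', rfl, ⟨u', v', e₁, rfl, hr, hl⟩, hl'⟩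
      exact ⟨u', v' ++ v, e₁, by simp, hr, v', v, e', rfl, hl, hl'⟩

theorem matches_cat_iff {n : ℕ} {r s : PRE σ} {e w e''} :
    Matches n (cat r s) e w e'' ↔ ∃ u v e', w = u ++ v ∧ Matches n r e u e' ∧
      Matches (n + r.groups) s e' v e'' := by
  constructor
  · rintro (_ | _)
    exact ⟨_, _, _, rfl, ‹_›, ‹_›⟩
  · rintro ⟨u, v, e', rfl, hr, hl⟩
    exact .cat _ _ _ _ _ _ _ _ hr hl

theorem matches_alt_iff {n : ℕ} {r s : PRE σ} {e w e'} :
    Matches n (alt r s) e w e' ↔ Matches n r e w e' ∨ Matches (n + r.groups) s e w e' := by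
  constructor
  · rintro (_ | _)
    · exact .inl ‹_›
    · exact .inr ‹_›
  · rintro (h | h)
    exacts [.alt_left _ _ _ _ _ _ h, .alt_right _ _ _ _ _ _ h]

theorem matches_ref_iff {n k : ℕ} {e w e'} :
    Matches n (ref k : PRE σ) e w e' ↔ e k = some w ∧ e' = e := by
  constructor
  · rintro ⟨⟩
    exact ⟨‹_›, rfl⟩
  · rintro ⟨h, rfl⟩
    exact .ref _ _ _ _ h

theorem matches_sym_iff {n : ℕ} {a : σ} {e w e'} :
    Matches n (sym a) e w e' ↔ w = [a] ∧ e' = e := by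
  constructor
  · rintro ⟨⟩
    exact ⟨rfl, rfl⟩
  · rintro ⟨rfl, rfl⟩
    exact .sym _ _ _

theorem matches_group_iff {n : ℕ} {r : PRE σ} {e w e'} :
    Matches n (group r) e w e' ↔
      ∃ e₁, Matches (n + 1) r e w e₁ ∧ e' = Function.update e₁ (n + 1) (some w) := by
  constructor
  · rintro ⟨⟩
    exact ⟨_, ‹_›, rfl⟩
  · rintro ⟨e₁, h, rfl⟩
    exact .group _ _ _ _ _ h

/-- The concatenation of expressions. -/
def catList (r : PRE σ) (l : List (PRE σ)) : PRE σ := l.foldl cat r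

/-- The alternation of expressions. -/
def altList (r : PRE σ) (l : List (PRE σ)) : PRE σ := l.foldl alt r

theorem groups_catList (r : PRE σ) (l : List (PRE σ)) :
    (catList r l).groups = groupsSum (r :: l) := by
  induction l generalizing r with
  | nil => simp [catList]
  | cons s l ih => exact (ih (cat r s)).trans (by simp [groups, add_assoc])

theorem groups_altList (r : PRE σ) (l : List (PRE σ)) :
    (altList r l).groups = groupsSum (r :: l) := by
  induction l generalizing r with
  | nil => simp [altList]
  | cons s l ih => exact (ih (alt r s)).trans (by simp [groups, add_assoc])

theorem toTokens_catList (r : PRE σ) (l : List (PRE σ)) :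
    (catList r l).toTokens = (r :: l).flatMap toTokens := by
  induction l generalizing r with
  | nil => simp [catList]
  | cons s l ih => exact (ih (cat r s)).trans (by simp [toTokens])

theorem toTokens_altList (r : PRE σ) (l : List (PRE σ)) :
    (altList r l).toTokens = r.toTokens ++ l.flatMap fun s => .bar :: s.toTokens := by
  induction l generalizing r with
  | nil => simp [altList]
  | cons s l ih => exact (ih (alt r s)).trans (by simp [toTokens])

theorem matches_catList_iff {n : ℕ} {r : PRE σ} {l e w e'} :
    Matches n (catList r l) e w e' ↔ MatchesList n (r :: l) e w e' := by
  induction l generalizing r with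
  | nil => simp [catList, matchesList_cons_iff, matchesList_nil_iff]
  | cons s l ih =>
    refine (ih (r := cat r s)).trans ?_
    simp only [matchesList_cons_iff, matches_cat_iff, groups, ← add_assoc]
    constructor
    · rintro ⟨_, v, e₁, rfl, ⟨u, u', e₂, rfl, hr, hs⟩, hl⟩
      exact ⟨u, u' ++ v, e₂, by simp, hr, u', v, e₁, rfl, hs, hl⟩
    · rintro ⟨u, _, e₁, rfl, hr, u', v, e₂, rfl, hs, hl⟩
      exact ⟨u ++ u', v, e₂, by simp, ⟨u, u', e₁, rfl, hr, hs⟩, hl⟩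

theorem matches_altList_iff {n : ℕ} {r : PRE σ} {l e w e'} :
    Matches n (altList r l) e w e' ↔
      ∃ l₁ s l₂, r :: l = l₁ ++ s :: l₂ ∧ Matches (n + groupsSum l₁) s e w e' := by
  induction l generalizing r with
  | nil =>
    constructor
    · exact fun h => ⟨[], r, [], rfl, h⟩
    · rintro ⟨l₁, s, l₂, h, hm⟩
      obtain ⟨rfl, rfl, rfl⟩ : l₁ = [] ∧ s = r ∧ l₂ = [] := by
        cases l₁ <;> simp_all
      exact hm
  | cons s l ih =>
    refine (ih (r := alt r s)).trans ?_
    constructor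
    · rintro ⟨l₁, q, l₂, h, hm⟩
      cases l₁ with
      | nil =>
        obtain ⟨rfl, rfl⟩ : alt r s = q ∧ l = l₂ := by simpa using h
        rcases matches_alt_iff.mp hm with hm | hm
        exacts [⟨[], r, s :: l, rfl, hm⟩, ⟨[r], s, l, rfl, by simpa using hm⟩]
      | cons p l₁ =>
        obtain ⟨rfl, rfl⟩ : alt r s = p ∧ l = l₁ ++ q :: l₂ := by simpa using h
        exact ⟨r :: s :: l₁, q, l₂, rfl, by simpa [groups, add_assoc] using hm⟩
    · rintro ⟨l₁, q, l₂, h, hm⟩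
      match l₁, h with
      | [], h =>
        obtain ⟨rfl, rfl⟩ : r = q ∧ s :: l = l₂ := by simpa using h
        exact ⟨[], _, l, rfl, matches_alt_iff.mpr (.inl hm)⟩
      | [p], h =>
        obtain ⟨rfl, rfl, rfl⟩ : r = p ∧ s = q ∧ l = l₂ := by simpa using h
        exact ⟨[], _, l, rfl, matches_alt_iff.mpr (.inr (by simpa using hm))⟩
      | p :: p' :: l₁, h =>
        obtain ⟨rfl, rfl, rfl⟩ : r = p ∧ s = p' ∧ l = l₁ ++ q :: l₂ := by simpa using h
        exact ⟨alt r s :: l₁, q, l₂, rfl, by simpa [groups, add_assoc] using hm⟩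

theorem isParseTree_catList {r : PRE σ} {l : List (PRE σ)} (hr : r.IsParseTree) (hr' : ¬ r.IsAlt)
    (hl : ∀ s ∈ l, s.IsParseTree ∧ ¬ s.IsAlt ∧ ¬ s.IsCat) :
    (catList r l).IsParseTree ∧ ¬ (catList r l).IsAlt := by
  induction l generalizing r with
  | nil => exact ⟨hr, hr'⟩
  | cons s l ih =>
    have hs := hl s (by simp)
    exact ih (r := cat r s) ⟨hr, hs.1, hr', hs.2⟩ id fun s' h => hl s' (by simp [h])

theorem isParseTree_altList {r : PRE σ} {l : List (PRE σ)} (hr : r.IsParseTree)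
    (hl : ∀ s ∈ l, s.IsParseTree ∧ ¬ s.IsAlt) : (altList r l).IsParseTree := by
  induction l generalizing r with
  | nil => exact hr
  | cons s l ih =>
    have hs := hl s (by simp)
    exact ih (r := alt r s) ⟨hr, hs.1, hs.2⟩ fun s' h => hl s' (by simp [h])

theorem starFree_catList {r : PRE σ} {l : List (PRE σ)} :
    (catList r l).StarFree ↔ ∀ s ∈ r :: l, s.StarFree := by
  induction l generalizing r with
  | nil => simp [catList]
  | cons s l ih => exact (ih (r := cat r s)).trans (by simp [StarFree, and_assoc])

theorem starFree_altList {r : PRE σ} {l : List (PRE σ)} :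
    (altList r l).StarFree ↔ ∀ s ∈ r :: l, s.StarFree := by
  induction l generalizing r with
  | nil => simp [altList]
  | cons s l ih => exact (ih (r := alt r s)).trans (by simp [StarFree, and_assoc])

/-- The back references in a list of expressions are valid. -/
def RefsValidList : ℕ → List (PRE σ) → Prop
  | _, [] => True
  | n, r :: l => r.RefsValid n ∧ RefsValidList (n + r.groups) l

theorem refsValidList_append {n : ℕ} {l l' : List (PRE σ)} :
    RefsValidList n (l ++ l') ↔ RefsValidList n l ∧ RefsValidList (n + groupsSum l) l' := by
  induction l generalizing n with
  | nil => simp [RefsValidList]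
  | cons r l ih => simp [RefsValidList, ih, and_assoc, add_assoc]

theorem refsValidList_of_forall {n : ℕ} {l : List (PRE σ)}
    (h : ∀ r ∈ l, ∀ m, n ≤ m → r.RefsValid m) : RefsValidList n l := by
  induction l generalizing n with
  | nil => trivial
  | cons r l ih =>
    exact ⟨h r (by simp) n le_rfl, ih fun s hs m hm => h s (by simp [hs]) m (by omega)⟩

theorem refsValid_catList {n : ℕ} {r : PRE σ} {l : List (PRE σ)} :
    (catList r l).RefsValid n ↔ RefsValidList n (r :: l) := by
  induction l generalizing r with
  | nil => simp [catList, RefsValidList]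
  | cons s l ih =>
    exact (ih (r := cat r s)).trans
      (by simp [RefsValid, RefsValidList, groups, and_assoc, add_assoc])

theorem refsValid_altList {n : ℕ} {r : PRE σ} {l : List (PRE σ)} :
    (altList r l).RefsValid n ↔ RefsValidList n (r :: l) := by
  induction l generalizing r with
  | nil => simp [altList, RefsValidList]
  | cons s l ih =>
    exact (ih (r := alt r s)).trans
      (by simp [RefsValid, RefsValidList, groups, and_assoc, add_assoc])

/-- A match changes only the variables of the expression. -/
theorem Matches.frame {n : ℕ} {r : PRE σ} {e w e'} (h : Matches n r e w e') {k : ℕ}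
    (hk : k ≤ n ∨ n + r.groups < k) : e' k = e k := by
  induction h with
  | sym | ref | star_nil => rfl
  | alt_left _ _ _ _ _ _ _ ih => exact ih (by simp only [groups] at hk; omega)
  | alt_right _ _ _ _ _ _ _ ih => exact ih (by simp only [groups] at hk; omega)
  | cat _ _ _ _ _ _ _ _ _ _ ih ih' =>
    simp only [groups] at hk
    rw [ih' (by omega), ih (by omega)]
  | star_cons _ _ _ _ _ _ _ _ _ ih ih' =>
    simp only [groups] at hk ih'
    rw [ih' (by omega), ih (by omega)]
  | group _ _ _ _ _ _ ih =>
    simp only [groups] at hk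
    rw [Function.update_of_ne (by omega), ih (by omega)]

theorem MatchesList.frame {n : ℕ} {l : List (PRE σ)} {e w e'} (h : MatchesList n l e w e') {k : ℕ}
    (hk : k ≤ n ∨ n + groupsSum l < k) : e' k = e k := by
  induction h with
  | nil => rfl
  | cons hr _ ih =>
    simp only [groupsSum_cons] at hk
    rw [ih (by omega), hr.frame (by omega)]

/-- Every expression of a list is matched in a situation that agrees with the beginning on the first
variables. -/
theorem MatchesList.exists_matches {n P : ℕ} {l : List (PRE σ)} {e w e'}
    (h : MatchesList n l e w e') (hP : P ≤ n) {r : PRE σ} (hr : r ∈ l) :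
    ∃ m e₁ u e₂, P ≤ m ∧ Matches m r e₁ u e₂ ∧ ∀ k ≤ P, e₁ k = e k := by
  induction h with
  | nil => simp at hr
  | cons hm _ ih =>
    rcases List.mem_cons.mp hr with rfl | hr
    · exact ⟨_, _, _, _, hP, hm, fun _ _ => rfl⟩
    · obtain ⟨m, e₁, u, e₂, h₁, h₂, h₃⟩ := ih (by omega) hr
      exact ⟨m, e₁, u, e₂, h₁, h₂, fun k hk => (h₃ k hk).trans (hm.frame (by omega))⟩

/-- Each `r` matches its word `f r` whatever values the variables beyond `P` have. In the
application the first `P` variables hold the choices, and the checks read no others. -/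
theorem exists_matchesList {P : ℕ} {l : List (PRE σ)} {e : ℕ → Option (List σ)}
    {f : PRE σ → List σ} (h : ∀ r ∈ l, ∀ m, P ≤ m → ∀ e₁ : ℕ → Option (List σ),
      (∀ k ≤ P, e₁ k = e k) → ∃ e₂, Matches m r e₁ (f r) e₂) {n : ℕ} (hn : P ≤ n) :
    ∃ e', MatchesList n l e (l.flatMap f) e' := by
  suffices ∀ n, P ≤ n → ∀ e₁ : ℕ → Option (List σ), (∀ k ≤ P, e₁ k = e k) →
      ∃ e', MatchesList n l e₁ (l.flatMap f) e' from this n hn e fun _ _ => rfl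
  clear hn n
  induction l with
  | nil => exact fun n _ e₁ _ => ⟨e₁, .nil _ _⟩
  | cons r l ih =>
    intro n hn e₁ he₁
    obtain ⟨e₂, h₂⟩ := h r (by simp) n hn e₁ he₁
    obtain ⟨e₃, h₃⟩ := ih (fun s hs => h s (by simp [hs])) (n + r.groups) (by omega) e₂
      fun k hk => (h₂.frame (by omega)).trans (he₁ k hk)
    exact ⟨e₃, .cons h₂ h₃⟩

/-! ## Choices -/

/-- An expression that chooses one of `2 ^ D - 1` variables. -/
def chooser (D : ℕ) : PRE Unit :=
  group (altList (group (sym ())) (List.replicate (2 ^ D - 2) (group (sym ()))))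

variable {D : ℕ}

/-- One outer and `2 ^ D - 1` inner pairs: the outer pair rounds the block up to a power of two. For
`D = 0` the alternation would still have one branch. -/
theorem groups_chooser (hD : 1 ≤ D) : (chooser D).groups = 2 ^ D := by
  have := Nat.pow_le_pow_right (n := 2) (by norm_num) hD
  simp only [chooser, groups, groups_altList, groupsSum, List.map_cons, List.map_replicate,
    List.sum_cons, List.sum_replicate, smul_eq_mul]
  omega

/-- All branches match the same letter; the information lies only in which inner variable is
instantiated. Codes start at `2` because variable `n + 1` belongs to the outer parentheses. -/
theorem matches_chooser_iff (hD : 1 ≤ D) {n : ℕ} {e w e'} : Matches n (chooser D) e w e' ↔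
    ∃ c, 2 ≤ c ∧ c ≤ 2 ^ D ∧ w = [()] ∧
      e' = Function.update (Function.update e (n + c) (some [()])) (n + 1) (some [()]) := by
  have h2 := Nat.pow_le_pow_right (n := 2) (by norm_num) hD
  have hrep : group (sym ()) :: List.replicate (2 ^ D - 2) (group (sym ())) =
      List.replicate (2 ^ D - 1) (group (sym ())) := by
    rw [← List.replicate_succ]
    congr 1
    omega
  have hsum : ∀ j, groupsSum (List.replicate j (group (sym ()))) = j := by
    intro j; simp [groupsSum, groups]
  rw [chooser, matches_group_iff]
  constructor
  · rintro ⟨e₁, h, rfl⟩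
    obtain ⟨l₁, s, l₂, hl, hm⟩ := matches_altList_iff.mp h
    rw [hrep] at hl
    have hlen := congrArg List.length hl
    simp only [List.length_replicate, List.length_append, List.length_cons] at hlen
    obtain ⟨h₁, h₂⟩ : l₁ = List.replicate l₁.length (group (sym ())) ∧ s = group (sym ()) := by
      have : ∀ x ∈ l₁ ++ s :: l₂, x = group (sym ()) := by
        rw [← hl]; exact fun x hx => List.eq_of_mem_replicate hx
      exact ⟨List.eq_replicate_iff.mpr ⟨rfl, fun x hx => this x (by simp [hx])⟩,
        this s (by simp)⟩
    subst h₂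
    rw [h₁, hsum, matches_group_iff] at hm
    obtain ⟨e₂, hm, rfl⟩ := hm
    obtain ⟨rfl, rfl⟩ := matches_sym_iff.mp hm
    exact ⟨l₁.length + 2, by omega, by omega, rfl, by
      rw [show n + 1 + l₁.length + 1 = n + (l₁.length + 2) by omega]⟩
  · rintro ⟨c, hc, hc', rfl, rfl⟩
    refine ⟨_, matches_altList_iff.mpr ⟨List.replicate (c - 2) (group (sym ())), group (sym ()),
      List.replicate (2 ^ D - c) (group (sym ())), ?_,
        matches_group_iff.mpr ⟨e, .sym _ _ _, rfl⟩⟩, ?_⟩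
    · rw [hrep, ← List.replicate_succ, List.replicate_append_replicate]
      congr 1
      omega
    · rw [hsum, show n + 1 + (c - 2) + 1 = n + c by omega]

theorem groupsSum_choosers (hD : 1 ≤ D) (m : ℕ) :
    groupsSum (List.replicate m (chooser D)) = m * 2 ^ D := by
  simp [groupsSum, groups_chooser hD]

/-- A chooser instantiates one inner variable of its own block, and by `Matches.frame` the later
choosers leave that block alone. -/
theorem MatchesList.exists_choice (hD : 1 ≤ D) {n m : ℕ} {e w e'}
    (h : MatchesList n (List.replicate m (chooser D)) e w e') (he : ∀ k, n < k → e k = none) :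
    ∃ ch : ℕ → ℕ, ∀ j < m, ∀ c, 2 ≤ c → c ≤ 2 ^ D → e' (n + j * 2 ^ D + c) ≠ none → c = ch j := by
  induction m generalizing n e w with
  | zero => exact ⟨id, by simp⟩
  | succ m ih =>
    rw [List.replicate_succ, matchesList_cons_iff, groups_chooser hD] at h
    obtain ⟨u, v, e₁, rfl, h₁, h₂⟩ := h
    have hframe := fun k hk => h₁.frame (k := k) (.inr hk)
    rw [groups_chooser hD] at hframe
    obtain ⟨ch, hch⟩ := ih h₂ fun k hk => by
      rw [hframe k hk, he k (lt_of_le_of_lt (Nat.le_add_right _ _) hk)]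
    obtain ⟨c₀, -, -, -, rfl⟩ := (matches_chooser_iff hD).mp h₁
    refine ⟨fun j => if j = 0 then c₀ else ch (j - 1), fun j hj c hc hc' hne => ?_⟩
    cases j with
    | zero =>
      by_contra hcc
      change ¬ c = c₀ at hcc
      apply hne
      rw [h₂.frame (.inl (by omega)), Function.update_of_ne (by omega),
        Function.update_of_ne (by omega), he _ (by omega)]
    | succ j =>
      refine hch j (by omega) c hc hc' ?_
      rwa [show n + 2 ^ D + j * 2 ^ D + c = n + (j + 1) * 2 ^ D + c by ring]

theorem exists_matchesList_choosers (hD : 1 ≤ D) (n m : ℕ) (e) (ch : ℕ → ℕ)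
    (hch : ∀ j < m, 2 ≤ ch j ∧ ch j ≤ 2 ^ D) :
    ∃ e', MatchesList n (List.replicate m (chooser D)) e (List.replicate m ()) e' ∧
      ∀ j < m, e' (n + j * 2 ^ D + ch j) = some [()] := by
  induction m generalizing n e ch with
  | zero => exact ⟨e, .nil _ _, by simp⟩
  | succ m ih =>
    have h₁ := (matches_chooser_iff hD (n := n) (e := e)).mpr
      ⟨ch 0, (hch 0 (by omega)).1, (hch 0 (by omega)).2, rfl, rfl⟩
    obtain ⟨e', h₂, h₃⟩ := ih (n + 2 ^ D) (Function.update (Function.update e (n + ch 0)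
      (some [()])) (n + 1) (some [()])) (fun j => ch (j + 1)) fun j hj => hch (j + 1) (by omega)
    refine ⟨e', .cons h₁ (by rwa [groups_chooser hD]), fun j hj => ?_⟩
    cases j with
    | zero =>
      have := hch 0 (by omega)
      rw [h₂.frame (.inl (by omega)), Function.update_of_ne (by omega)]
      simp
    | succ j =>
      rw [← h₃ j (by omega)]
      congr 1
      ring

end PRE

/-! ## Expressions for tilings of a torus -/

namespace PRE

/-- A tiling of a torus by elements of `C` whose windows are in `R` and whose row `0` is `ini`. -/
def IsTiling {C : Type} (R : List (C × C × C × C)) (ini : ℕ → C) (T N : ℕ) (τ : ℕ → ℕ → C) : Prop :=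
  (∀ t < T, ∀ i < N, (τ t i, τ t ((i + 1) % N), τ ((t + 1) % T) i,
    τ ((t + 1) % T) ((i + 1) % N)) ∈ R) ∧ ∀ i < N, τ 0 i = ini i

/-- The number of the variable for the code `c` at column `i` of row `t`. -/
def tileVar (K D t i c : ℕ) : ℕ := (2 ^ (2 * K + 1) + (t * 2 ^ (K + 1) + i)) * 2 ^ D + c

/-- The expression that checks that a window has given codes. -/
def windowExpr (K D t i : ℕ) (q : ℕ × ℕ × ℕ × ℕ) : PRE Unit :=
  catList (ref (tileVar K D t i q.1))
    [ref (tileVar K D t ((i + 1) % 2 ^ (K + 1)) q.2.1),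
      ref (tileVar K D ((t + 1) % 2 ^ K) i q.2.2.1),
      ref (tileVar K D ((t + 1) % 2 ^ K) ((i + 1) % 2 ^ (K + 1)) q.2.2.2)]

/-- The expression that checks that a window has allowed codes. -/
def windowCheck (K D : ℕ) (q : ℕ × ℕ × ℕ × ℕ) (Q : List (ℕ × ℕ × ℕ × ℕ)) (t i : ℕ) : PRE Unit :=
  group (altList (windowExpr K D t i q) (Q.map (windowExpr K D t i)))

/-- The checks of the windows and of row `0`. -/
def tilingChecks (K D : ℕ) (q : ℕ × ℕ × ℕ × ℕ) (Q : List (ℕ × ℕ × ℕ × ℕ)) (ini : ℕ → ℕ) :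
    List (PRE Unit) :=
  ((List.range (2 ^ K)).flatMap fun t => (List.range (2 ^ (K + 1))).map fun i =>
    windowCheck K D q Q t i) ++
      (List.range (2 ^ (K + 1))).map fun i => ref (tileVar K D 0 i (ini i))

/-- The expression for the tilings with given codes. -/
def tilingExpr (K D : ℕ) (q : ℕ × ℕ × ℕ × ℕ) (Q : List (ℕ × ℕ × ℕ × ℕ)) (ini : ℕ → ℕ) : PRE Unit :=
  catList (chooser D) (List.replicate (2 ^ (2 * K + 2) - 1) (chooser D) ++ tilingChecks K D q Q ini)

/-! ### Validity of the expression and meaning of its checks. -/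

section

variable {K D : ℕ} {q : ℕ × ℕ × ℕ × ℕ} {Q : List (ℕ × ℕ × ℕ × ℕ)} {ini : ℕ → ℕ}

theorem choosers_eq : chooser D :: (List.replicate (2 ^ (2 * K + 2) - 1) (chooser D) ++
    tilingChecks K D q Q ini) =
      List.replicate (2 ^ (2 * K + 2)) (chooser D) ++ tilingChecks K D q Q ini := by
  rw [← List.cons_append, ← List.replicate_succ, Nat.sub_add_cancel Nat.one_le_two_pow]

theorem tile_lt {t i : ℕ} (ht : t < 2 ^ K) (hi : i < 2 ^ (K + 1)) :
    t * 2 ^ (K + 1) + i < 2 ^ (2 * K + 1) := by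
  have : 2 ^ (2 * K + 1) = 2 ^ K * 2 ^ (K + 1) := by ring
  nlinarith

theorem tileVar_bounds {t i c : ℕ} (ht : t < 2 ^ K) (hi : i < 2 ^ (K + 1)) (hc : c ≤ 2 ^ D) :
    c ≤ tileVar K D t i c ∧ tileVar K D t i c ≤ 2 ^ (2 * K + 2) * 2 ^ D := by
  have h := tile_lt ht hi
  have h2 : 2 ^ (2 * K + 2) = 2 * 2 ^ (2 * K + 1) := by ring
  refine ⟨by simp [tileVar], ?_⟩
  rw [tileVar, h2]
  have : (2 ^ (2 * K + 1) + (t * 2 ^ (K + 1) + i) + 1) * 2 ^ D ≤ (2 * 2 ^ (2 * K + 1)) * 2 ^ D :=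
    Nat.mul_le_mul_right _ (by omega)
  linarith

theorem mem_tilingChecks {r : PRE Unit} : r ∈ tilingChecks K D q Q ini ↔
    (∃ t < 2 ^ K, ∃ i < 2 ^ (K + 1), windowCheck K D q Q t i = r) ∨
      ∃ i < 2 ^ (K + 1), ref (tileVar K D 0 i (ini i)) = r := by
  simp [tilingChecks]

/-- The codes are in the range of the variables. -/
structure CodesWithin (D : ℕ) (q : ℕ × ℕ × ℕ × ℕ) (Q : List (ℕ × ℕ × ℕ × ℕ)) (ini : ℕ → ℕ) :
    Prop where
  window : ∀ p ∈ q :: Q, ∀ c ∈ [p.1, p.2.1, p.2.2.1, p.2.2.2], 2 ≤ c ∧ c ≤ 2 ^ D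
  ini : ∀ i, 2 ≤ ini i ∧ ini i ≤ 2 ^ D

theorem mod_two_pow_lt (a k : ℕ) : a % 2 ^ k < 2 ^ k := Nat.mod_lt _ (by positivity)

theorem refsValid_windowExpr {p : ℕ × ℕ × ℕ × ℕ} {t i m : ℕ} (ht : t < 2 ^ K)
    (hi : i < 2 ^ (K + 1)) (hm : 2 ^ (2 * K + 2) * 2 ^ D ≤ m)
    (hp : ∀ c ∈ [p.1, p.2.1, p.2.2.1, p.2.2.2], 2 ≤ c ∧ c ≤ 2 ^ D) :
    (windowExpr K D t i p).RefsValid m := by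
  have aux : ∀ {t i c}, t < 2 ^ K → i < 2 ^ (K + 1) → 2 ≤ c ∧ c ≤ 2 ^ D →
      1 ≤ tileVar K D t i c ∧ tileVar K D t i c ≤ m := fun ht hi hc => by
    have := tileVar_bounds ht hi hc.2
    omega
  have := mod_two_pow_lt (t + 1) K
  have := mod_two_pow_lt (i + 1) (K + 1)
  simp only [List.mem_cons, List.not_mem_nil, or_false, forall_eq_or_imp, forall_eq] at hp
  rw [windowExpr, refsValid_catList]
  simp only [RefsValidList, RefsValid, groups, add_zero, and_true]
  exact ⟨aux ht hi hp.1, aux ht ‹_› hp.2.1, aux ‹_› hi hp.2.2.1, aux ‹_› ‹_› hp.2.2.2⟩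

theorem groupsSum_windowExprs (t i : ℕ) (l : List (ℕ × ℕ × ℕ × ℕ)) :
    groupsSum (l.map (windowExpr K D t i)) = 0 := by
  induction l with
  | nil => rfl
  | cons p l ih =>
    rw [List.map_cons, groupsSum_cons, ih, windowExpr, groups_catList]
    simp [groups]

theorem refsValidList_windowExprs {t i m : ℕ} {l : List (ℕ × ℕ × ℕ × ℕ)}
    (h : ∀ p ∈ l, (windowExpr K D t i p).RefsValid m) :
    RefsValidList m (l.map (windowExpr K D t i)) := by
  induction l with
  | nil => trivial
  | cons p l ih =>
    refine ⟨h p (by simp), ?_⟩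
    have : (windowExpr K D t i p).groups = 0 := by
      simpa using groupsSum_windowExprs (K := K) (D := D) t i [p]
    rw [this]
    exact ih fun p' hp' => h p' (by simp [hp'])

theorem refsValid_chooser (m : ℕ) : (chooser D).RefsValid m := by
  rw [chooser, RefsValid, refsValid_altList]
  refine refsValidList_of_forall fun r hr m' _ => ?_
  rw [← List.replicate_succ] at hr
  rw [List.eq_of_mem_replicate hr]
  trivial

theorem tilingExpr_valid (hD : 1 ≤ D) (h : CodesWithin D q Q ini) :
    (tilingExpr K D q Q ini).Valid := by
  have hw : ∀ t i p, (windowExpr K D t i p).IsParseTree ∧ ¬ (windowExpr K D t i p).IsAlt :=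
    fun t i p => isParseTree_catList trivial id (by
      simp only [List.mem_cons, List.not_mem_nil, or_false, forall_eq_or_imp, forall_eq]
      exact ⟨⟨trivial, id, id⟩, ⟨trivial, id, id⟩, ⟨trivial, id, id⟩⟩)
  have hch : (chooser D).IsParseTree := isParseTree_altList (r := group (sym ())) trivial
    fun s hs => by rw [List.eq_of_mem_replicate hs]; exact ⟨trivial, id⟩
  refine ⟨(isParseTree_catList hch id fun s hs => ?_).1, ?_⟩
  · rcases List.mem_append.mp hs with hs | hs
    · rw [List.eq_of_mem_replicate hs]
      exact ⟨hch, id, id⟩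
    · rcases mem_tilingChecks.mp hs with ⟨t, -, i, -, rfl⟩ | ⟨i, -, rfl⟩
      · refine ⟨isParseTree_altList (hw _ _ _).1 fun s hs => ?_, id, id⟩
        obtain ⟨p, -, rfl⟩ := List.mem_map.mp hs
        exact hw _ _ _
      · exact ⟨trivial, id, id⟩
  · rw [tilingExpr, refsValid_catList, choosers_eq, refsValidList_append]
    refine ⟨refsValidList_of_forall fun r hr m _ => ?_, refsValidList_of_forall fun r hr m hm => ?_⟩
    · rw [List.eq_of_mem_replicate hr]
      exact refsValid_chooser m
    · rw [groupsSum_choosers hD, zero_add] at hm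
      rcases mem_tilingChecks.mp hr with ⟨t, ht, i, hi, rfl⟩ | ⟨i, hi, rfl⟩
      · rw [windowCheck, RefsValid, refsValid_altList, ← List.map_cons]
        exact refsValidList_windowExprs fun p hp =>
          refsValid_windowExpr ht hi (by omega) (h.window p hp)
      · have := tileVar_bounds (K := K) (D := D) (t := 0) (by positivity) hi (h.ini i).2
        have := h.ini i
        exact ⟨by omega, by omega⟩

theorem tilingExpr_starFree : (tilingExpr K D q Q ini).StarFree := by
  rw [tilingExpr, starFree_catList, choosers_eq]
  intro r hr
  rcases List.mem_append.mp hr with hr | hr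
  · rw [List.eq_of_mem_replicate hr, chooser, StarFree, starFree_altList, ← List.replicate_succ]
    intro s hs
    rw [List.eq_of_mem_replicate hs]
    trivial
  · rcases mem_tilingChecks.mp hr with ⟨t, -, i, -, rfl⟩ | ⟨i, -, rfl⟩
    · rw [windowCheck, StarFree, starFree_altList, ← List.map_cons]
      intro s hs
      obtain ⟨p, -, rfl⟩ := List.mem_map.mp hs
      rw [windowExpr, starFree_catList]
      simp [StarFree]
    · trivial

theorem matches_windowExpr_iff {n t i : ℕ} {p : ℕ × ℕ × ℕ × ℕ} {e w e'} :
    Matches n (windowExpr K D t i p) e w e' ↔ e' = e ∧ ∃ u₁ u₂ u₃ u₄,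
      w = u₁ ++ (u₂ ++ (u₃ ++ u₄)) ∧ e (tileVar K D t i p.1) = some u₁ ∧
      e (tileVar K D t ((i + 1) % 2 ^ (K + 1)) p.2.1) = some u₂ ∧
      e (tileVar K D ((t + 1) % 2 ^ K) i p.2.2.1) = some u₃ ∧
      e (tileVar K D ((t + 1) % 2 ^ K) ((i + 1) % 2 ^ (K + 1)) p.2.2.2) = some u₄ := by
  simp only [windowExpr, matches_catList_iff, matchesList_cons_iff, matchesList_nil_iff,
    matches_ref_iff]
  constructor
  · rintro ⟨u₁, _, _, rfl, ⟨h₁, rfl⟩, u₂, _, _, rfl, ⟨h₂, rfl⟩, u₃, _, _, rfl, ⟨h₃, rfl⟩, u₄, _, _,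
      rfl, ⟨h₄, rfl⟩, rfl, rfl⟩
    exact ⟨rfl, u₁, u₂, u₃, u₄, by simp, h₁, h₂, h₃, h₄⟩
  · rintro ⟨rfl, u₁, u₂, u₃, u₄, rfl, h₁, h₂, h₃, h₄⟩
    exact ⟨u₁, _, _, rfl, ⟨h₁, rfl⟩, u₂, _, _, rfl, ⟨h₂, rfl⟩, u₃, _, _, rfl, ⟨h₃, rfl⟩, u₄, [], _,
      by simp, ⟨h₄, rfl⟩, rfl, rfl⟩

theorem matches_windowCheck_iff {n t i : ℕ} {e w e'} :
    Matches n (windowCheck K D q Q t i) e w e' ↔ ∃ p ∈ q :: Q, ∃ e₁,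
      Matches (n + 1) (windowExpr K D t i p) e w e₁ ∧ e' = Function.update e₁ (n + 1) (some w) := by
  rw [windowCheck, matches_group_iff]
  simp only [matches_altList_iff, ← List.map_cons]
  constructor
  · rintro ⟨e₁, ⟨l₁, s, l₂, hl, hm⟩, rfl⟩
    obtain ⟨l₁, l₂, hl₁, rfl, h₂⟩ := List.map_eq_append_iff.mp hl
    obtain ⟨p, l₂, rfl, rfl, rfl⟩ := List.map_eq_cons_iff.mp h₂
    rw [groupsSum_windowExprs] at hm
    exact ⟨p, by simp [hl₁], e₁, hm, rfl⟩
  · rintro ⟨p, hp, e₁, hm, rfl⟩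
    obtain ⟨l₁, l₂, hl⟩ := List.append_of_mem hp
    exact ⟨e₁, ⟨l₁.map (windowExpr K D t i), windowExpr K D t i p, l₂.map (windowExpr K D t i),
      by rw [hl, List.map_append, List.map_cons], by rwa [groupsSum_windowExprs]⟩, rfl⟩

end

/-! ### Matches of the expression and tilings. -/

section

variable {C : Type} {code : C → ℕ} {K D : ℕ} {q : C × C × C × C} {Q : List (C × C × C × C)}
  {ini : ℕ → C}

/-- The codes of a window. -/
def codes (code : C → ℕ) (q : C × C × C × C) : ℕ × ℕ × ℕ × ℕ :=
  (code q.1, code q.2.1, code q.2.2.1, code q.2.2.2)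

theorem codesWithin (hc : ∀ c, 2 ≤ code c ∧ code c ≤ 2 ^ D) :
    CodesWithin D (codes code q) (Q.map (codes code)) (fun i => code (ini i)) := by
  refine ⟨?_, fun _ => hc _⟩
  rw [← List.map_cons]
  simp only [List.mem_map, forall_exists_index, and_imp, forall_apply_eq_imp_iff₂]
  intro p _
  simp only [List.mem_cons, List.not_mem_nil, or_false, forall_eq_or_imp, forall_eq, codes]
  exact ⟨hc _, hc _, hc _, hc _⟩

/-- The choosers fix one code per tile. A check that matches refers only to instantiated variables,
hence to the chosen codes. The parentheses of the checks come after all choosers and so do not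
disturb the variables that are referred to. -/
theorem isTiling_of_matches (hD : 1 ≤ D) (hinj : Function.Injective code)
    (hc : ∀ c, 2 ≤ code c ∧ code c ≤ 2 ^ D)
    (h : ∃ w, w ∈ (tilingExpr K D (codes code q) (Q.map (codes code))
      fun i => code (ini i)).language) :
    ∃ τ, IsTiling (q :: Q) ini (2 ^ K) (2 ^ (K + 1)) τ := by
  obtain ⟨w, e', hm⟩ := h
  rw [tilingExpr, matches_catList_iff, choosers_eq, matchesList_append_iff] at hm
  obtain ⟨u, v, e, rfl, h₁, h₂⟩ := hm
  obtain ⟨ch, hch⟩ := h₁.exists_choice hD fun _ _ => rfl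
  rw [groupsSum_choosers hD, zero_add] at h₂
  have hpow : 2 ^ (2 * K + 2) = 2 * 2 ^ (2 * K + 1) := by ring
  have hval : ∀ {t i : ℕ} {c : C}, t < 2 ^ K → i < 2 ^ (K + 1) →
      e (tileVar K D t i (code c)) ≠ none →
        code c = ch (2 ^ (2 * K + 1) + (t * 2 ^ (K + 1) + i)) := by
    intro t i c ht hi hne
    have := tile_lt ht hi
    exact hch _ (by omega) _ (hc c).1 (hc c).2 (by rwa [zero_add])
  have hchecks : ∀ r ∈ tilingChecks K D (codes code q) (Q.map (codes code)) (fun i => code (ini i)),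
      ∃ m e₁ u e₂, Matches m r e₁ u e₂ ∧ ∀ k ≤ 2 ^ (2 * K + 2) * 2 ^ D, e₁ k = e k := fun r hr => by
    obtain ⟨m, e₁, u, e₂, -, h⟩ := h₂.exists_matches le_rfl hr
    exact ⟨m, e₁, u, e₂, h⟩
  have hwin : ∀ t < 2 ^ K, ∀ i < 2 ^ (K + 1), ∃ p ∈ q :: Q,
      code p.1 = ch (2 ^ (2 * K + 1) + (t * 2 ^ (K + 1) + i)) ∧
      code p.2.1 = ch (2 ^ (2 * K + 1) + (t * 2 ^ (K + 1) + (i + 1) % 2 ^ (K + 1))) ∧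
      code p.2.2.1 = ch (2 ^ (2 * K + 1) + ((t + 1) % 2 ^ K * 2 ^ (K + 1) + i)) ∧
      code p.2.2.2 = ch (2 ^ (2 * K + 1) +
        ((t + 1) % 2 ^ K * 2 ^ (K + 1) + (i + 1) % 2 ^ (K + 1))) := by
    intro t ht i hi
    obtain ⟨m, e₁, u, e₂, hm, he⟩ := hchecks _ (mem_tilingChecks.mpr (.inl ⟨t, ht, i, hi, rfl⟩))
    obtain ⟨p, hp, e₃, hm, -⟩ := matches_windowCheck_iff.mp hm
    rw [← List.map_cons] at hp
    obtain ⟨p, hpQ, rfl⟩ := List.mem_map.mp hp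
    obtain ⟨-, u₁, u₂, u₃, u₄, -, h₁, h₂, h₃, h₄⟩ := matches_windowExpr_iff.mp hm
    have ht' := mod_two_pow_lt (t + 1) K
    have hi' := mod_two_pow_lt (i + 1) (K + 1)
    simp only [codes] at h₁ h₂ h₃ h₄
    refine ⟨p, hpQ, hval ht hi ?_, hval ht hi' ?_, hval ht' hi ?_, hval ht' hi' ?_⟩
    · rw [← he _ (tileVar_bounds ht hi (hc _).2).2, h₁]; simp
    · rw [← he _ (tileVar_bounds ht hi' (hc _).2).2, h₂]; simp
    · rw [← he _ (tileVar_bounds ht' hi (hc _).2).2, h₃]; simp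
    · rw [← he _ (tileVar_bounds ht' hi' (hc _).2).2, h₄]; simp
  -- Every tile lies in a window, so the chosen number is the code of an element of `C`; outside the
  -- torus any element will do.
  have hex : ∀ t i, ∃ c, t < 2 ^ K → i < 2 ^ (K + 1) →
      code c = ch (2 ^ (2 * K + 1) + (t * 2 ^ (K + 1) + i)) := by
    intro t i
    by_cases h : t < 2 ^ K ∧ i < 2 ^ (K + 1)
    · obtain ⟨p, -, hp, -⟩ := hwin t h.1 i h.2
      exact ⟨p.1, fun _ _ => hp⟩
    · exact ⟨q.1, fun ht hi => (h ⟨ht, hi⟩).elim⟩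
  choose τ hτ using hex
  refine ⟨τ, fun t ht i hi => ?_, fun i hi => ?_⟩
  · obtain ⟨p, hp, h₁, h₂, h₃, h₄⟩ := hwin t ht i hi
    have ht' := mod_two_pow_lt (t + 1) K
    have hi' := mod_two_pow_lt (i + 1) (K + 1)
    convert hp using 1
    refine Prod.ext ?_ (Prod.ext ?_ (Prod.ext ?_ ?_)) <;> apply hinj
    · exact (hτ t i ht hi).trans h₁.symm
    · exact (hτ _ _ ht hi').trans h₂.symm
    · exact (hτ _ _ ht' hi).trans h₃.symm
    · exact (hτ _ _ ht' hi').trans h₄.symm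
  · obtain ⟨m, e₁, u, e₂, hm, he⟩ := hchecks _ (mem_tilingChecks.mpr (.inr ⟨i, hi, rfl⟩))
    have h := (matches_ref_iff.mp hm).1
    have ht : 0 < 2 ^ K := by positivity
    apply hinj
    rw [hτ 0 i ht hi, hval ht hi]
    rw [← he _ (tileVar_bounds ht hi (hc _).2).2, h]
    simp

/-- A chooser matches one letter, the check of a window four and a check of row `0` one. There are
two choosers per tile, one of them padding; this gives six letters per tile and one more per column.
-/
theorem replicate_mem_language (hD : 1 ≤ D) (hc : ∀ c, 2 ≤ code c ∧ code c ≤ 2 ^ D)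
    {τ : ℕ → ℕ → C} (h : IsTiling (q :: Q) ini (2 ^ K) (2 ^ (K + 1)) τ) :
    List.replicate (6 * (2 ^ K * 2 ^ (K + 1)) + 2 ^ (K + 1)) () ∈
      (tilingExpr K D (codes code q) (Q.map (codes code)) fun i => code (ini i)).language := by
  have hpow : 2 ^ (2 * K + 1) = 2 ^ K * 2 ^ (K + 1) := by ring
  have hpow' : 2 ^ (2 * K + 2) = 2 * (2 ^ K * 2 ^ (K + 1)) := by ring
  have hN : 0 < 2 ^ (K + 1) := by positivity
  obtain ⟨e, h₁, hch⟩ := exists_matchesList_choosers hD 0 (2 ^ (2 * K + 2)) (fun _ => none)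
    -- The first `2 ^ (2 * K + 1)` choosers are padding, which only shifts the numbers; truncated
    -- subtraction gives them all the code of the tile at the origin, which is as good as any.
    (fun j => code (τ ((j - 2 ^ (2 * K + 1)) / 2 ^ (K + 1)) ((j - 2 ^ (2 * K + 1)) % 2 ^ (K + 1))))
    fun j _ => hc _
  have hval : ∀ {t i : ℕ}, t < 2 ^ K → i < 2 ^ (K + 1) →
      e (tileVar K D t i (code (τ t i))) = some [()] := by
    intro t i ht hi
    have := tile_lt ht hi
    have := hch (2 ^ (2 * K + 1) + (t * 2 ^ (K + 1) + i)) (by omega)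
    rwa [Nat.add_sub_cancel_left, mul_comm t, Nat.mul_add_div hN, Nat.div_eq_of_lt hi, add_zero,
      Nat.mul_add_mod, Nat.mod_eq_of_lt hi, zero_add, mul_comm _ t] at this
  let f : PRE Unit → List Unit := fun r => match r with
    | ref _ => [()]
    | _ => [(), (), (), ()]
  obtain ⟨e', h₂⟩ := exists_matchesList (P := 2 ^ (2 * K + 2) * 2 ^ D) (e := e) (f := f)
    (l := tilingChecks K D (codes code q) (Q.map (codes code)) fun i => code (ini i)) (by
      intro r hr m _ e₁ he
      rcases mem_tilingChecks.mp hr with ⟨t, ht, i, hi, rfl⟩ | ⟨i, hi, rfl⟩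
      · have ht' := mod_two_pow_lt (t + 1) K
        have hi' := mod_two_pow_lt (i + 1) (K + 1)
        refine ⟨_, matches_windowCheck_iff.mpr ⟨codes code (τ t i,
          τ t ((i + 1) % 2 ^ (K + 1)), τ ((t + 1) % 2 ^ K) i,
          τ ((t + 1) % 2 ^ K) ((i + 1) % 2 ^ (K + 1))), ?_, e₁, matches_windowExpr_iff.mpr
          ⟨rfl, [()], [()], [()], [()], rfl, ?_, ?_, ?_, ?_⟩, rfl⟩⟩
        · rw [← List.map_cons]
          exact List.mem_map_of_mem (h.1 t ht i hi)
        · exact (he _ (tileVar_bounds ht hi (hc _).2).2).trans (hval ht hi)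
        · exact (he _ (tileVar_bounds ht hi' (hc _).2).2).trans (hval ht hi')
        · exact (he _ (tileVar_bounds ht' hi (hc _).2).2).trans (hval ht' hi)
        · exact (he _ (tileVar_bounds ht' hi' (hc _).2).2).trans (hval ht' hi')
      · have ht : 0 < 2 ^ K := by positivity
        refine ⟨e₁, .ref _ _ _ _ ?_⟩
        rw [he _ (tileVar_bounds ht hi (hc _).2).2, ← h.2 i hi]
        exact hval ht hi) le_rfl
  refine ⟨e', ?_⟩
  rw [tilingExpr, matches_catList_iff, choosers_eq, matchesList_append_iff]
  refine ⟨_, _, e, ?_, h₁, by rwa [groupsSum_choosers hD, zero_add]⟩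
  refine (List.eq_replicate_iff.mpr ⟨?_, fun _ _ => rfl⟩).symm
  simp [tilingChecks, f, windowCheck, List.length_flatMap, List.flatMap_map, List.flatMap_assoc]
  rw [hpow']
  ring

end

end PRE

/-! ## Binary counters on stacks -/

namespace Complexity

/-- The lowest `L` binary digits of a number, least significant digit first. -/
def lowBits : ℕ → ℕ → List Bool
  | 0, _ => []
  | L + 1, v => v.bodd :: lowBits L v.div2

@[simp]
theorem length_lowBits (L v : ℕ) : (lowBits L v).length = L := by
  induction L generalizing v with
  | zero => rfl
  | succ L ih => simp [lowBits, ih]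

theorem lowBits_zero (L : ℕ) : lowBits L 0 = List.replicate L false := by
  induction L with
  | zero => rfl
  | succ L ih => rw [lowBits, Nat.div2_zero, ih]; rfl

theorem div2_add_two_mul (x y : ℕ) : (y + 2 * x).div2 = y.div2 + x ∧ (y + 2 * x).bodd = y.bodd := by
  constructor
  · rw [Nat.div2_val, Nat.div2_val, Nat.add_mul_div_left _ _ (by norm_num)]
  · simp

theorem lowBits_add (a b x y : ℕ) (hy : y < 2 ^ b) :
    lowBits (a + b) (x * 2 ^ b + y) = lowBits b y ++ lowBits a x := by
  induction b generalizing y with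
  | zero => obtain rfl : y = 0 := by simpa using hy
            simp [lowBits]
  | succ b ih =>
    have h : x * 2 ^ (b + 1) + y = y + 2 * (x * 2 ^ b) := by ring
    rw [← add_assoc, lowBits, lowBits, h, (div2_add_two_mul _ _).1, (div2_add_two_mul _ _).2,
      add_comm y.div2, ih _ (by rw [Nat.div2_val]; rw [pow_succ] at hy; omega)]
    rfl

theorem lowBits_add_two_pow (L v : ℕ) : lowBits L (v + 2 ^ L) = lowBits L v := by
  induction L generalizing v with
  | zero => rfl
  | succ L ih =>
    rw [lowBits, lowBits, pow_succ', (div2_add_two_mul _ _).1, (div2_add_two_mul _ _).2, ih]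

/-- The leading one turns digits of fixed width, leading zeros included, into the binary notation of
a number. -/
theorem bits_two_pow_add (L v : ℕ) (hv : v < 2 ^ L) :
    Nat.bits (2 ^ L + v) = lowBits L v ++ [true] := by
  induction L generalizing v with
  | zero => obtain rfl : v = 0 := by simpa using hv
            simp [lowBits]
  | succ L ih =>
    have h := Nat.bodd_add_div2 v
    have hb : 2 ^ (L + 1) + v = Nat.bit v.bodd (2 ^ L + v.div2) := by
      rw [Nat.bit_val, pow_succ]
      omega
    rw [hb, Nat.bits_append_bit _ _ (by
      intro h; have := Nat.one_le_two_pow (n := L); omega), lowBits,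
      ih _ (by rw [Nat.div2_val]; rw [pow_succ] at hv; omega), List.cons_append]

theorem bodd_div2_succ (v : ℕ) : (v.bodd = false ∧ (v + 1).bodd = true ∧ (v + 1).div2 = v.div2) ∨
    (v.bodd = true ∧ (v + 1).bodd = false ∧ (v + 1).div2 = v.div2 + 1) := by
  rw [Nat.bodd_succ, Nat.div2_succ]
  cases v.bodd <;> simp

/-- The two cases of a carry: it stops at the lowest zero, or it runs through all digits and the
counter wraps around to zero. -/
theorem lowBits_succ (L v : ℕ) :
    (∃ a l, lowBits L v = List.replicate a true ++ false :: l ∧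
      lowBits L (v + 1) = List.replicate a false ++ true :: l ∧ (v + 1) % 2 ^ L ≠ 0) ∨
    (lowBits L v = List.replicate L true ∧ lowBits L (v + 1) = List.replicate L false ∧
      (v + 1) % 2 ^ L = 0) := by
  induction L generalizing v with
  | zero => exact .inr ⟨rfl, rfl, Nat.mod_one _⟩
  | succ L ih =>
    have h := Nat.bodd_add_div2 (v + 1)
    rcases bodd_div2_succ v with ⟨h₁, h₂, h₃⟩ | ⟨h₁, h₂, h₃⟩
    · refine .inl ⟨0, lowBits L v.div2, by rw [lowBits, h₁]; rfl, by rw [lowBits, h₂, h₃]; rfl,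
        fun hm => ?_⟩
      obtain ⟨k, hk⟩ := Nat.dvd_of_mod_eq_zero hm
      rw [h₂, hk] at h
      rw [show 2 ^ (L + 1) * k = 2 * (2 ^ L * k) by ring] at h
      simp only [Bool.toNat_true] at h
      omega
    · have hm : (v + 1) % 2 ^ (L + 1) = 2 * ((v.div2 + 1) % 2 ^ L) := by
        rw [pow_succ', ← Nat.mul_mod_mul_left, ← h₃]
        rw [h₂] at h
        simp only [Bool.toNat_false] at h
        congr 1
        omega
      rcases ih v.div2 with ⟨a, l, e₁, e₂, e₃⟩ | ⟨e₁, e₂, e₃⟩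
      · exact .inl ⟨a + 1, l, by rw [lowBits, h₁, e₁]; rfl, by rw [lowBits, h₂, h₃, e₂]; rfl,
          by omega⟩
      · exact .inr ⟨by rw [lowBits, h₁, e₁]; rfl, by rw [lowBits, h₂, h₃, e₂]; rfl, by omega⟩

/-- Here the width is not fixed: a carry through all digits creates a new leading one. This is the
moment at which the counters have to be widened. -/
theorem bits_succ (n : ℕ) :
    (∃ a l, Nat.bits n = List.replicate a true ++ false :: l ∧
      Nat.bits (n + 1) = List.replicate a false ++ true :: l) ∨
    (∃ a, Nat.bits n = List.replicate a true ∧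
      Nat.bits (n + 1) = List.replicate a false ++ [true]) := by
  induction n using Nat.binaryRec' with
  | zero => exact .inr ⟨0, by simp⟩
  | bit b n hn ih =>
    rw [Nat.bits_append_bit _ _ hn]
    cases b with
    | false =>
      refine .inl ⟨0, n.bits, rfl, ?_⟩
      rw [show Nat.bit false n + 1 = Nat.bit true n by simp [Nat.bit_val],
        Nat.bits_append_bit _ _ (fun _ => rfl)]
      rfl
    | true =>
      rw [show Nat.bit true n + 1 = Nat.bit false (n + 1) by simp [Nat.bit_val]; ring,
        Nat.bits_append_bit _ _ (fun h => by simp at h)]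
      rcases ih with ⟨a, l, h₁, h₂⟩ | ⟨a, h₁, h₂⟩
      · exact .inl ⟨a + 1, l, by rw [h₁]; rfl, by rw [h₂]; rfl⟩
      · exact .inr ⟨a + 1, by rw [h₁]; rfl, by rw [h₂]; rfl⟩

namespace Prog

variable {Γ Δ ι A : Type} {w : List Γ} {p q : Prog Γ Δ ι A} {m m' m'' : Mem Δ ι A}

theorem Sem.seq (h : Sem w p m m') (h' : Sem w q m' m'') : Sem w (seq p q) m m'' :=
  sem_seq.mpr ⟨_, h, h'⟩

theorem Sem.act {f} {e : Effect Δ ι A} (h : f (Machine.readInput w m.pos) m.tops = some e)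
    (hm : m' = m.apply w e) : Sem w (act f) m m' := ⟨1, hm ▸ .act h⟩

theorem Sem.ite_true {c} (h : c (Machine.readInput w m.pos) m.tops = true) (hp : Sem w p m m') :
    Sem w (ite c p q) m m' := let ⟨_, h'⟩ := hp; ⟨_, .ite_true h h'⟩

theorem Sem.ite_false {c} (h : c (Machine.readInput w m.pos) m.tops = false) (hp : Sem w q m m') :
    Sem w (ite c p q) m m' := let ⟨_, h'⟩ := hp; ⟨_, .ite_false h h'⟩

theorem Sem.loop_true {c} (h : c (Machine.readInput w m.pos) m.tops = true) (hp : Sem w p m m')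
    (hq : Sem w (loop c p) m' m'') : Sem w (loop c p) m m'' :=
  let ⟨_, h₁⟩ := hp; let ⟨_, h₂⟩ := hq; ⟨_, .loop_true h h₁ h₂⟩

theorem Sem.loop_false {c} (h : c (Machine.readInput w m.pos) m.tops = false) :
    Sem w (loop c p) m m := ⟨_, .loop_false h⟩

theorem Sem.loop_of_forall {c} {n : ℕ} {σ : ℕ → Mem Δ ι A}
    (hc : ∀ j < n, c (Machine.readInput w (σ j).pos) (σ j).tops = true)
    (hn : c (Machine.readInput w (σ n).pos) (σ n).tops = false)
    (h : ∀ j < n, Sem w p (σ j) (σ (j + 1))) : Sem w (loop c p) (σ 0) (σ n) := by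
  suffices ∀ k j, j + k = n → Sem w (loop c p) (σ j) (σ n) from this n 0 (zero_add n)
  intro k
  induction k with
  | zero => rintro j rfl; exact .loop_false hn
  | succ k ih =>
    intro j hj
    exact .loop_true (hc j (by omega)) (h j (by omega)) (ih (j + 1) (by omega))

theorem Sem.seqs_nil : Sem w (seqs []) m m := sem_seqs_nil.mpr rfl

theorem Sem.seqs_cons {L : List (Prog Γ Δ ι A)} (h : Sem w p m m') (h' : Sem w (seqs L) m' m'') :
    Sem w (seqs (p :: L)) m m'' := h.seq h'

theorem det_seqs {L : List (Prog Γ Δ ι A)} (h : ∀ p ∈ L, p.Det) : (seqs L).Det := by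
  induction L with
  | nil => trivial
  | cons p L ih => exact ⟨h p (by simp), ih fun q hq => h q (by simp [hq])⟩

theorem nonShrinking_idle [Fintype ι] :
    NonShrinking (act fun _ _ => some .idle : Prog Γ Δ ι A) := by
  rintro x s e ⟨⟩
  simp [Effect.idle, StackOp.growth]

theorem nonShrinking_seqs [Fintype ι] {L : List (Prog Γ Δ ι A)} (h : ∀ p ∈ L, p.NonShrinking) :
    (seqs L).NonShrinking := by
  induction L with
  | nil => exact nonShrinking_idle
  | cons p L ih => exact ⟨h p (by simp), ih fun q hq => h q (by simp [hq])⟩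

end Prog

/-- The registers: a row and the next row, a column and the next column, the length of the input. -/
inductive Reg where
  | hi
  | hi1
  | lo
  | lo1
  | len
  deriving DecidableEq

instance : Fintype Reg := ⟨{.hi, .hi1, .lo, .lo1, .len}, fun r => by cases r <;> simp⟩

/-- The stacks of a register: its digits, least significant digit on top; auxiliary storage; an
overflow flag. -/
inductive Slot where
  | front
  | back
  | flag
  deriving DecidableEq

instance : Fintype Slot := ⟨{.front, .back, .flag}, fun r => by cases r <;> simp⟩

/-- Programs that use counters. -/
abbrev CProg (Γ Δ : Type) := Prog Γ Δ (Reg × Slot) Bool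

/-! ### Counters that never decrease the total height. -/

namespace CProg

open Prog

variable {Γ Δ : Type} {w : List Γ}

/-- The memory with given contents of the stacks. -/
def mem (R B F : Reg → List Bool) (p : ℕ) (o : List Δ) : Mem Δ (Reg × Slot) Bool :=
  ⟨p, fun i => match i.2 with | .front => R i.1 | .back => B i.1 | .flag => F i.1, o⟩

/-- An action that changes at most two stacks. -/
def change (i j : Reg × Slot) (a b : StackOp Bool) (em : Option Δ) : Effect Δ (Reg × Slot) Bool :=
  ⟨.stay, fun k => if k = i then a else if k = j then b else .keep, em⟩

theorem sum_growth_change {i j : Reg × Slot} (hij : i ≠ j) (a b : StackOp Bool) (em : Option Δ) :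
    ∑ k, ((change i j a b em).ops k).growth = a.growth + b.growth := by
  have : ∀ k, ((change i j a b em).ops k).growth =
      (if k = i then a.growth else 0) + if k = j then b.growth else 0 := by
    intro k
    simp only [change]
    by_cases h : k = i
    · subst h; simp [hij]
    · by_cases h' : k = j
      · subst h'; simp [h]
      · simp [h, h', StackOp.growth]
  simp [this, Finset.sum_add_distrib]

/-- Move the digit on top of the front of a register to the back. -/
def fwd (r : Reg) (g : Bool → Bool) : CProg Γ Δ :=
  act fun _ s => (s (r, .front)).map fun a =>
    change (r, .front) (r, .back) .pop (.push (g a)) none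

/-- Move the digit on top of the back of a register to the front. -/
def bwd (r : Reg) (em : Bool → Option Δ) : CProg Γ Δ :=
  act fun _ s => (s (r, .back)).map fun a =>
    change (r, .back) (r, .front) .pop (.push a) (em a)

/-- Replace the top of a stack. -/
def setTop (i : Reg × Slot) (a : Bool) : CProg Γ Δ :=
  act fun _ _ => some ⟨.stay, fun k => if k = i then .set a else .keep, none⟩

/-- Emit a symbol that may depend on the scanned input symbol. -/
def put (f : Option Γ → Δ) : CProg Γ Δ := act fun x _ => some ⟨.stay, fun _ => .keep, some (f x)⟩

/-- Move the input head. -/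
def move (d : Dir) : CProg Γ Δ := act fun _ _ => some ⟨d, fun _ => .keep, none⟩

/-- Push a symbol on some stacks. -/
def pushAll (S : Reg × Slot → Bool) (a : Bool) : CProg Γ Δ :=
  act fun _ _ => some ⟨.stay, fun i => bif S i then .push a else .keep, none⟩

/-- Every pop is paired with a push in the same action, so the digits in transit are never lost from
the count. -/
theorem nonShrinking_fwd (r : Reg) (g : Bool → Bool) : (fwd r g : CProg Γ Δ).NonShrinking := by
  intro x s e h
  obtain ⟨a, -, rfl⟩ := Option.map_eq_some_iff.mp h
  rw [sum_growth_change (by simp)]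
  rfl

theorem nonShrinking_bwd (r : Reg) (em : Bool → Option Δ) :
    (bwd r em : CProg Γ Δ).NonShrinking := by
  intro x s e h
  obtain ⟨a, -, rfl⟩ := Option.map_eq_some_iff.mp h
  rw [sum_growth_change (by simp)]
  rfl

theorem nonShrinking_setTop (i) (a : Bool) : (setTop i a : CProg Γ Δ).NonShrinking := by
  rintro x s e ⟨⟩
  refine Finset.sum_nonneg fun k _ => ?_
  dsimp only
  split_ifs <;> simp [StackOp.growth]

theorem nonShrinking_put (f : Option Γ → Δ) : (put f : CProg Γ Δ).NonShrinking := by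
  rintro x s e ⟨⟩
  simp [StackOp.growth]

theorem nonShrinking_move (d : Dir) : (move d : CProg Γ Δ).NonShrinking := by
  rintro x s e ⟨⟩
  simp [StackOp.growth]

theorem nonShrinking_pushAll (S) (a : Bool) : (pushAll S a : CProg Γ Δ).NonShrinking := by
  rintro x s e ⟨⟩
  refine Finset.sum_nonneg fun k _ => ?_
  dsimp only
  cases S k <;> simp [StackOp.growth]

variable {R B F : Reg → List Bool} {pos : ℕ} {o : List Δ} {r : Reg}

theorem sem_fwd {a : Bool} {l : List Bool} (g : Bool → Bool) (h : R r = a :: l) :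
    Sem w (fwd r g) (mem R B F pos o)
      (mem (Function.update R r l) (Function.update B r (g a :: B r)) F pos o) := by
  refine .act (e := change (r, .front) (r, .back) .pop (.push (g a)) none)
    (by simp [Mem.tops, mem, h]) ?_
  ext1
  · rfl
  · funext ⟨r', s⟩
    rcases eq_or_ne r' r with rfl | hr
    · cases s <;> simp [mem, Mem.apply, change, StackOp.run, h]
    · cases s <;> simp [mem, Mem.apply, change, StackOp.run, hr]
  · simp [mem, Mem.apply, change]

theorem sem_bwd {a : Bool} {l : List Bool} (em : Bool → Option Δ) (h : B r = a :: l) :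
    Sem w (bwd r em) (mem R B F pos o)
      (mem (Function.update R r (a :: R r)) (Function.update B r l) F pos
        (o ++ (em a).toList)) := by
  refine .act (e := change (r, .back) (r, .front) .pop (.push a) (em a))
    (by simp [Mem.tops, mem, h]) ?_
  ext1
  · rfl
  · funext ⟨r', s⟩
    rcases eq_or_ne r' r with rfl | hr
    · cases s <;> simp [mem, Mem.apply, change, StackOp.run, h]
    · cases s <;> simp [mem, Mem.apply, change, StackOp.run, hr]
  · simp [mem, Mem.apply, change]

theorem sem_setTop_front {a b : Bool} {l : List Bool} (h : R r = a :: l) :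
    Sem w (setTop (r, .front) b) (mem R B F pos o)
      (mem (Function.update R r (b :: l)) B F pos o) := by
  refine .act rfl ?_
  ext1
  · rfl
  · funext ⟨r', s⟩
    rcases eq_or_ne r' r with rfl | hr
    · cases s <;> simp [mem, Mem.apply, StackOp.run, h]
    · cases s <;> simp [mem, Mem.apply, StackOp.run, hr]
  · simp [mem, Mem.apply]

theorem sem_setTop_flag {a b : Bool} {l : List Bool} (h : F r = a :: l) :
    Sem w (setTop (r, .flag) b) (mem R B F pos o)
      (mem R B (Function.update F r (b :: l)) pos o) := by
  refine .act rfl ?_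
  ext1
  · rfl
  · funext ⟨r', s⟩
    rcases eq_or_ne r' r with rfl | hr
    · cases s <;> simp [mem, Mem.apply, StackOp.run, h]
    · cases s <;> simp [mem, Mem.apply, StackOp.run, hr]
  · simp [mem, Mem.apply]

theorem sem_put (f : Option Γ → Δ) : Sem w (put f) (mem R B F pos o)
    (mem R B F pos (o ++ [f (Machine.readInput w pos)])) := .act rfl rfl

theorem sem_move (d : Dir) : Sem w (move d) (mem R B F pos o)
    (mem R B F (Machine.moveInput w pos d) o) := by
  refine .act rfl ?_
  simp [mem, Mem.apply, StackOp.run]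

/-- Move digits from the front of a register to the back, as long as a condition holds. -/
def fwdWhile (r : Reg) (c : Option Bool → Bool) (g : Bool → Bool) : CProg Γ Δ :=
  loop (fun _ s => c (s (r, .front))) (fwd r g)

/-- Move all digits from the back of a register to the front. -/
def bwdAll (r : Reg) (em : Bool → Option Δ) : CProg Γ Δ :=
  loop (fun _ s => (s (r, .back)).isSome) (bwd r em)

theorem sem_fwdWhile {c : Option Bool → Bool} {g : Bool → Bool} {l₁ l₂ : List Bool}
    (h : R r = l₁ ++ l₂) (h₁ : ∀ a ∈ l₁, c (some a) = true) (h₂ : c l₂.head? = false) :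
    Sem w (fwdWhile r c g) (mem R B F pos o)
      (mem (Function.update R r l₂) (Function.update B r ((l₁.map g).reverse ++ B r)) F pos o) := by
  induction l₁ generalizing R B with
  | nil =>
    rw [List.nil_append] at h
    simp only [List.map_nil, List.reverse_nil, List.nil_append, ← h, Function.update_eq_self]
    exact .loop_false (by simpa [Mem.tops, mem, h] using h₂)
  | cons a l₁ ih =>
    refine .loop_true (by simpa [Mem.tops, mem, h] using h₁ a (by simp)) (sem_fwd g h) ?_
    have := ih (R := Function.update R r (l₁ ++ l₂)) (B := Function.update B r (g a :: B r))
      (by simp) fun a ha => h₁ a (by simp [ha])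
    rw [fwdWhile] at this
    simpa using this

theorem sem_bwdAll {em : Bool → Option Δ} {l : List Bool} (h : B r = l) :
    Sem w (bwdAll r em) (mem R B F pos o)
      (mem (Function.update R r (l.reverse ++ R r)) (Function.update B r []) F pos
        (o ++ l.filterMap em)) := by
  induction l generalizing R B o with
  | nil =>
    have h' : Function.update B r [] = B := by rw [← h, Function.update_eq_self]
    simp only [List.reverse_nil, List.nil_append, List.filterMap_nil, List.append_nil,
      Function.update_eq_self, h']
    exact .loop_false (by simp [Mem.tops, mem, h])
  | cons a l ih =>
    refine .loop_true (by simp [Mem.tops, mem, h]) (sem_bwd em h) ?_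
    have := ih (R := Function.update R r (a :: R r)) (B := Function.update B r l) (by simp)
      (o := o ++ (em a).toList)
    rw [bwdAll] at this
    cases he : em a <;> simpa [he] using this

/-- Emit the digits of a register, most significant digit first. -/
def putReg (r : Reg) (f : Bool → Δ) : CProg Γ Δ :=
  seq (fwdWhile r Option.isSome id) (bwdAll r fun a => some (f a))

theorem sem_putReg (f : Bool → Δ) : Sem w (putReg r f) (mem R (fun _ => []) F pos o)
    (mem R (fun _ => []) F pos (o ++ (R r).reverse.map f)) := by
  have h₁ := sem_fwdWhile (w := w) (R := R) (B := fun _ => []) (F := F) (pos := pos) (o := o)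
    (c := Option.isSome) (g := id) (l₁ := R r) (l₂ := []) (r := r) (by simp) (by simp) rfl
  have h₂ := sem_bwdAll (w := w) (R := Function.update R r [])
    (B := Function.update (fun _ => []) r (((R r).map id).reverse ++ [])) (F := F) (pos := pos)
    (o := o) (r := r) (em := fun a => some (f a)) rfl
  rw [putReg]
  convert h₁.seq h₂ using 2
  · simp
  · simp
  · simp [List.filterMap_eq_map']

/-- Increment a register. The program `ov` is run in case of an overflow. -/
def inc (r : Reg) (ov : CProg Γ Δ) : CProg Γ Δ :=
  seq (fwdWhile r (fun a => a == some true) fun _ => false)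
    (seq (ite (fun _ s => (s (r, .front)).isNone) ov (setTop (r, .front) true))
      (bwdAll r fun _ => none))

theorem sem_inc {a : ℕ} {l : List Bool} {ov : CProg Γ Δ}
    (h : R r = List.replicate a true ++ false :: l) :
    Sem w (inc r ov) (mem R (fun _ => []) F pos o)
      (mem (Function.update R r (List.replicate a false ++ true :: l)) (fun _ => []) F pos o) := by
  have h₁ := sem_fwdWhile (w := w) (B := fun _ => []) (F := F) (pos := pos) (o := o)
    (c := fun a => a == some true) (g := fun _ => false) h
    (fun b hb => by rw [List.eq_of_mem_replicate hb]; rfl) rfl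
  have h₂ := sem_setTop_front (w := w) (R := Function.update R r (false :: l)) (r := r) (b := true)
    (B := Function.update (fun _ => []) r
      (((List.replicate a true).map fun _ => false).reverse ++ [])) (F := F) (pos := pos) (o := o)
    (a := false) (l := l) (by simp)
  have h₃ := sem_bwdAll (w := w)
    (R := Function.update (Function.update R r (false :: l)) r (true :: l))
    (B := Function.update (fun _ => []) r
      (((List.replicate a true).map fun _ => false).reverse ++ [])) (F := F) (pos := pos) (o := o)
    (r := r) (em := fun _ => none) rfl
  rw [inc]
  convert h₁.seq ((Sem.ite_false
    (c := fun _ s => (s (r, .front)).isNone) (by simp [Mem.tops, mem]) h₂).seq h₃) using 2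
  · simp
  · simp
  · simp

/-- The program `ov` runs when the front of `r` is empty and its digits, already turned into zeros,
lie on the back. Therefore it is considered for every `B`, and the digits it leaves on the front
become leading digits. -/
theorem sem_inc_overflow {R₁ F₁ : Reg → List Bool} {a : ℕ} {ov : CProg Γ Δ}
    (h : R r = List.replicate a true) (hov : ∀ B, Sem w ov
      (mem (Function.update R r []) B F pos o) (mem R₁ B F₁ pos o)) :
    Sem w (inc r ov) (mem R (fun _ => []) F pos o)
      (mem (Function.update R₁ r (List.replicate a false ++ R₁ r)) (fun _ => []) F₁ pos o) := by
  have h₁ := sem_fwdWhile (w := w) (B := fun _ => []) (F := F) (pos := pos) (o := o)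
    (c := fun a => a == some true) (g := fun _ => false) (h.trans (List.append_nil _).symm)
    (fun b hb => by rw [List.eq_of_mem_replicate hb]; rfl) rfl
  have h₃ := sem_bwdAll (w := w) (R := R₁)
    (B := Function.update (fun _ => []) r
      (((List.replicate a true).map fun _ => false).reverse ++ [])) (F := F₁) (pos := pos) (o := o)
    (r := r) (em := fun _ => none) rfl
  rw [inc]
  convert h₁.seq ((Sem.ite_true
    (c := fun _ s => (s (r, .front)).isNone) (by simp [Mem.tops, mem]) (hov _)).seq h₃) using 2
  · simp
  · simp
  · simp

theorem det_inc {ov : CProg Γ Δ} (h : ov.Det) : (inc r ov).Det := ⟨trivial, ⟨h, trivial⟩, trivial⟩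

theorem nonShrinking_inc {ov : CProg Γ Δ} (h : ov.NonShrinking) : (inc r ov).NonShrinking :=
  ⟨nonShrinking_fwd _ _, ⟨h, nonShrinking_setTop _ _⟩, nonShrinking_bwd _ _⟩

theorem nonShrinking_putReg (f : Bool → Δ) : (putReg r f : CProg Γ Δ).NonShrinking :=
  ⟨nonShrinking_fwd _ _, nonShrinking_bwd _ _⟩

end CProg

end Complexity

/-! ## A program that writes down the expression for tilings -/

namespace Complexity

/-- The registers for the next row and column drop their carry, which is the neighbourhood relation
on the torus. -/
theorem lowBits_succ_mod {L v : ℕ} (hv : v < 2 ^ L) :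
    lowBits L ((v + 1) % 2 ^ L) = lowBits L (v + 1) := by
  rcases (Nat.succ_le_of_lt hv).lt_or_eq with h | h
  · rw [Nat.mod_eq_of_lt h]
  · rw [Nat.succ_eq_add_one] at h
    have := lowBits_add_two_pow L 0
    rw [zero_add] at this
    rw [h, Nat.mod_self, this]

theorem Prog.Sem.of_eq {Γ Δ ι A : Type} {w : List Γ} {p : Prog Γ Δ ι A} {m m₁ m₂ : Mem Δ ι A}
    (h : Sem w p m m₁) (he : m₁ = m₂) : Sem w p m m₂ := he ▸ h

namespace CProg

open Prog PRE

theorem mem_congr {Δ : Type} {R R' B B' F F' : Reg → List Bool} {p p' : ℕ} {o o' : List Δ}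
    (hR : ∀ r, R r = R' r) (hB : B = B') (hF : ∀ r, F r = F' r) (hp : p = p') (ho : o = o') :
    mem R B F p o = mem R' B' F' p' o' := by
  rw [funext hR, hB, funext hF, hp, ho]

/-! ### Loops over rows and columns, and printing. -/

section

variable {Γ Δ : Type} {w : List Γ} {R B F : Reg → List Bool} {pos : ℕ} {o : List Δ} {r : Reg}

theorem sem_pushAll (S : Reg × Slot → Bool) (a : Bool) : Sem w (pushAll S a) (mem R B F pos o)
    (mem (fun r => bif S (r, .front) then a :: R r else R r)
      (fun r => bif S (r, .back) then a :: B r else B r)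
      (fun r => bif S (r, .flag) then a :: F r else F r) pos o) := by
  refine .act rfl ?_
  ext1
  · rfl
  · funext ⟨r, s⟩
    cases s <;> simp only [mem, Mem.apply]
    · cases S (r, .front) <;> rfl
    · cases S (r, .back) <;> rfl
    · cases S (r, .flag) <;> rfl
  · simp [mem, Mem.apply]

/-- Increment a register and raise its flag in case of an overflow. -/
def incFlag (r : Reg) : CProg Γ Δ := inc r (setTop (r, .flag) true)

/-- Increment a register and ignore an overflow. -/
def incMod (r : Reg) : CProg Γ Δ := inc r (seqs [])

theorem sem_incFlag {L v : ℕ} {b : Bool} (h : R r = lowBits L v) (hF : F r = [b]) :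
    Sem w (incFlag r) (mem R (fun _ => []) F pos o) (mem (Function.update R r (lowBits L (v + 1)))
      (fun _ => []) (Function.update F r [b || decide ((v + 1) % 2 ^ L = 0)]) pos o) := by
  rcases lowBits_succ L v with ⟨a, l, h₁, h₂, h₃⟩ | ⟨h₁, h₂, h₃⟩
  · have := sem_inc (w := w) (F := F) (pos := pos) (o := o) (ov := setTop (r, .flag) true)
      (h.trans h₁)
    rw [h₂, decide_eq_false h₃, Bool.or_false, ← hF, Function.update_eq_self]
    exact this
  · have := sem_inc_overflow (w := w) (F := F) (pos := pos) (o := o) (ov := setTop (r, .flag) true)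
      (h.trans h₁) fun B => sem_setTop_flag hF
    rw [h₂, decide_eq_true h₃, Bool.or_true]
    exact this.of_eq (mem_congr (fun _ => by simp) rfl (fun _ => rfl) rfl rfl)

theorem sem_incMod {L v : ℕ} (h : R r = lowBits L v) :
    Sem w (incMod r) (mem R (fun _ => []) F pos o) (mem (Function.update R r (lowBits L (v + 1)))
      (fun _ => []) F pos o) := by
  rcases lowBits_succ L v with ⟨a, l, h₁, h₂, h₃⟩ | ⟨h₁, h₂, h₃⟩
  · have := sem_inc (w := w) (F := F) (pos := pos) (o := o) (ov := seqs []) (h.trans h₁)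
    rw [h₂]
    exact this
  · have := sem_inc_overflow (w := w) (F := F) (pos := pos) (o := o) (ov := seqs [])
      (h.trans h₁) fun B => .seqs_nil
    rw [h₂]
    exact this.of_eq (mem_congr (fun _ => by simp) rfl (fun _ => rfl) rfl rfl)

/-- The contents of the registers: the row `t`, the column `i`, and the next ones. -/
def regs (K : ℕ) (ℓ : List Bool) (t i : ℕ) : Reg → List Bool
  | .hi => lowBits K t
  | .hi1 => lowBits K (t + 1)
  | .lo => lowBits (K + 1) i
  | .lo1 => lowBits (K + 1) (i + 1)
  | .len => ℓ

/-- The overflow flags. -/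
def flags (a b : Bool) : Reg → List Bool
  | .hi => [a]
  | .lo => [b]
  | _ => [false]

/-- The memory during the loops over rows and columns. -/
def ctr (K : ℕ) (ℓ : List Bool) (t i : ℕ) (a b : Bool) (p : ℕ) (o : List Δ) :
    Mem Δ (Reg × Slot) Bool :=
  mem (regs K ℓ t i) (fun _ => []) (flags a b) p o

/-- Go to the next column. -/
def nextLo : CProg Γ Δ := seq (incFlag .lo) (incMod .lo1)

/-- Go to the next row. -/
def nextHi : CProg Γ Δ := seq (incFlag .hi) (incMod .hi1)

variable {K : ℕ} {ℓ : List Bool} {t i : ℕ} {a b : Bool}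

theorem sem_nextLo : Sem w nextLo (ctr K ℓ t i a b pos o)
    (ctr K ℓ t (i + 1) a (b || decide ((i + 1) % 2 ^ (K + 1) = 0)) pos o) := by
  have h₁ := sem_incFlag (w := w) (R := regs K ℓ t i) (F := flags a b) (pos := pos) (o := o)
    (r := .lo) rfl rfl
  have h₂ := sem_incMod (w := w) (R := Function.update (regs K ℓ t i) .lo (lowBits (K + 1) (i + 1)))
    (F := Function.update (flags a b) .lo [b || decide ((i + 1) % 2 ^ (K + 1) = 0)]) (pos := pos)
    (o := o) (r := .lo1) (L := K + 1) (v := i + 1) rfl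
  exact (h₁.seq h₂).of_eq (mem_congr (fun r => by cases r <;> rfl) rfl
    (fun r => by cases r <;> rfl) rfl rfl)

theorem sem_nextHi : Sem w nextHi (ctr K ℓ t i a b pos o)
    (ctr K ℓ (t + 1) i (a || decide ((t + 1) % 2 ^ K = 0)) b pos o) := by
  have h₁ := sem_incFlag (w := w) (R := regs K ℓ t i) (F := flags a b) (pos := pos) (o := o)
    (r := .hi) rfl rfl
  have h₂ := sem_incMod (w := w) (R := Function.update (regs K ℓ t i) .hi (lowBits K (t + 1)))
    (F := Function.update (flags a b) .hi [a || decide ((t + 1) % 2 ^ K = 0)]) (pos := pos)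
    (o := o) (r := .hi1) (L := K) (v := t + 1) rfl
  exact (h₁.seq h₂).of_eq (mem_congr (fun r => by cases r <;> rfl) rfl
    (fun r => by cases r <;> rfl) rfl rfl)

/-- Run a program for all columns from the current one. -/
def loopLo (p : CProg Γ Δ) : CProg Γ Δ :=
  seq (loop (fun _ s => s (.lo, .flag) != some true) (seq p nextLo)) (setTop (.lo, .flag) false)

/-- Run a program for all rows. -/
def loopHi (p : CProg Γ Δ) : CProg Γ Δ :=
  seq (loop (fun _ s => s (.hi, .flag) != some true) (seq p nextHi)) (setTop (.hi, .flag) false)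

/-- The loop ends when the counter overflows and raises its flag, so no bound is stored. It may
start at any column `j`, because the first column of row `0` is printed separately; `p` follows the
input head, which may move along with the columns. -/
theorem sem_loopLo {p : ℕ → ℕ} {g : ℕ → List Δ} {body : CProg Γ Δ} {j m : ℕ} (hm : 0 < m)
    (hjm : j + m = 2 ^ (K + 1)) (h : ∀ i, j ≤ i → i < 2 ^ (K + 1) → ∀ o,
      Sem w body (ctr K ℓ t i a false (p i) o) (ctr K ℓ t i a false (p (i + 1)) (o ++ g i))) :
    Sem w (loopLo body) (ctr K ℓ t j a false (p j) o) (ctr K ℓ t 0 a false (p (2 ^ (K + 1)))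
      (o ++ (List.range m).flatMap fun i => g (j + i))) := by
  have h₁ := Sem.loop_of_forall (w := w) (n := m) (p := seq body nextLo)
    (c := fun _ s => s (.lo, .flag) != some true)
    (σ := fun i => ctr K ℓ t (j + i) a (decide (i = m)) (p (j + i))
      (o ++ (List.range i).flatMap fun i => g (j + i)))
    (fun i hi => by simp [Mem.tops, ctr, mem, flags, hi.ne]) (by simp [Mem.tops, ctr, mem, flags])
    (fun i hi => by
      have := (h (j + i) (by omega) (by omega) (o ++ (List.range i).flatMap fun i => g (j + i))).seq
        sem_nextLo
      rw [decide_eq_false hi.ne]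
      have e : (false || decide ((j + i + 1) % 2 ^ (K + 1) = 0)) = decide (i + 1 = m) := by
        rw [Bool.false_or, decide_eq_decide]
        rcases (show j + i + 1 ≤ 2 ^ (K + 1) by omega).lt_or_eq with h' | h'
        · rw [Nat.mod_eq_of_lt h']; omega
        · rw [h', Nat.mod_self]; omega
      rw [e, List.append_assoc] at this
      rw [List.range_succ, List.flatMap_append, List.flatMap_singleton]
      exact this)
  have h₂ := sem_setTop_flag (w := w) (R := regs K ℓ t (j + m)) (B := fun _ => [])
    (F := flags a true) (pos := p (j + m)) (o := o ++ (List.range m).flatMap fun i => g (j + i))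
    (r := .lo) (b := false) rfl
  rw [decide_eq_false hm.ne, decide_eq_true rfl] at h₁
  rw [List.range_zero, List.flatMap_nil, List.append_nil] at h₁
  refine (h₁.seq h₂).of_eq (mem_congr (fun r => ?_) rfl (fun r => by cases r <;> rfl)
    (by rw [hjm]) rfl)
  cases r
  · rfl
  · rfl
  -- After the overflow the counter for `2 ^ (K + 1)` shows the digits of `0`, and the counter for
  -- its successor those of `1`, as at the start of a row.
  · simpa [regs, hjm] using lowBits_add_two_pow (K + 1) 0
  · simpa [regs, hjm, add_comm] using lowBits_add_two_pow (K + 1) 1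
  · rfl

theorem sem_loopHi {g : ℕ → List Δ} {body : CProg Γ Δ} (h : ∀ t, t < 2 ^ K → ∀ o,
      Sem w body (ctr K ℓ t 0 false false pos o) (ctr K ℓ t 0 false false pos (o ++ g t))) :
    Sem w (loopHi body) (ctr K ℓ 0 0 false false pos o) (ctr K ℓ 0 0 false false pos
      (o ++ (List.range (2 ^ K)).flatMap g)) := by
  have h₁ := Sem.loop_of_forall (w := w) (n := 2 ^ K) (p := seq body nextHi)
    (c := fun _ s => s (.hi, .flag) != some true)
    (σ := fun t => ctr K ℓ t 0 (decide (t = 2 ^ K)) false pos (o ++ (List.range t).flatMap g))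
    (fun i hi => by simp [Mem.tops, ctr, mem, flags, hi.ne]) (by simp [Mem.tops, ctr, mem, flags])
    (fun t ht => by
      have := (h t ht (o ++ (List.range t).flatMap g)).seq sem_nextHi
      rw [decide_eq_false ht.ne]
      have e : (false || decide ((t + 1) % 2 ^ K = 0)) = decide (t + 1 = 2 ^ K) := by
        rw [Bool.false_or, decide_eq_decide]
        rcases (Nat.succ_le_of_lt ht).lt_or_eq with h' | h'
        · rw [Nat.mod_eq_of_lt h']; omega
        · rw [← Nat.succ_eq_add_one, h', Nat.mod_self]; simp
      rw [e, List.append_assoc] at this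
      rw [List.range_succ, List.flatMap_append, List.flatMap_singleton]
      exact this)
  have h₂ := sem_setTop_flag (w := w) (R := regs K ℓ (2 ^ K) 0) (B := fun _ => [])
    (F := flags true false) (pos := pos) (o := o ++ (List.range (2 ^ K)).flatMap g)
    (r := .hi) (b := false) rfl
  rw [decide_eq_false (Nat.two_pow_pos K).ne, decide_eq_true rfl] at h₁
  rw [List.range_zero, List.flatMap_nil, List.append_nil] at h₁
  refine (h₁.seq h₂).of_eq (mem_congr (fun r => ?_) rfl (fun r => by cases r <;> rfl) rfl rfl)
  cases r
  · simpa [regs] using lowBits_add_two_pow K 0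
  · simpa [regs, add_comm] using lowBits_add_two_pow K 1
  · rfl
  · rfl
  · rfl

theorem sem_loop_all {g : ℕ → ℕ → List Δ} {body : CProg Γ Δ}
    (h : ∀ t, t < 2 ^ K → ∀ i, i < 2 ^ (K + 1) → ∀ o,
      Sem w body (ctr K ℓ t i false false pos o) (ctr K ℓ t i false false pos (o ++ g t i))) :
    Sem w (loopHi (loopLo body)) (ctr K ℓ 0 0 false false pos o) (ctr K ℓ 0 0 false false pos
      (o ++ (List.range (2 ^ K)).flatMap fun t => (List.range (2 ^ (K + 1))).flatMap (g t))) :=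
  sem_loopHi fun t ht o => by
    simpa using sem_loopLo (w := w) (p := fun _ => pos) (g := g t) (j := 0) (o := o)
      (Nat.two_pow_pos (K + 1)) (zero_add _) fun i _ hi o => h t ht i hi o

/-- A token that may depend on the input symbol, or the digits of a register. -/
inductive Piece (Γ Δ : Type) where
  | tok (f : Option Γ → Δ)
  | reg (r : Reg) (f : Bool → Δ)

/-- The program that emits a piece. -/
def Piece.prog : Piece Γ Δ → CProg Γ Δ
  | tok f => put f
  | reg r f => putReg r f

/-- The symbols emitted for a piece. -/
def Piece.out (R : Reg → List Bool) (x : Option Γ) : Piece Γ Δ → List Δ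
  | tok f => [f x]
  | reg r f => (R r).reverse.map f

/-- The program that emits some pieces. -/
def print (l : List (Piece Γ Δ)) : CProg Γ Δ := seqs (l.map Piece.prog)

theorem sem_print {l : List (Piece Γ Δ)} : Sem w (print l) (mem R (fun _ => []) F pos o)
    (mem R (fun _ => []) F pos (o ++ l.flatMap (Piece.out R (Machine.readInput w pos)))) := by
  induction l generalizing o with
  | nil => simp [print]
  | cons x l ih =>
    rw [List.flatMap_cons, ← List.append_assoc]
    refine .seqs_cons ?_ ih
    cases x
    exacts [sem_put _, sem_putReg _]

theorem det_print (l : List (Piece Γ Δ)) : (print l).Det := by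
  refine det_seqs fun p hp => ?_
  obtain ⟨x, -, rfl⟩ := List.mem_map.mp hp
  cases x
  exacts [trivial, ⟨trivial, trivial⟩]

theorem nonShrinking_print (l : List (Piece Γ Δ)) : (print l).NonShrinking := by
  refine nonShrinking_seqs fun p hp => ?_
  obtain ⟨x, -, rfl⟩ := List.mem_map.mp hp
  cases x
  exacts [nonShrinking_put _, nonShrinking_putReg _]

theorem det_nextLo : (nextLo : CProg Γ Δ).Det := ⟨det_inc trivial, det_inc trivial⟩

theorem det_loopLo {p : CProg Γ Δ} (h : p.Det) : (loopLo p).Det := ⟨⟨h, det_nextLo⟩, trivial⟩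

theorem det_loopHi {p : CProg Γ Δ} (h : p.Det) : (loopHi p).Det :=
  ⟨⟨h, det_inc trivial, det_inc trivial⟩, trivial⟩

theorem nonShrinking_next (r r' : Reg) :
    (seq (incFlag r) (incMod r') : CProg Γ Δ).NonShrinking :=
  ⟨nonShrinking_inc (nonShrinking_setTop _ _), nonShrinking_inc nonShrinking_idle⟩

theorem nonShrinking_loopLo {p : CProg Γ Δ} (h : p.NonShrinking) : (loopLo p).NonShrinking :=
  ⟨⟨h, nonShrinking_next _ _⟩, nonShrinking_setTop _ _⟩

theorem nonShrinking_loopHi {p : CProg Γ Δ} (h : p.NonShrinking) : (loopHi p).NonShrinking :=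
  ⟨⟨h, nonShrinking_next _ _⟩, nonShrinking_setTop _ _⟩

end

/-! ### Setting up the counters -/

section

variable {Γ Δ : Type} {w : List Γ} {ℓ : List Bool} {a c pos : ℕ} {o : List Δ}

/-- The contents of the registers while their width is determined. -/
def wide (ℓ : List Bool) (a : ℕ) : Reg → List Bool
  | .hi => List.replicate a false
  | .hi1 => List.replicate a false
  | .lo => List.replicate (a + 1) false
  | .lo1 => List.replicate (a + 1) false
  | .len => ℓ

/-- Make the counters wider by `c`. -/
def widen (c : ℕ) : CProg Γ Δ :=
  seqs (List.replicate c (pushAll (fun i => decide (i.2 = .front ∧ i.1 ≠ .len)) false))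

theorem sem_widen {B F : Reg → List Bool} : Sem w (widen c) (mem (wide ℓ a) B F pos o)
    (mem (wide ℓ (a + c)) B F pos o) := by
  induction c generalizing a with
  | zero => exact .seqs_nil
  | succ c ih =>
    have := ih (a := a + 1)
    rw [show a + 1 + c = a + (c + 1) by omega] at this
    refine .seqs_cons ?_ this
    exact (sem_pushAll (fun i => decide (i.2 = .front ∧ i.1 ≠ .len)) false).of_eq
      (mem_congr (fun r => by cases r <;> rfl) (by funext r; cases r <;> rfl)
        (fun r => by cases r <;> rfl) rfl rfl)

/-- Count the input and determine the width of the counters. -/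
def setup (c : ℕ) : CProg Γ Δ :=
  seq (pushAll (fun i => decide (i.2 = .flag)) false)
    (seq (pushAll (fun i => decide (i = (.lo, .front) ∨ i = (.lo1, .front))) false)
      (seq (widen c) (seq (move .right)
        (seq (loop (fun x _ => x.isSome) (seq (inc .len (seq (pushAll
          (fun i => decide (i = (.len, .front))) true) (widen c))) (move .right)))
          (seq (move .left) (seq (loop (fun x _ => x.isSome) (move .left))
            (seq (incMod .hi1) (incMod .lo1))))))))

/-- The width of the counters for inputs of length `n`. -/
def width (c n : ℕ) : ℕ := c * (n.size + 1)

theorem readInput_isSome_iff {p : ℕ} :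
    (Machine.readInput w p).isSome = true ↔ 1 ≤ p ∧ p ≤ w.length := by
  rw [Machine.readInput]
  split_ifs with h
  · simp [h]
  · simp; omega

/-- Whenever the length acquires a new digit, the counters get `c` more digits; this maintains
`width c j` without any multiplication. -/
theorem sem_countStep {F : Reg → List Bool} (j : ℕ) :
    Sem w (inc .len (seq (pushAll (fun i => decide (i = (.len, .front))) true) (widen c)))
      (mem (wide (Nat.bits j) (width c j)) (fun _ => []) F pos o)
      (mem (wide (Nat.bits (j + 1)) (width c (j + 1))) (fun _ => []) F pos o) := by
  rcases bits_succ j with ⟨b, l, h₁, h₂⟩ | ⟨b, h₁, h₂⟩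
  · have hs : (j + 1).size = j.size := by
      rw [← Nat.size_eq_bits_len, ← Nat.size_eq_bits_len, h₁, h₂]
      simp
    convert sem_inc (w := w) (R := wide (Nat.bits j) (width c j)) (r := .len) (F := F) (pos := pos)
      (o := o) h₁ using 2
    rw [width, hs, ← width, h₂]
    funext r; cases r <;> rfl
  · have hs : (j + 1).size = j.size + 1 := by
      rw [← Nat.size_eq_bits_len, ← Nat.size_eq_bits_len, h₁, h₂]
      simp
    have := sem_inc_overflow (w := w) (R := wide (Nat.bits j) (width c j)) (r := .len) (F := F)
      (pos := pos) (o := o) (R₁ := wide [true] (width c j + c)) (F₁ := F)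
      (ov := seq (pushAll (fun i => decide (i = (.len, .front))) true) (widen c)) h₁ fun B => by
        refine Sem.seq ?_ sem_widen
        exact (sem_pushAll (fun i => decide (i = (.len, .front))) true).of_eq
          (mem_congr (fun r => by cases r <;> rfl) (by funext r; cases r <;> rfl)
            (fun r => by cases r <;> rfl) rfl rfl)
    convert this using 2
    rw [width, hs, h₂, show c * (j.size + 1 + 1) = width c j + c by rw [width]; ring]
    funext r; cases r <;> rfl

/-- One pass counts the input and widens the zero counters; then the head returns, and one increment
each makes the registers of the next row and column equal to one modulo their size. -/
theorem sem_setup : Sem w (setup c) (.init : Mem Δ (Reg × Slot) Bool)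
    (ctr (width c w.length) (Nat.bits w.length) 0 0 false false 0 []) := by
  have hinit : (.init : Mem Δ (Reg × Slot) Bool) =
      mem (fun _ => []) (fun _ => []) (fun _ => []) 0 [] := by
    ext1
    · rfl
    · funext ⟨r, s⟩; cases s <;> rfl
    · rfl
  rw [hinit]
  have h₁ := sem_pushAll (w := w) (R := fun _ => []) (B := fun _ => []) (F := fun _ => [])
    (pos := 0) (o := ([] : List Δ)) (fun i => decide (i.2 = .flag)) false
  have h₂ := sem_pushAll (w := w) (R := fun _ => []) (B := fun _ => []) (F := fun _ => [false])
    (pos := 0) (o := ([] : List Δ))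
    (fun i => decide (i = (.lo, .front) ∨ i = (.lo1, .front))) false
  have h₃ : Sem w (widen c) (mem (wide [] 0) (fun _ => []) (fun _ => [false]) 0 [])
      (mem (Δ := Δ) (wide [] (0 + c)) (fun _ => []) (fun _ => [false]) 0 []) := sem_widen
  have h₄ := sem_move (w := w) (R := wide [] (0 + c)) (B := fun _ => []) (F := fun _ => [false])
    (pos := 0) (o := ([] : List Δ)) .right
  have h₅ := Sem.loop_of_forall (w := w) (n := w.length) (c := fun x _ => x.isSome)
    (p := seq (inc .len (seq (pushAll (fun i => decide (i = (.len, .front))) true) (widen c)))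
      (move .right))
    (σ := fun j => mem (Δ := Δ) (wide (Nat.bits j) (width c j)) (fun _ => []) (fun _ => [false])
      (j + 1) [])
    (fun j hj => readInput_isSome_iff.mpr ⟨by simp [mem], by simpa [mem] using hj⟩)
    (by
      rw [← Bool.not_eq_true, readInput_isSome_iff]
      simp [mem])
    (fun j hj => by
      refine (sem_countStep j).seq ?_
      convert sem_move (w := w) .right using 2
      simp [Machine.moveInput, hj])
  have h₆ := sem_move (w := w) (R := wide (Nat.bits w.length) (width c w.length))
    (B := fun _ => []) (F := fun _ => [false]) (pos := w.length + 1) (o := ([] : List Δ)) .left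
  have h₇ := Sem.loop_of_forall (w := w) (n := w.length) (c := fun x _ => x.isSome)
    (p := move .left)
    (σ := fun j => mem (Δ := Δ) (wide (Nat.bits w.length) (width c w.length)) (fun _ => [])
      (fun _ => [false]) (w.length - j) [])
    (fun j hj => readInput_isSome_iff.mpr ⟨by simp only [mem]; omega, by simp [mem]⟩)
    (by
      rw [← Bool.not_eq_true, readInput_isSome_iff]
      simp [mem])
    (fun j hj => by
      refine (sem_move .left).of_eq (mem_congr (fun _ => rfl) rfl (fun _ => rfl) ?_ rfl)
      simp only [Machine.moveInput]
      omega)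
  rw [Nat.sub_self] at h₇
  have h₈ := sem_incMod (w := w) (R := wide (Nat.bits w.length) (width c w.length)) (r := .hi1)
    (F := fun _ => [false]) (pos := 0) (o := ([] : List Δ)) (lowBits_zero _).symm
  have h₉ := sem_incMod (w := w) (R := Function.update (wide (Nat.bits w.length) (width c w.length))
    .hi1 (lowBits (width c w.length) (0 + 1))) (r := .lo1) (L := width c w.length + 1) (v := 0)
    (F := fun _ => [false]) (pos := 0) (o := ([] : List Δ)) (lowBits_zero _).symm
  have e₁ : (fun r : Reg => bif decide ((r, Slot.flag).2 = Slot.flag) then [false] else []) =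
      fun _ => [false] := rfl
  have e₂ : (fun r : Reg => bif decide ((r, Slot.front) = (.lo, .front) ∨
      (r, Slot.front) = (.lo1, .front)) then [false] else []) = wide [] 0 := by
    funext r; cases r <;> rfl
  have e₃ : (fun r : Reg => bif decide ((r, Slot.back) = (.lo, .front) ∨
      (r, Slot.back) = (.lo1, .front)) then [false] else []) = fun _ => [] := by
    funext r; cases r <;> rfl
  have e₄ : (fun r : Reg => bif decide ((r, Slot.flag) = (.lo, .front) ∨
      (r, Slot.flag) = (.lo1, .front)) then [false, false] else [false]) = fun _ => [false] := by
    funext r; cases r <;> rfl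
  rw [e₂, e₃, e₄] at h₂
  have e₅ : wide [] (0 + c) = wide (Nat.bits 0) (width c 0) := by simp [width]
  have e₆ : Machine.moveInput w 0 .right = 1 := by simp [Machine.moveInput]
  rw [e₅, e₆] at h₄
  rw [e₅] at h₃
  have := h₁.seq (h₂.seq (h₃.seq (h₄.seq (h₅.seq (h₆.seq (h₇.seq (h₈.seq h₉)))))))
  rw [setup]
  refine this.of_eq (mem_congr (fun r => ?_) rfl (fun r => by cases r <;> rfl) rfl rfl)
  cases r
  · exact (lowBits_zero _).symm
  · rfl
  · exact (lowBits_zero _).symm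
  · rfl
  · rfl

theorem det_setup : (setup c : CProg Γ Δ).Det := by
  have h : (widen c : CProg Γ Δ).Det := det_seqs fun p hp => by
    rw [List.eq_of_mem_replicate hp]; trivial
  exact ⟨trivial, trivial, h, trivial, ⟨det_inc ⟨trivial, h⟩, trivial⟩, trivial, trivial,
    det_inc trivial, det_inc trivial⟩

theorem nonShrinking_setup : (setup c : CProg Γ Δ).NonShrinking := by
  have h : (widen c : CProg Γ Δ).NonShrinking := nonShrinking_seqs fun p hp => by
    rw [List.eq_of_mem_replicate hp]; exact nonShrinking_pushAll _ _
  exact ⟨nonShrinking_pushAll _ _, nonShrinking_pushAll _ _, h, nonShrinking_move _,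
    ⟨nonShrinking_inc ⟨nonShrinking_pushAll _ _, h⟩, nonShrinking_move _⟩, nonShrinking_move _,
    nonShrinking_move _, nonShrinking_inc nonShrinking_idle, nonShrinking_inc nonShrinking_idle⟩

end

end CProg

end Complexity

/-! ## Writing down the expression for tilings -/

namespace PRE

open Complexity

/-- Here the shift by `2 ^ (2 * K + 1)` blocks pays off: it supplies the leading one, after which
row, column and code occupy separate ranges of digits. A reference can be printed from the counters
without arithmetic. -/
theorem toTokens_ref_tileVar {K D t i c : ℕ} (ht : t < 2 ^ K) (hi : i < 2 ^ (K + 1))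
    (hc : c < 2 ^ D) : (ref (tileVar K D t i c) : PRE Unit).toTokens =
      [.backslash, .digit true] ++ (lowBits K t).reverse.map .digit ++
        (lowBits (K + 1) i).reverse.map .digit ++ (lowBits D c).reverse.map .digit := by
  have h : tileVar K D t i c = 2 ^ (K + (K + 1) + D) + ((t * 2 ^ (K + 1) + i) * 2 ^ D + c) := by
    rw [tileVar]; ring
  have hlt : (t * 2 ^ (K + 1) + i) * 2 ^ D + c < 2 ^ (K + (K + 1) + D) := by
    have h₁ := tile_lt ht hi
    rw [show 2 * K + 1 = K + (K + 1) by ring] at h₁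
    rw [pow_add _ (K + (K + 1))]
    nlinarith
  rw [toTokens, h, bits_two_pow_add _ _ hlt, lowBits_add _ _ _ _ hc, lowBits_add _ _ _ _ hi]
  simp

end PRE

namespace Complexity.CProg

open Prog PRE

theorem flatMap_range_replicate {α β : Type} (f : α → List β) (n k : ℕ) (a : α) :
    ((List.range n).flatMap fun _ => (List.replicate k a).flatMap f) =
      (List.replicate (n * k) a).flatMap f := by
  induction n with
  | zero => simp
  | succ n ih => rw [List.range_succ, List.flatMap_append, ih, Nat.succ_mul, List.replicate_add,
      List.flatMap_append, List.flatMap_singleton]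

/-! ### Correctness and space of the printing program. -/

section

variable {Γ : Type} {w : List Γ} {K D t i : ℕ} {ℓ : List Bool}

/-- The pieces of a reference to a variable for a tile. -/
def refPieces (D : ℕ) (rh rl : Reg) (c : Option Γ → ℕ) : List (Piece Γ (PREToken Unit)) :=
  [.tok fun _ => .backslash, .tok fun _ => .digit true, .reg rh .digit, .reg rl .digit] ++
    (List.range D).reverse.map fun j => .tok fun x => .digit ((lowBits D (c x)).getD j false)

theorem sem_print_ctr {Δ : Type} {a b : Bool} {p : ℕ} {o g : List Δ} {l : List (Piece Γ Δ)}
    (h : l.flatMap (Piece.out (regs K ℓ t i) (Machine.readInput w p)) = g) :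
    Sem w (print l) (ctr K ℓ t i a b p o) (ctr K ℓ t i a b p (o ++ g)) := h ▸ sem_print

theorem out_refPieces {R : Reg → List Bool} {rh rl : Reg} {c : Option Γ → ℕ} {x : Option Γ}
    (hh : R rh = lowBits K t) (hl : R rl = lowBits (K + 1) i) (ht : t < 2 ^ K)
    (hi : i < 2 ^ (K + 1)) (hc : c x < 2 ^ D) :
    (refPieces D rh rl c).flatMap (Piece.out R x) = (ref (tileVar K D t i (c x))).toTokens := by
  have h : (List.range D).map (fun j => (lowBits D (c x)).getD j false) = lowBits D (c x) := by
    refine List.ext_getElem (by simp) fun j h₁ h₂ => ?_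
    rw [List.getElem_map, List.getElem_range, List.getD_eq_getElem _ _ h₂]
  rw [toTokens_ref_tileVar ht hi hc, ← hh, ← hl]
  conv_rhs => rw [← h]
  rw [refPieces, List.flatMap_append, List.flatMap_map]
  simp [Piece.out, ← List.map_eq_flatMap, ← List.map_reverse]

/-- The pieces of a window. -/
def windowPieces (D : ℕ) (q : ℕ × ℕ × ℕ × ℕ) : List (Piece Γ (PREToken Unit)) :=
  refPieces D .hi .lo (fun _ => q.1) ++ refPieces D .hi .lo1 (fun _ => q.2.1) ++
    refPieces D .hi1 .lo (fun _ => q.2.2.1) ++ refPieces D .hi1 .lo1 (fun _ => q.2.2.2)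

theorem out_windowPieces {q : ℕ × ℕ × ℕ × ℕ} {x : Option Γ} (ht : t < 2 ^ K) (hi : i < 2 ^ (K + 1))
    (hq : ∀ c ∈ [q.1, q.2.1, q.2.2.1, q.2.2.2], c < 2 ^ D) :
    (windowPieces D q).flatMap (Piece.out (regs K ℓ t i) x) = (windowExpr K D t i q).toTokens := by
  have ht' := mod_two_pow_lt (t + 1) K
  have hi' := mod_two_pow_lt (i + 1) (K + 1)
  have eh := (lowBits_succ_mod ht).symm
  have el := (lowBits_succ_mod hi).symm
  simp only [List.mem_cons, List.not_mem_nil, or_false, forall_eq_or_imp, forall_eq] at hq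
  obtain ⟨h₁, h₂, h₃, h₄⟩ := hq
  rw [windowExpr, toTokens_catList, windowPieces, List.flatMap_append, List.flatMap_append,
    List.flatMap_append, out_refPieces rfl rfl ht hi h₁, out_refPieces rfl el ht hi' h₂,
    out_refPieces eh rfl ht' hi h₃, out_refPieces eh el ht' hi' h₄]
  simp

/-- The pieces of the check of a window. -/
def checkPieces (D : ℕ) (q : ℕ × ℕ × ℕ × ℕ) (Q : List (ℕ × ℕ × ℕ × ℕ)) :
    List (Piece Γ (PREToken Unit)) :=
  (.tok fun _ => .lparen) :: (windowPieces D q ++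
    (Q.flatMap fun q => (.tok fun _ => .bar) :: windowPieces D q) ++ [.tok fun _ => .rparen])

theorem out_checkPieces {q : ℕ × ℕ × ℕ × ℕ} {Q : List (ℕ × ℕ × ℕ × ℕ)} {x : Option Γ}
    (ht : t < 2 ^ K) (hi : i < 2 ^ (K + 1))
    (hq : ∀ p ∈ q :: Q, ∀ c ∈ [p.1, p.2.1, p.2.2.1, p.2.2.2], c < 2 ^ D) :
    (checkPieces D q Q).flatMap (Piece.out (regs K ℓ t i) x) =
      (windowCheck K D q Q t i).toTokens := by
  rw [windowCheck, toTokens, toTokens_altList, checkPieces, List.flatMap_cons, List.flatMap_append,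
    List.flatMap_append, out_windowPieces ht hi (hq q (by simp)), List.flatMap_assoc,
    List.flatMap_map]
  have : ∀ p ∈ Q, (((.tok fun _ => .bar) :: windowPieces D p).flatMap
      (Piece.out (regs K ℓ t i) x)) = .bar :: (windowExpr K D t i p).toTokens := fun p hp => by
    rw [List.flatMap_cons, out_windowPieces ht hi (hq p (by simp [hp]))]
    rfl
  rw [List.flatMap_congr this]
  simp [Piece.out]

/-- The pieces of a constant list. -/
def constPieces (l : List (PREToken Unit)) : List (Piece Γ (PREToken Unit)) :=
  l.map fun a => .tok fun _ => a

theorem out_constPieces (R : Reg → List Bool) (x : Option Γ) (l : List (PREToken Unit)) :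
    (constPieces l).flatMap (Piece.out R x) = l := by
  simp [constPieces, Piece.out, List.flatMap_map]

/-- Write down the expression for tilings, where `k₀` is the code in the first column of row `0`,
and `k` gives the codes in the other columns, followed by a string. -/
def tilingProg (c D : ℕ) (q : ℕ × ℕ × ℕ × ℕ) (Q : List (ℕ × ℕ × ℕ × ℕ)) (k₀ : ℕ)
    (k : Option Γ → ℕ) : CProg Γ (PREToken Unit) :=
  seqs [setup c,
    loopHi (loopLo (print (constPieces ((List.replicate 2 (chooser D)).flatMap toTokens)))),
    loopHi (loopLo (print (checkPieces D q Q))),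
    print (refPieces D .hi .lo fun _ => k₀),
    nextLo,
    move .right,
    loopLo (seq (print (refPieces D .hi .lo k)) (move .right)),
    print (constPieces [.sep]),
    loopHi (loopLo (print (constPieces ((List.replicate 6 ()).flatMap fun a => [.letter a])))),
    loopLo (print (constPieces ((List.replicate 1 ()).flatMap fun a => [.letter a])))]

theorem det_tilingProg (c D : ℕ) (q : ℕ × ℕ × ℕ × ℕ) (Q : List (ℕ × ℕ × ℕ × ℕ)) (k₀ : ℕ)
    (k : Option Γ → ℕ) : (tilingProg c D q Q k₀ k).Det := by
  refine det_seqs fun p hp => ?_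
  simp only [List.mem_cons, List.not_mem_nil, or_false] at hp
  rcases hp with rfl | rfl | rfl | rfl | rfl | rfl | rfl | rfl | rfl | rfl
  exacts [det_setup, det_loopHi (det_loopLo (det_print _)), det_loopHi (det_loopLo (det_print _)),
    det_print _, det_nextLo, trivial, det_loopLo ⟨det_print _, trivial⟩, det_print _,
    det_loopHi (det_loopLo (det_print _)), det_loopLo (det_print _)]

theorem nonShrinking_tilingProg (c D : ℕ) (q : ℕ × ℕ × ℕ × ℕ) (Q : List (ℕ × ℕ × ℕ × ℕ)) (k₀ : ℕ)
    (k : Option Γ → ℕ) : (tilingProg c D q Q k₀ k).NonShrinking := by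
  refine nonShrinking_seqs fun p hp => ?_
  simp only [List.mem_cons, List.not_mem_nil, or_false] at hp
  rcases hp with rfl | rfl | rfl | rfl | rfl | rfl | rfl | rfl | rfl | rfl
  exacts [nonShrinking_setup, nonShrinking_loopHi (nonShrinking_loopLo (nonShrinking_print _)),
    nonShrinking_loopHi (nonShrinking_loopLo (nonShrinking_print _)), nonShrinking_print _,
    nonShrinking_next _ _, nonShrinking_move _,
    nonShrinking_loopLo ⟨nonShrinking_print _, nonShrinking_move _⟩, nonShrinking_print _,
    nonShrinking_loopHi (nonShrinking_loopLo (nonShrinking_print _)),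
    nonShrinking_loopLo (nonShrinking_print _)]

/-- The codes in row `0`. -/
def rowCodes (k₀ : ℕ) (k : Option Γ → ℕ) (w : List Γ) (i : ℕ) : ℕ :=
  if i = 0 then k₀ else k (Machine.readInput w i)

/-- The head stops at the right endmarker, while the columns go on; all these columns carry the same
symbol. -/
theorem readInput_min {i : ℕ} :
    Machine.readInput w (min i (w.length + 1)) = Machine.readInput w i := by
  rcases le_total i (w.length + 1) with h | h
  · rw [min_eq_left h]
  · rw [min_eq_right h, Machine.readInput, Machine.readInput, if_neg (by omega),
      if_neg (by omega), List.getElem?_eq_none (by omega), List.getElem?_eq_none (by omega)]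

/-- The length of the string in the instance for a torus. -/
def unaryLength (K : ℕ) : ℕ := 6 * (2 ^ K * 2 ^ (K + 1)) + 2 ^ (K + 1)

/-- The instance is regrouped into nested loops over rows and columns. Two choosers per tile account
for the padding as well, and column `0` of the input row is separated since it carries the left
endmarker. -/
theorem encodeInstance_tilingExpr {q : ℕ × ℕ × ℕ × ℕ} {Q : List (ℕ × ℕ × ℕ × ℕ)} {ini : ℕ → ℕ} :
    encodeInstance (tilingExpr K D q Q ini) (List.replicate (unaryLength K) ()) =
      ((List.range (2 ^ K)).flatMap fun _ => (List.range (2 ^ (K + 1))).flatMap fun _ =>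
        (List.replicate 2 (chooser D)).flatMap toTokens) ++
      ((List.range (2 ^ K)).flatMap fun t => (List.range (2 ^ (K + 1))).flatMap fun i =>
        (windowCheck K D q Q t i).toTokens) ++
      (ref (tileVar K D 0 0 (ini 0))).toTokens ++
      ((List.range (2 ^ (K + 1) - 1)).flatMap fun i =>
        (ref (tileVar K D 0 (1 + i) (ini (1 + i)))).toTokens) ++ [.sep] ++
      ((List.range (2 ^ K)).flatMap fun _ => (List.range (2 ^ (K + 1))).flatMap fun _ =>
        (List.replicate 6 ()).flatMap fun a => [.letter a]) ++
      (List.range (2 ^ (K + 1))).flatMap fun _ =>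
        (List.replicate 1 ()).flatMap fun a => [.letter a] := by
  have hr : List.range (2 ^ (K + 1)) = 0 :: (List.range (2 ^ (K + 1) - 1)).map (1 + ·) := by
    conv_lhs => rw [← Nat.sub_add_cancel (Nat.one_le_two_pow (n := K + 1)), List.range_succ_eq_map]
    rw [List.cons_inj_right]
    exact List.map_congr_left fun a _ => Nat.succ_eq_one_add a
  have h₁ : (List.replicate (unaryLength K) ()).map PREToken.letter =
      (List.replicate (2 ^ K * (2 ^ (K + 1) * 6)) ()).flatMap (fun a => [PREToken.letter a]) ++
        (List.replicate (2 ^ (K + 1) * 1) ()).flatMap fun a => [PREToken.letter a] := by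
    rw [← List.flatMap_append, ← List.replicate_add, ← List.map_eq_flatMap, unaryLength]
    congr 2
    ring
  rw [encodeInstance, h₁, tilingExpr, toTokens_catList, choosers_eq, tilingChecks]
  simp only [flatMap_range_replicate, List.flatMap_append, List.flatMap_assoc, List.flatMap_map]
  rw [show 2 ^ (2 * K + 2) = 2 ^ K * (2 ^ (K + 1) * 2) by ring]
  conv_lhs => enter [1, 2, 2]; rw [hr]
  simp only [List.flatMap_cons, List.flatMap_map, List.append_assoc, List.cons_append,
    List.nil_append]

theorem sem_tilingProg {c D : ℕ} {q : ℕ × ℕ × ℕ × ℕ} {Q : List (ℕ × ℕ × ℕ × ℕ)} {k₀ : ℕ}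
    {k : Option Γ → ℕ} (hq : ∀ p ∈ q :: Q, ∀ c ∈ [p.1, p.2.1, p.2.2.1, p.2.2.2], c < 2 ^ D)
    (hk₀ : k₀ < 2 ^ D) (hk : ∀ x, k x < 2 ^ D) : ∃ p, Sem w (tilingProg c D q Q k₀ k) .init
      (ctr (width c w.length) (Nat.bits w.length) 0 0 false false p
        (encodeInstance (tilingExpr (width c w.length) D q Q (rowCodes k₀ k w))
          (List.replicate (unaryLength (width c w.length)) ()))) := by
  set K := width c w.length with hK
  have h2 : 2 ≤ 2 ^ (K + 1) := by
    rw [pow_succ]; have := Nat.one_le_two_pow (n := K); omega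
  refine ⟨min (2 ^ (K + 1)) (w.length + 1), ?_⟩
  rw [encodeInstance_tilingExpr]
  refine .seqs_cons sem_setup ?_
  rw [← hK]
  refine .seqs_cons (sem_loop_all (g := fun _ _ => (List.replicate 2 (chooser D)).flatMap toTokens)
    fun t _ i _ o => ?_) ?_
  · exact sem_print_ctr (out_constPieces _ _ _)
  refine .seqs_cons (sem_loop_all (g := fun t i => (windowCheck K D q Q t i).toTokens)
    fun t ht i hi o => ?_) ?_
  · exact sem_print_ctr (out_checkPieces ht hi hq)
  refine .seqs_cons sem_print ?_
  rw [out_refPieces rfl rfl (Nat.two_pow_pos K) (Nat.two_pow_pos (K + 1)) hk₀]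
  refine .seqs_cons sem_nextLo ?_
  -- There are at least two columns, so going from column `0` to column `1` raises no flag.
  rw [decide_eq_false (by rw [zero_add, Nat.mod_eq_of_lt (by omega)]; omega), Bool.or_false,
    zero_add]
  refine .seqs_cons (sem_move .right) ?_
  -- In column `i` the head is at `min i (w.length + 1)`; this is the case `i = 1`.
  rw [show Machine.moveInput w 0 .right = min 1 (w.length + 1) by simp [Machine.moveInput]]
  refine .seqs_cons (sem_loopLo (p := fun i => min i (w.length + 1)) (m := 2 ^ (K + 1) - 1)
    (g := fun i => (ref (tileVar K D 0 i (rowCodes k₀ k w i))).toTokens) (by omega) (by omega)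
    fun i h₁ hi o => ?_) ?_
  · refine Sem.seq (sem_print_ctr ?_) ((sem_move .right).of_eq
      (mem_congr (fun _ => rfl) rfl (fun _ => rfl) ?_ rfl))
    · rw [out_refPieces rfl rfl (Nat.two_pow_pos K) hi (hk _), readInput_min, rowCodes,
        if_neg (by omega)]
    · simp only [Machine.moveInput]
      omega
  refine .seqs_cons sem_print ?_
  rw [out_constPieces]
  refine .seqs_cons (sem_loop_all
    (g := fun _ _ => (List.replicate 6 ()).flatMap fun a => [.letter a])
    fun t _ i _ o => ?_) ?_
  · exact sem_print_ctr (out_constPieces _ _ _)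
  refine .seqs_cons ((sem_loopLo (p := fun _ => min (2 ^ (K + 1)) (w.length + 1)) (j := 0)
    (g := fun _ => (List.replicate 1 ()).flatMap fun a => [.letter a]) (by omega) (zero_add _)
    fun i _ hi o => ?_).of_eq ?_) .seqs_nil
  · exact sem_print_ctr (out_constPieces _ _ _)
  · simp [rowCodes]

theorem size_le_log (n : ℕ) : n.size ≤ Nat.log 2 n + 1 :=
  Nat.size_le.mpr (Nat.lt_pow_succ_log_self (by norm_num) n)

/-- Four counters of width `K` or `K + 1`, the digits of the length and five flags, with `K` equal
to `width c n`. -/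
theorem height_ctr_le {a b : Bool} {c n p : ℕ} {o : List (PREToken Unit)} :
    (ctr (width c n) (Nat.bits n) t i a b p o).height ≤ (8 * c + 20) * (Nat.log 2 n + 1) := by
  have hs := size_le_log n
  have : (ctr (width c n) (Nat.bits n) t i a b p o).height = 4 * width c n + 2 + n.size + 5 := by
    rw [Mem.height, Fintype.sum_prod_type]
    simp only [Finset.sum, Finset.univ, Fintype.elems, ctr, mem]
    simp [regs, flags, Nat.size_eq_bits_len]
    ring
  rw [this, width]
  nlinarith [Nat.zero_le (c * (Nat.log 2 n + 1 - n.size))]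

theorem logSpaceComputable_tilings (c D : ℕ) {q : ℕ × ℕ × ℕ × ℕ}
    {Q : List (ℕ × ℕ × ℕ × ℕ)} {k₀ : ℕ}
    {k : Option Γ → ℕ} (hq : ∀ p ∈ q :: Q, ∀ c ∈ [p.1, p.2.1, p.2.2.1, p.2.2.2], c < 2 ^ D)
    (hk₀ : k₀ < 2 ^ D) (hk : ∀ x, k x < 2 ^ D) :
    LogSpaceComputable fun w : List Γ =>
      encodeInstance (tilingExpr (width c w.length) D q Q (rowCodes k₀ k w))
        (List.replicate (unaryLength (width c w.length)) ()) :=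
  .of_prog _ (det_tilingProg c D q Q k₀ k) (nonShrinking_tilingProg c D q Q k₀ k) (8 * c + 20)
    fun _ => let ⟨_, t, h⟩ := sem_tilingProg hq hk₀ hk; ⟨t, _, h, rfl, height_ctr_le⟩

end

end Complexity.CProg

/-! ## Hardness -/

namespace Complexity

/-- Since `n < 2 ^ n.size`, powers of `n` are bounded by powers of two whose exponents are multiples
of `n.size`. A product adds the factors `c`, and a sum costs at most one more factor of two. -/
theorem exists_pow_bound (p : Polynomial ℕ) :
    ∃ c : ℕ, ∀ n : ℕ, p.eval n ≤ 2 ^ CProg.width c n := by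
  have hmono : ∀ {c d : ℕ} (n : ℕ), c ≤ d → 2 ^ CProg.width c n ≤ 2 ^ CProg.width d n :=
    fun n h => Nat.pow_le_pow_right (by norm_num) (Nat.mul_le_mul_right _ h)
  have hC : ∀ a n : ℕ, a ≤ 2 ^ CProg.width a n := fun a n =>
    Nat.lt_two_pow_self.le.trans
      (Nat.pow_le_pow_right (by norm_num) (Nat.le_mul_of_pos_right _ (by omega)))
  have hX : ∀ n : ℕ, n ≤ 2 ^ CProg.width 1 n := fun n =>
    (Nat.lt_size_self n).le.trans
      (Nat.pow_le_pow_right (by norm_num) (by rw [CProg.width]; omega))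
  have hmul : ∀ c d n : ℕ, 2 ^ CProg.width c n * 2 ^ CProg.width d n = 2 ^ CProg.width (c + d) n :=
    fun c d n => by rw [← pow_add, CProg.width, CProg.width, CProg.width, add_mul]
  induction p using Polynomial.induction_on with
  | C a => exact ⟨a, fun n => by simpa using hC a n⟩
  | add p q hp hq =>
    obtain ⟨c, hc⟩ := hp
    obtain ⟨d, hd⟩ := hq
    refine ⟨1 + (c + d), fun n => ?_⟩
    have h₁ := (hc n).trans (hmono n (Nat.le_add_right c d))
    have h₂ := (hd n).trans (hmono n (Nat.le_add_left d c))
    have h₃ : 2 ≤ 2 ^ CProg.width 1 n := Nat.le_self_pow (by rw [CProg.width]; omega) 2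
    rw [Polynomial.eval_add, ← hmul]
    nlinarith
  | monomial m a h =>
    obtain ⟨c, hc⟩ := h
    refine ⟨c + 1, fun n => ?_⟩
    rw [pow_succ, ← mul_assoc, Polynomial.eval_mul, Polynomial.eval_X, ← hmul]
    exact Nat.mul_le_mul (hc n) (hX n)

instance : Finite Dir := by
  refine Finite.of_injective (β := Option Bool) (fun d => match d with
    | .left => none
    | .stay => some false
    | .right => some true) ?_
  intro x y h
  cases x <;> cases y <;> simp_all

namespace Machine

variable {Γ : Type} (M : Machine Γ Empty)

theorem finite_cell [Finite Γ] : Finite M.Cell := by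
  have := M.finite_Q
  have := M.finite_A
  have := M.finite_ι
  have := InKind.finite (Γ := Γ)
  have : Finite (Action M.Q M.ι M.A Empty) := by
    refine Finite.of_injective (β := M.Q × Dir × (M.ι → M.A) × (M.ι → Dir) × Option Empty)
      (fun a => (a.next, a.inMove, a.write, a.move, a.emit)) ?_
    rintro ⟨⟩ ⟨⟩ h
    simpa using h
  have : Finite M.Shared := by
    refine Finite.of_injective
      (β := M.Q × Option Γ × (M.ι → M.A) × Action M.Q M.ι M.A Empty × Dir)
      (fun g => (g.state, g.input, g.scanned, g.action, g.dir)) ?_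
    rintro ⟨⟩ ⟨⟩ h
    simpa using h
  refine Finite.of_injective
    (β := Option (InKind Γ ⊕ (InKind Γ × Bool × (M.ι → M.A) × (M.ι → Bool) × M.Shared)))
    (fun c => match c with
      | .top => none
      | .ini k => some (.inl k)
      | .ord k h y hd g => some (.inr (k, h, y, hd, g))) ?_
  intro x y h
  cases x <;> cases y <;> simp_all

variable {M} {w : List Γ} {T N : ℕ} {R : List (M.Cell × M.Cell × M.Cell × M.Cell)}

theorem exists_isTableau_of_isTiling [NeZero N]
    (hR : ∀ p ∈ R, M.Window p.1 p.2.1 p.2.2.1 p.2.2.2) {τ : ℕ → ℕ → M.Cell}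
    (h : PRE.IsTiling R (fun i => .ini (.ofPos w i)) T N τ) : ∃ σ, M.IsTableau w T N σ := by
  refine ⟨fun t z => τ (t % T) z.val, fun t ht z => ?_, fun z => by simp, fun z => ?_⟩
  · have := hR _ (h.1 t ht z.val z.val_lt)
    simpa [Nat.mod_eq_of_lt ht, ZMod.val_add, ZMod.val_one_eq_one_mod] using this
  · simpa using h.2 _ z.val_lt

theorem IsTableau.exists_isTiling (hR : ∀ a b c d, M.Window a b c d → (a, b, c, d) ∈ R)
    {σ : ℕ → ZMod N → M.Cell} (h : M.IsTableau w T N σ) :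
    ∃ τ, PRE.IsTiling R (fun i => .ini (.ofPos w i)) T N τ := by
  refine ⟨fun t i => σ t i, fun t ht i _ => ?_, fun i hi => ?_⟩
  · have hrow : ∀ z, σ ((t + 1) % T) z = σ (t + 1) z := fun z => by
      rcases (Nat.succ_le_of_lt ht).lt_or_eq with h' | h'
      · rw [Nat.mod_eq_of_lt h']
      · rw [← Nat.succ_eq_add_one, h', Nat.mod_self, h.2.1]
    simp only [hrow, ZMod.natCast_mod, Nat.cast_add, Nat.cast_one]
    exact hR _ _ _ _ (h.1 t ht i)
  · simp [h.2.2, ZMod.val_natCast, Nat.mod_eq_of_lt hi]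

end Machine

/-- Every language in NP is reducible to the problem whether an expression matches a string, no
matter whether some word or the particular word `s` has to be matched. -/
theorem InNP.exists_reduction {Γ : Type} [Finite Γ] {L : Language Γ} (hL : InNP L) :
    ∃ (r : List Γ → PRE Unit) (s : List Γ → List Unit),
      LogSpaceComputable (fun w => PRE.encodeInstance (r w) (s w)) ∧
      (∀ w, (r w).Valid ∧ (r w).StarFree) ∧ (∀ w ∈ L, s w ∈ (r w).language) ∧
      ∀ w, (∃ u, u ∈ (r w).language) → w ∈ L := by
  obtain ⟨M, p, hM⟩ := hL
  -- The torus must have room for the accepting computation with its three extra rows, and for the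
  -- input with its endmarkers.
  obtain ⟨c, hc⟩ := exists_pow_bound (p + Polynomial.X + Polynomial.C 3)
  have hfin := M.finite_cell
  obtain ⟨m, ⟨e⟩⟩ := Finite.exists_equiv_fin M.Cell
  -- The shift by two matches the first inner variable of a chooser; the codes stay below `2 ^ (m +
  -- 2)` and thus fit into `m + 2` digits.
  set code : M.Cell → ℕ := fun x => e x + 2 with hcode
  have hinj : Function.Injective code := fun x y h =>
    e.injective (Fin.ext (by simpa [hcode] using h))
  have hlt : ∀ x, code x < 2 ^ (m + 2) := fun x => by
    have := Nat.lt_two_pow_self (n := m + 2)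
    have := (e x).isLt
    simp only [hcode]
    omega
  have hbd : ∀ x, 2 ≤ code x ∧ code x ≤ 2 ^ (m + 2) := fun x => ⟨by simp [hcode], (hlt x).le⟩
  set W : Set (M.Cell × M.Cell × M.Cell × M.Cell) := {p | M.Window p.1 p.2.1 p.2.2.1 p.2.2.2}
  set Q := W.toFinite.toFinset.toList with hQ
  -- An alternation needs a first branch. The empty window serves for it; its repetition in `Q` does
  -- no harm.
  have hmem : ∀ p, p ∈ (.top, .top, .top, .top) :: Q ↔ M.Window p.1 p.2.1 p.2.2.1 p.2.2.2 := by
    intro p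
    rw [List.mem_cons, hQ, Finset.mem_toList, Set.Finite.mem_toFinset]
    exact ⟨fun h => h.elim (fun h => h ▸ .top) id, .inr⟩
  set K : List Γ → ℕ := fun w => CProg.width c w.length
  have hK : ∀ w, p.eval w.length + w.length + 3 ≤ 2 ^ K w := fun w => by
    simpa using hc w.length
  have hpow : ∀ w, 2 ^ (K w + 1) = 2 * 2 ^ K w := fun w => pow_succ' _ _
  have hrow : ∀ w i, CProg.rowCodes (code (.ini .left)) (fun x => code (.ini (x.elim .right .sym)))
      w i = code (.ini (.ofPos w i)) := fun w i => by
    cases i <;> simp [CProg.rowCodes, InKind.ofPos, Machine.readInput]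
  refine ⟨fun w => PRE.tilingExpr (K w) (m + 2) (PRE.codes code (.top, .top, .top, .top))
      (Q.map (PRE.codes code)) fun i => code (.ini (.ofPos w i)),
    fun w => List.replicate (CProg.unaryLength (K w)) (), ?_,
    fun w => ⟨PRE.tilingExpr_valid (by omega) (PRE.codesWithin hbd), PRE.tilingExpr_starFree⟩,
    fun w hw => ?_, fun w hw => ?_⟩
  · have := CProg.logSpaceComputable_tilings c (m + 2)
      (q := PRE.codes code (.top, .top, .top, .top)) (Q := Q.map (PRE.codes code))
      (k₀ := code (.ini .left)) (k := fun x : Option Γ => code (.ini (x.elim .right .sym)))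
      (fun p hp => by
        rw [← List.map_cons] at hp
        obtain ⟨p, -, rfl⟩ := List.mem_map.mp hp
        simp [PRE.codes, hlt]) (hlt _) fun _ => hlt _
    simpa only [show ∀ w, CProg.rowCodes _ _ w = _ from fun w => funext (hrow w)] using this
  · obtain ⟨t, ht, ha⟩ := (hM w).1 hw
    have := hK w
    have := hpow w
    obtain ⟨σ, hσ⟩ := ha.exists_isTableau (T := 2 ^ K w) (N := 2 ^ (K w + 1)) (by omega) (by omega)
      (by omega)
    obtain ⟨τ, hτ⟩ := hσ.exists_isTiling fun a b c d h => (hmem (a, b, c, d)).mpr h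
    exact PRE.replicate_mem_language (by omega) hbd hτ
  · have := hK w
    have := hpow w
    obtain ⟨τ, hτ⟩ := PRE.isTiling_of_matches (by omega) hinj hbd hw
    obtain ⟨σ, hσ⟩ := Machine.exists_isTableau_of_isTiling (fun p hp => (hmem p).mp hp) hτ
    exact (hM w).2 (hσ.accepts (by omega) (by omega) (by omega))

end Complexity

/-! ### The two reductions. -/

namespace PRE

theorem logSpaceReducible_starFreeMatching {Γ : Type} [Finite Γ] {L : Language Γ}
    (hL : Complexity.InNP L) : Complexity.LogSpaceReducible L (starFreeMatching Unit) := by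
  obtain ⟨r, s, hf, hv, h₁, h₂⟩ := hL.exists_reduction
  refine ⟨_, hf, fun w => ⟨fun hw => ⟨r w, s w, (hv w).1, (hv w).2, rfl, s w, h₁ w hw,
    List.infix_rfl⟩, ?_⟩⟩
  rintro ⟨r', s', hv', hs', he, u, hu, -⟩
  -- The instance could a priori be positive through another expression with the same written form;
  -- unique readability excludes this.
  obtain ⟨rfl, -⟩ := encodeInstance_inj (hv w).1.1 (hv w).2 hv'.1 hs' he
  exact h₂ w ⟨u, hu⟩

theorem logSpaceReducible_starFreeMembership {Γ : Type} [Finite Γ] {L : Language Γ}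
    (hL : Complexity.InNP L) : Complexity.LogSpaceReducible L (starFreeMembership Unit) := by
  obtain ⟨r, s, hf, hv, h₁, h₂⟩ := hL.exists_reduction
  refine ⟨_, hf, fun w => ⟨fun hw => ⟨r w, s w, (hv w).1, (hv w).2, rfl, h₁ w hw⟩, ?_⟩⟩
  rintro ⟨r', s', hv', hs', he, hu⟩
  obtain ⟨rfl, -⟩ := encodeInstance_inj (hv w).1.1 (hv w).2 hv'.1 hs' he
  exact h₂ w ⟨_, hu⟩

end PRE

theorem theorem7 :
    Complexity.NPCompleteLogSpace (PRE.starFreeMatching Unit) ∧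
      Complexity.NPCompleteLogSpace (PRE.starFreeMembership Unit) :=
  ⟨⟨PRE.starFreeMatching_inNP, fun _ _ _ hL => PRE.logSpaceReducible_starFreeMatching hL⟩,
    PRE.starFreeMembership_inNP, fun _ _ _ hL => PRE.logSpaceReducible_starFreeMembership hL⟩
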